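/- For integers $k\ge 0$, $Q\ge 1$, $q\ge 2$, $N\ge 1$ and $a$, put $$V_k(Q;q,a):=\frac1Q\sum_{m \bmod Q}\Bigg(\sum_{\substack{1\le n\le N\\ n\equiv a \bmod q}}\bigg(\Big(\frac{\varphi(Q)}{Q}\Big)^{-1}1_{(n+m,Q)=1}-1\bigg)\Bigg)^k ,$$ where $0^0=1$. Let $\mu_k$ be the $k$-th moment of the standard normal distribution, that is, $\mu_k=1\cdot3\cdots(k-1)$ if $k$ is even (so $\mu_0=1$) and $\mu_k=0$ if $k$ is odd. **Proposition 2.2.** Let $k\ge 1$ be an integer. There is a constant $C>0$ depending only on $k$ such that for all integers $Q\ge1$, $q\ge2$, $a$ and $N$ with $(q,Q)=1$, $(a,q)=1$ and $N\ge 2q$, $$\left|V_k(Q;q,a)-\mu_k\,V_2(Q;q,a)^{k/2}\right|\le C\left(\frac Nq\right)^{\frac k2-\frac1{7k}}\left(\frac{\varphi(Q)}{Q}\right)^{-2^k-\frac k2}.$$ For $k=0$ one has $V_0(Q;q,a)=\mu_0V_2(Q;q,a)^0$ exactly (both sides are $1$). -/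

import Mathlib

open scoped Nat

/-- The `k`-th moment `μ_k` of the standard normal distribution:
`1 · 3 ⋯ (k - 1)` if `k` is even (with `μ_0 = 1`), and `0` if `k` is odd. -/
def gaussMoment (k : ℕ) : ℕ :=
  if Even k then (k - 1)‼ else 0

/-- The integers `1 ≤ n ≤ N` with `n ≡ a (mod q)`. -/
def progression (N q : ℕ) (a : ℤ) : Finset ℕ :=
  (Finset.Icc 1 N).filter (fun n : ℕ => (n : ℤ) ≡ a [ZMOD (q : ℤ)])

/-- The sum over `n` in the progression of `(φ(Q)/Q)⁻¹ 1_{(n+m,Q)=1} - 1`. -/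
noncomputable def normalizedCount (Q q : ℕ) (a : ℤ) (N m : ℕ) : ℝ :=
  ∑ n ∈ progression N q a,
    (((Nat.totient Q : ℝ) / (Q : ℝ))⁻¹ * (if Nat.Coprime (n + m) Q then (1 : ℝ) else 0) - 1)

/-- `V_k(Q;q,a)` (which also depends on `N`): the average over the residues `m` modulo `Q`
of the `k`-th power of the normalized count. -/
noncomputable def momentV (k Q q : ℕ) (a : ℤ) (N : ℕ) : ℝ :=
  (1 / (Q : ℝ)) * ∑ m ∈ Finset.range Q, normalizedCount Q q a N m ^ k

/-! Coprimality to Q depends only on the radical of Q, and multiplication by the inverse of q turns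
the progression into an interval. So V_k is the k-th moment of the normalized count of units among
y, ..., y + h - 1, for y uniform modulo the radical and h comparable to N/q
(`momentV_eq_unitMoment`). It remains to study `unitMoment k Q h` for squarefree Q; primes up to h
and primes beyond h are treated by different methods.

Suppose first that all primes of Q are at most h. Expanding in characters, the k-th moment is the
sum of the products of Fourier coefficients over k-tuples of frequencies with sum zero
(`zeroSumMoment_fourierCoef`). A coefficient at a frequency of order r is at most about 2^ω(r)/r
times a kernel of size min(h, 1/distance to 0). The tuples in which the first entry is opposite to
another one give (k-1) V_2 times the (k-2)-nd moment, which is the Gaussian recursion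
(`norm_zeroSum_recursion_le`). In every other tuple the order of the first entry divides the product
of the other orders, so either it is at most D^(k-1), or it has a common divisor larger than D with
one of them (`addOrderOf_le_or_gcd`).

Both cases are estimated by `sum_zeroSum_prod_le_of_sum_sq_le`: a sum over zero-sum tuples is at
most the product of the ℓ² sizes of the factors on elements of given order, times a product of 1 +
O(1/p) over the primes of Q. That product is smaller than any power of h because these primes are at
most h. A small order reduces the size of the first factor. A large common divisor allows the two
entries to be merged into their sum, and the merged function is smaller by a factor √D
(`exists_sum_sq_gcdConv_le`). Taking D^(k-1) = √h gives a power saving that exceeds 1/(7k).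

A prime p > h removes at most one integer of the interval. Conditionally on the residue modulo Q,
passing to Qp therefore adds a centred two-point variable, and the k-th moment grows by binom(k,2)
times its variance times the (k-2)-nd moment, up to lower order; μ_k V_2^(k/2) grows in the same way
(`abs_gaussDev_mul_prime_le`). The error is O(1/p) relative to the scale, while the scale √h Q/φ(Q)
itself grows by (1 - 1/p)^(-1), which absorbs the error. Hence the constants do not depend on the
number of primes, and the total loss is (Q/φ(Q))^(k+1), within the allowed power. -/

/-! ### Multilinear convolutions on cyclic groups -/

/-- Summing over tuples with vanishing sum, when the `j`-th factor is constant, leaves the other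
coordinates free. -/
lemma sum_zeroSum_prod_succAbove {H : Type*} [AddCommGroup H] [Fintype H] [DecidableEq H] {n : ℕ}
    (j : Fin (n + 1)) (g : Fin n → H → ℝ) :
    ∑ x : Fin (n + 1) → H with ∑ i, x i = 0, ∏ l, g l (x (j.succAbove l)) =
      ∏ l, ∑ y, g l y := by
  rw [Finset.sum_filter, ← (Fin.insertNthEquiv (fun _ => H) j).sum_comp, Fintype.sum_prod_type,
    Finset.sum_comm]
  rw [Finset.prod_univ_sum]
  simp only [Fintype.piFinset_univ]
  refine Finset.sum_congr rfl fun y _ => ?_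
  simp only [Fin.sum_univ_succAbove _ j, Fin.insertNthEquiv_apply, Fin.insertNth_apply_same,
    Fin.insertNth_apply_succAbove]
  rw [Finset.sum_eq_single (-∑ i, y i)]
  · simp
  · intro b _ hb
    rw [if_neg]
    intro h
    exact hb (eq_neg_of_add_eq_zero_left h)
  · simp

/-- Cauchy–Schwarz for a multilinear convolution: two of the functions are measured in `ℓ²`, the
others in `ℓ¹`. -/
lemma sum_zeroSum_prod_le {H : Type*} [AddCommGroup H] [Fintype H] [DecidableEq H] {k : ℕ}
    (g : Fin k → H → ℝ) (hg : ∀ i x, 0 ≤ g i x) {i j : Fin k} (hij : i ≠ j) :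
    ∑ x : Fin k → H with ∑ l, x l = 0, ∏ l, g l (x l) ≤
      √(∑ y, g i y ^ 2) * √(∑ y, g j y ^ 2) *
        ∏ l ∈ (Finset.univ.erase i).erase j, ∑ y, g l y := by
  obtain ⟨n, rfl⟩ : ∃ n, k = n + 1 := ⟨k - 1, by have := i.pos; omega⟩
  -- After squaring in Cauchy–Schwarz the j-th coordinate no longer occurs in the summand. The
  -- zero-sum condition determines it, so the sum factors over the other coordinates.
  have key : ∀ i j : Fin (n + 1), i ≠ j →
      ∑ x : Fin (n + 1) → H with ∑ l, x l = 0,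
        (g i (x i) ^ 2 * ∏ l ∈ (Finset.univ.erase i).erase j, g l (x l)) =
      (∑ y, g i y ^ 2) * ∏ l ∈ (Finset.univ.erase i).erase j, ∑ y, g l y := by
    intro i j hij
    have h1 : ∀ F : Fin (n + 1) → ℝ, ∀ c : ℝ,
        c * ∏ l ∈ (Finset.univ.erase i).erase j, F l =
          ∏ l : Fin n, if j.succAbove l = i then c else F (j.succAbove l) := by
      intro F c
      have h2 : c * ∏ l ∈ (Finset.univ.erase i).erase j, F l =
          ∏ l ∈ Finset.univ.erase j, if l = i then c else F l := by
        rw [Finset.erase_right_comm, ← Finset.mul_prod_erase (Finset.univ.erase j) _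
          (show i ∈ Finset.univ.erase j by simpa using hij)]
        rw [if_pos rfl]
        congr 1
        refine Finset.prod_congr rfl fun l hl => ?_
        rw [if_neg (Finset.ne_of_mem_erase hl)]
      rw [h2, ← Finset.prod_image (s := Finset.univ) (g := j.succAbove)
        (f := fun l => if l = i then c else F l)
        (by intro a _ b _ h; exact Fin.succAbove_right_injective h)]
      congr 1
      ext l
      simp
    rw [h1 (fun l => ∑ y, g l y)]
    have h3 := sum_zeroSum_prod_succAbove j
      (fun l y => if j.succAbove l = i then g i y ^ 2 else g (j.succAbove l) y)
    have h4 : ∀ l : Fin n, (∑ y, if j.succAbove l = i then g i y ^ 2 else g (j.succAbove l) y) =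
        if j.succAbove l = i then ∑ y, g i y ^ 2 else ∑ y, g (j.succAbove l) y := by
      intro l; split_ifs <;> rfl
    simp only [h4] at h3
    rw [← h3]
    refine Finset.sum_congr rfl fun x _ => ?_
    rw [h1 (fun l => g l (x l))]
    refine Finset.prod_congr rfl fun l _ => ?_
    by_cases h : j.succAbove l = i
    · rw [if_pos h, if_pos h, h]
    · rw [if_neg h, if_neg h]
  have hR : ∀ x : Fin (n + 1) → H, 0 ≤ ∏ l ∈ (Finset.univ.erase i).erase j, g l (x l) :=
    fun x => Finset.prod_nonneg fun l _ => hg l _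
  -- The remaining factors are shared equally, through a square root, between the two sides of
  -- Cauchy–Schwarz.
  have hprod : ∀ x : Fin (n + 1) → H, ∏ l, g l (x l) =
      (g i (x i) * √(∏ l ∈ (Finset.univ.erase i).erase j, g l (x l))) *
      (g j (x j) * √(∏ l ∈ (Finset.univ.erase i).erase j, g l (x l))) := by
    intro x
    rw [← Finset.mul_prod_erase Finset.univ _ (Finset.mem_univ i),
      ← Finset.mul_prod_erase (Finset.univ.erase i) _ (show j ∈ Finset.univ.erase i by
        simpa using hij.symm)]
    have := Real.mul_self_sqrt (hR x)
    linear_combination -(g i (x i) * g j (x j)) * this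
  have hi := key i j hij
  have hj := key j i hij.symm
  rw [Finset.erase_right_comm] at hj
  set W := ∏ l ∈ (Finset.univ.erase i).erase j, ∑ y, g l y with hW
  have hW0 : 0 ≤ W := Finset.prod_nonneg fun l _ => Finset.sum_nonneg fun y _ => hg l y
  simp only [hprod]
  refine (Real.sum_mul_le_sqrt_mul_sqrt _ _ _).trans (le_of_eq ?_)
  simp only [mul_pow, Real.sq_sqrt (hR _)]
  rw [hi, hj, Real.sqrt_mul (Finset.sum_nonneg fun _ _ => sq_nonneg _),
    Real.sqrt_mul (Finset.sum_nonneg fun _ _ => sq_nonneg _)]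
  have := Real.mul_self_sqrt hW0
  linear_combination (√(∑ y, g i y ^ 2) * √(∑ y, g j y ^ 2)) * this

/-- The part of `g` at `0` (for `b = false`) or away from `0` (for `b = true`). -/
noncomputable def zeroSplit {H : Type*} [Zero H] [DecidableEq H] (b : Prop) [Decidable b]
    (g : H → ℝ) (y : H) : ℝ :=
  if b then (if y = 0 then 0 else g y) else (if y = 0 then g y else 0)

lemma zeroSplit_nonneg {H : Type*} [Zero H] [DecidableEq H] (b : Prop) [Decidable b]
    {g : H → ℝ} (hg : ∀ y, 0 ≤ g y) (y : H) : 0 ≤ zeroSplit b g y := by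
  unfold zeroSplit
  split_ifs <;> simp [hg]

lemma prod_eq_sum_prod_zeroSplit {H : Type*} [Zero H] [DecidableEq H] {k : ℕ}
    (g : Fin k → H → ℝ) (x : Fin k → H) :
    ∏ i, g i (x i) = ∑ S : Finset (Fin k), ∏ i, zeroSplit (i ∈ S) (g i) (x i) := by
  have h : ∀ i, g i (x i) = (if x i = 0 then 0 else g i (x i)) +
      (if x i = 0 then g i (x i) else 0) := by
    intro i; split_ifs <;> simp
  rw [Finset.prod_congr rfl fun i _ => h i, Finset.prod_add, Finset.powerset_univ]
  refine Finset.sum_congr rfl fun S _ => ?_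
  simp only [zeroSplit, Finset.prod_ite, Finset.filter_mem_eq_inter, Finset.univ_inter,
    Finset.filter_notMem_eq_sdiff]

/-- The weight of the set `S` of coordinates that do not vanish. -/
noncomputable def splitWeight (p : ℝ) {k : ℕ} (S : Finset (Fin k)) : ℝ :=
  if S = ∅ then 1 else √p ^ S.card / p

/-- If S has at least two elements, two of them are kept in ℓ² and each of the others costs √p in
passing from ℓ¹ to ℓ², where p is the order of the group: altogether √p^(|S| - 2). If S is a single
index, no tuple has sum zero, since exactly one entry would be nonzero. Losing this term is what
makes the local factor 1 + O(1/p) and not 1 + O(1/√p). -/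
lemma sum_zeroSum_zeroSplit_le {H : Type*} [AddCommGroup H] [Fintype H] [DecidableEq H] {k : ℕ}
    (g : Fin k → H → ℝ) (hg : ∀ i x, 0 ≤ g i x) (S : Finset (Fin k)) :
    ∑ x : Fin k → H with ∑ l, x l = 0, ∏ l, zeroSplit (l ∈ S) (g l) (x l) ≤
      splitWeight (Fintype.card H) S *
        ∏ i, if i ∈ S then √(∑ y with y ≠ 0, g i y ^ 2) else g i 0 := by
  have hn : ∀ i y, 0 ≤ zeroSplit (i ∈ S) (g i) y := fun i y => zeroSplit_nonneg _ (hg i) y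
  have hp : (0 : ℝ) < Fintype.card H := by exact_mod_cast Fintype.card_pos
  have hR : 0 ≤ ∏ i, if i ∈ S then √(∑ y with y ≠ 0, g i y ^ 2) else g i 0 :=
    Finset.prod_nonneg fun i _ => by split_ifs; exacts [Real.sqrt_nonneg _, hg _ _]
  have hsq : ∀ i ∈ S, ∑ y, zeroSplit (i ∈ S) (g i) y ^ 2 = ∑ y with y ≠ 0, g i y ^ 2 := by
    intro i hi
    rw [Finset.sum_filter]
    refine Finset.sum_congr rfl fun y _ => ?_
    by_cases hy : y = 0 <;> simp [zeroSplit, hi, hy]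
  have hzero : ∀ i, i ∉ S → ∑ y, zeroSplit (i ∈ S) (g i) y = g i 0 := by
    intro i hi
    simp [zeroSplit, hi]
  have hl1 : ∀ i ∈ S, ∑ y, zeroSplit (i ∈ S) (g i) y ≤
      √(Fintype.card H) * √(∑ y with y ≠ 0, g i y ^ 2) := by
    intro i hi
    rw [← hsq i hi]
    have := Real.sum_mul_le_sqrt_mul_sqrt Finset.univ (fun _ : H => (1 : ℝ))
      (fun y => zeroSplit (i ∈ S) (g i) y)
    simpa using this
  unfold splitWeight
  rcases S.eq_empty_or_nonempty with rfl | ⟨i, hi⟩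
  · simp only [if_true, one_mul, Finset.notMem_empty, if_false]
    refine (Finset.sum_le_univ_sum_of_nonneg fun x => Finset.prod_nonneg fun i _ => hn i _).trans ?_
    have := (Finset.prod_univ_sum (fun _ : Fin k => (Finset.univ : Finset H))
      (fun i y => zeroSplit (i ∈ (∅ : Finset (Fin k))) (g i) y)).symm
    rw [Fintype.piFinset_univ] at this
    rw [this]
    exact le_of_eq (Finset.prod_congr rfl fun i _ => hzero i (by simp))
  · rw [if_neg (Finset.ne_empty_of_mem hi)]
    by_cases h2 : ∃ j ∈ S, j ≠ i
    · obtain ⟨j, hj, hji⟩ := h2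
      refine (sum_zeroSum_prod_le _ hn hji.symm).trans ?_
      rw [hsq i hi, hsq j hj]
      have hb : ∏ l ∈ (Finset.univ.erase i).erase j, ∑ y, zeroSplit (l ∈ S) (g l) y ≤
          ∏ l ∈ (Finset.univ.erase i).erase j, ((if l ∈ S then √(Fintype.card H) else 1) *
            if l ∈ S then √(∑ y with y ≠ 0, g l y ^ 2) else g l 0) := by
        refine Finset.prod_le_prod (fun l _ => Finset.sum_nonneg fun y _ => hn l y) fun l _ => ?_
        by_cases hl : l ∈ S
        · simpa only [if_pos hl] using hl1 l hl
        · simp only [if_neg hl, one_mul]; exact (hzero l hl).le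
      refine (mul_le_mul_of_nonneg_left hb (by positivity)).trans (le_of_eq ?_)
      rw [Finset.prod_mul_distrib]
      have hcard : √(Fintype.card H) ^ S.card = (Fintype.card H : ℝ) *
          ∏ l ∈ (Finset.univ.erase i).erase j, if l ∈ S then √(Fintype.card H : ℝ) else 1 := by
        have h3 : √(Fintype.card H) ^ S.card =
            ∏ l, if l ∈ S then √(Fintype.card H : ℝ) else 1 := by
          rw [Finset.prod_ite_mem]; simp
        rw [h3, ← Finset.mul_prod_erase Finset.univ _ (Finset.mem_univ i),
          ← Finset.mul_prod_erase (Finset.univ.erase i) _ (show j ∈ Finset.univ.erase i by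
          simpa using hji), if_pos hi, if_pos hj, ← mul_assoc, Real.mul_self_sqrt hp.le]
      rw [hcard, ← Finset.mul_prod_erase Finset.univ (fun i =>
          if i ∈ S then √(∑ y with y ≠ 0, g i y ^ 2) else g i 0) (Finset.mem_univ i),
          ← Finset.mul_prod_erase (Finset.univ.erase i) _ (show j ∈ Finset.univ.erase i by
          simpa using hji), if_pos hi, if_pos hj]
      field_simp
    · push Not at h2
      have : ∑ x : Fin k → H with ∑ l, x l = 0, ∏ l, zeroSplit (l ∈ S) (g l) (x l) = 0 := by
        refine Finset.sum_eq_zero fun x hx => ?_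
        simp only [Finset.mem_filter, Finset.mem_univ, true_and] at hx
        rw [Finset.prod_eq_zero_iff]
        by_contra hcon
        push Not at hcon
        have hl : ∀ l, l ≠ i → x l = 0 := by
          intro l hl
          by_contra h0
          have hlS : l ∉ S := fun h => hl (h2 l h)
          exact hcon l (Finset.mem_univ l) (by simp [zeroSplit, hlS, h0])
        rw [Finset.sum_eq_single i (fun l _ h => hl l h) (by simp)] at hx
        exact hcon i (Finset.mem_univ i) (by simp [zeroSplit, hi, hx])
      rw [this]
      exact mul_nonneg (by positivity) hR

lemma sum_zeroSum_prod_le_sum_splitWeight {H : Type*} [AddCommGroup H] [Fintype H]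
    [DecidableEq H] {k : ℕ} (g : Fin k → H → ℝ) (hg : ∀ i x, 0 ≤ g i x) :
    ∑ x : Fin k → H with ∑ l, x l = 0, ∏ l, g l (x l) ≤
      ∑ S : Finset (Fin k), splitWeight (Fintype.card H) S *
        ∏ i, if i ∈ S then √(∑ y with y ≠ 0, g i y ^ 2) else g i 0 := by
  rw [Finset.sum_congr rfl fun x _ => prod_eq_sum_prod_zeroSplit g x, Finset.sum_comm]
  exact Finset.sum_le_sum fun S _ => sum_zeroSum_zeroSplit_le g hg S

/-- The powers of √p cancel, so each nonempty S contributes κ^|S|/p, and the binomial theorem sums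
these. This is the local factor at p in the multilinear estimate. -/
lemma sum_splitWeight_mul_prod_le {p : ℝ} (hp : 0 < p) (κ : ℝ) (k : ℕ) :
    ∑ S : Finset (Fin k), splitWeight p S * ∏ i, (if i ∈ S then κ / √p else 1) ≤
      1 + (1 + κ) ^ k / p := by
  have h1 : ∀ S : Finset (Fin k), splitWeight p S * ∏ i, (if i ∈ S then κ / √p else 1) ≤
      (if S = ∅ then 1 else 0) + κ ^ S.card / p := by
    intro S
    rw [Finset.prod_ite_mem, Finset.univ_inter, Finset.prod_const]
    unfold splitWeight
    split_ifs with h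
    · subst h; simp; positivity
    · have : √p ≠ 0 := (Real.sqrt_pos.2 hp).ne'
      rw [div_pow]
      apply le_of_eq
      field_simp
      simp
  refine (Finset.sum_le_sum fun S _ => h1 S).trans (le_of_eq ?_)
  rw [Finset.sum_add_distrib, Finset.sum_ite_eq' Finset.univ ∅, if_pos (Finset.mem_univ _),
    ← Finset.sum_div]
  congr 2
  have := Fin.sum_pow_mul_eq_add_pow (n := k) κ 1
  simp only [one_pow, mul_one] at this
  rw [this, add_comm]

lemma ZMod.addOrderOf_eq_of_ne_zero {p : ℕ} (hp : p.Prime) {x : ZMod p} (hx : x ≠ 0) :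
    addOrderOf x = p := by
  have h : addOrderOf x ∣ p := addOrderOf_dvd_of_nsmul_eq_zero (by simp)
  rcases (Nat.dvd_prime hp).1 h with h | h
  · exact absurd (AddMonoid.addOrderOf_eq_one_iff.1 h) hx
  · exact h

lemma ZMod.addOrderOf_dvd (Q : ℕ) (x : ZMod Q) : addOrderOf x ∣ Q :=
  addOrderOf_dvd_of_nsmul_eq_zero (by simp)

/-- A multilinear convolution at `0` on `ℤ/Q` is controlled by the `ℓ²` norms of the functions on
the sets of elements of given order. -/
theorem sum_zeroSum_prod_le_of_sum_sq_le {κ : ℝ} (hκ : 0 ≤ κ) (k : ℕ) (Q : ℕ) :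
    Squarefree Q → ∀ [NeZero Q] (f : Fin k → ZMod Q → ℝ) (A : Fin k → ℝ),
      (∀ i x, 0 ≤ f i x) → (∀ i, 0 ≤ A i) →
      (∀ i, ∀ r, r ∣ Q → ∑ α with addOrderOf α = r, f i α ^ 2 ≤
        (A i * κ ^ r.primeFactors.card) ^ 2 / r) →
      ∑ α : Fin k → ZMod Q with ∑ i, α i = 0, ∏ i, f i (α i) ≤
        (∏ p ∈ Q.primeFactors, (1 + (1 + κ) ^ k / (p : ℝ))) * ∏ i, A i := by
  induction Q using induction_on_primes with
  | zero => intro h; exact absurd h not_squarefree_zero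
  | one =>
    intro _ _ f A hf hA h
    have h1 : ∀ i, f i 0 ≤ A i := by
      intro i
      have := h i 1 dvd_rfl
      simp only [AddMonoid.addOrderOf_eq_one_iff, Nat.primeFactors_one, Finset.card_empty,
        pow_zero, mul_one, Nat.cast_one, div_one] at this
      rw [Finset.sum_filter, Finset.sum_ite_eq' Finset.univ (0 : ZMod 1),
        if_pos (Finset.mem_univ _)] at this
      exact le_of_sq_le_sq this (hA i)
    rw [Finset.sum_filter, Fintype.sum_eq_single 0 (fun x hx => absurd (Subsingleton.elim x 0) hx)]
    simp only [Pi.zero_apply, Finset.sum_const_zero, if_true, Nat.primeFactors_one,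
      Finset.prod_empty, one_mul]
    exact Finset.prod_le_prod (fun i _ => hf i 0) fun i _ => h1 i
  | prime_mul p a hp ih =>
    intro hsq hne f A hf hA h
    have ha0 : a ≠ 0 := by rintro rfl; simp at hsq
    have : NeZero a := ⟨ha0⟩
    have : Fact p.Prime := ⟨hp⟩
    have hcop : Nat.Coprime p a := (Nat.squarefree_mul_iff.1 hsq).1
    have hsa : Squarefree a := (Nat.squarefree_mul_iff.1 hsq).2.2
    set e := (ZMod.chineseRemainder hcop).toAddEquiv with he
    have hp0 : (0 : ℝ) < p := by exact_mod_cast hp.pos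
    have hordT : ∀ (x : ZMod p) (y : ZMod a), addOrderOf (e.symm (x, y)) =
        if x = 0 then addOrderOf y else p * addOrderOf y := by
      intro x y
      rw [AddEquiv.addOrderOf_eq, Prod.addOrderOf]
      split_ifs with hx
      · subst hx; simp
      · simp only
        rw [ZMod.addOrderOf_eq_of_ne_zero hp hx]
        exact Nat.Coprime.lcm_eq_mul (hcop.coprime_dvd_right (ZMod.addOrderOf_dvd a y))
    -- By the Chinese remainder theorem an element is a pair (x, y). The ℓ² norm over x ≠ 0 is a
    -- function of y that satisfies the induction hypothesis with A replaced by A κ/√p, because the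
    -- order of (x, y) is p times that of y and has one more prime factor. The slice x = 0 satisfies
    -- it with A unchanged.
    let g : Fin k → ZMod a → ℝ := fun i y => √(∑ x with x ≠ 0, f i (e.symm (x, y)) ^ 2)
    let f0 : Fin k → ZMod a → ℝ := fun i y => f i (e.symm (0, y))
    have hsum : ∀ (i : Fin k) (r : ℕ), ∑ α with addOrderOf α = r, f i α ^ 2 =
        ∑ x : ZMod p, ∑ y : ZMod a, if (if x = 0 then addOrderOf y else p * addOrderOf y) = r then
          f i (e.symm (x, y)) ^ 2 else 0 := by
      intro i r
      rw [Finset.sum_filter, ← e.symm.toEquiv.sum_comp, Fintype.sum_prod_type]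
      refine Finset.sum_congr rfl fun x _ => Finset.sum_congr rfl fun y _ => ?_
      simp only [AddEquiv.toEquiv_eq_coe, AddEquiv.coe_toEquiv]
      rw [hordT]
    have hg : ∀ i r, r ∣ a → ∑ α with addOrderOf α = r, g i α ^ 2 ≤
        (A i * (κ / √p) * κ ^ r.primeFactors.card) ^ 2 / r := by
      intro i r hr
      have hpr : Nat.Coprime p r := hcop.coprime_dvd_right hr
      have h1 := h i (p * r) (mul_dvd_mul_left p hr)
      rw [hsum] at h1
      have hr0 : r ≠ 0 := by rintro rfl; exact ha0 (zero_dvd_iff.1 hr)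
      have h2 : (p * r).primeFactors.card = r.primeFactors.card + 1 := by
        rw [hpr.primeFactors_mul, Finset.card_union_of_disjoint hpr.disjoint_primeFactors,
          hp.primeFactors, Finset.card_singleton, add_comm]
      rw [h2] at h1
      have h3 : (A i * κ ^ (r.primeFactors.card + 1)) ^ 2 / ((p * r : ℕ) : ℝ) =
          (A i * (κ / √p) * κ ^ r.primeFactors.card) ^ 2 / r := by
        have hr1 : (r : ℝ) ≠ 0 := by exact_mod_cast hr0
        have := Real.sq_sqrt hp0.le
        rw [mul_pow (A i * (κ / √p)), mul_pow (A i) (κ / √p), div_pow, this]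
        push_cast
        field_simp
        ring
      rw [h3] at h1
      refine le_trans (b := ∑ x with x ≠ 0, ∑ y with addOrderOf y = r, f i (e.symm (x, y)) ^ 2)
        (le_of_eq ?_) (le_trans ?_ h1)
      · rw [Finset.sum_comm]
        refine Finset.sum_congr rfl fun y _ => ?_
        exact Real.sq_sqrt (Finset.sum_nonneg fun _ _ => sq_nonneg _)
      · rw [Finset.sum_filter]
        refine Finset.sum_le_sum fun x _ => ?_
        by_cases hx : x = 0
        · rw [if_neg (not_not.2 hx)]
          exact Finset.sum_nonneg fun y _ => by split_ifs <;> positivity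
        · rw [if_pos hx, Finset.sum_filter]
          refine Finset.sum_le_sum fun y _ => ?_
          by_cases hy : addOrderOf y = r
          · rw [if_pos hy, if_neg hx, hy, if_pos rfl]
          · rw [if_neg hy]
            split_ifs <;> positivity
    have hf0 : ∀ i r, r ∣ a → ∑ α with addOrderOf α = r, f0 i α ^ 2 ≤
        (A i * 1 * κ ^ r.primeFactors.card) ^ 2 / r := by
      intro i r hr
      have h1 := h i r (hr.mul_left p)
      rw [hsum] at h1
      rw [mul_one]
      refine le_trans ?_ h1
      refine le_trans ?_ (Finset.single_le_sum (f := fun x => ∑ y : ZMod a,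
        if (if x = 0 then addOrderOf y else p * addOrderOf y) = r then
          f i (e.symm (x, y)) ^ 2 else 0)
        (fun x _ => Finset.sum_nonneg fun y _ => by split_ifs <;> positivity)
        (Finset.mem_univ (0 : ZMod p)))
      rw [Finset.sum_filter]
      exact le_of_eq (Finset.sum_congr rfl fun y _ => by simp [f0])
    have main : ∀ S : Finset (Fin k),
        ∑ y : Fin k → ZMod a with ∑ i, y i = 0, ∏ i, (if i ∈ S then g i (y i) else f0 i (y i)) ≤
        (∏ q ∈ a.primeFactors, (1 + (1 + κ) ^ k / (q : ℝ))) *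
          ((∏ i, A i) * ∏ i, if i ∈ S then κ / √p else 1) := by
      intro S
      have := ih hsa (fun i y => if i ∈ S then g i y else f0 i y)
        (fun i => A i * if i ∈ S then κ / √p else 1)
        (fun i x => by split_ifs; exacts [Real.sqrt_nonneg _, hf _ _])
        (fun i => mul_nonneg (hA i) (by split_ifs <;> positivity))
        (fun i r hr => by
          by_cases hi : i ∈ S
          · simpa only [if_pos hi] using hg i r hr
          · simpa only [if_neg hi] using hf0 i r hr)
      rwa [Finset.prod_mul_distrib] at this
    -- The zero-sum condition splits into one modulo p and one modulo a. For fixed y the sum over x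
    -- is the local problem on the group of order p.
    have hJ : ∑ α : Fin k → ZMod (p * a) with ∑ i, α i = 0, ∏ i, f i (α i) ≤
        ∑ S : Finset (Fin k), splitWeight p S *
          ∑ y : Fin k → ZMod a with ∑ i, y i = 0,
            ∏ i, (if i ∈ S then g i (y i) else f0 i (y i)) := by
      let E : (Fin k → ZMod a) × (Fin k → ZMod p) ≃ (Fin k → ZMod (p * a)) :=
        (Equiv.prodComm _ _).trans ((Equiv.arrowProdEquivProdArrow _ _ _).symm.trans
          (Equiv.arrowCongr (Equiv.refl _) e.symm.toEquiv))
      have hE : ∀ y x i, E (y, x) i = e.symm (x i, y i) := fun y x i => rfl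
      have hE0 : ∀ y x, ∑ i, E (y, x) i = 0 ↔ ∑ i, y i = 0 ∧ ∑ i, x i = 0 := by
        intro y x
        simp only [hE]
        rw [← map_sum, map_eq_zero_iff _ e.symm.injective, Prod.ext_iff, Prod.fst_sum,
          Prod.snd_sum]
        simp [and_comm]
      rw [Finset.sum_filter, ← E.sum_comp, Fintype.sum_prod_type]
      have h1 : ∀ y : Fin k → ZMod a,
          (∑ x : Fin k → ZMod p, if ∑ i, E (y, x) i = 0 then ∏ i, f i (E (y, x) i) else 0) ≤
          if ∑ i, y i = 0 then ∑ S : Finset (Fin k), splitWeight p S *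
            ∏ i, (if i ∈ S then g i (y i) else f0 i (y i)) else 0 := by
        intro y
        by_cases hy : ∑ i, y i = 0
        · rw [if_pos hy]
          have := sum_zeroSum_prod_le_sum_splitWeight
            (fun i (x : ZMod p) => f i (e.symm (x, y i))) (fun i x => hf i _)
          rw [ZMod.card, Finset.sum_filter] at this
          refine le_trans (le_of_eq ?_) this
          refine Finset.sum_congr rfl fun x _ => ?_
          have h2 := hE0 y x
          simp only [hy, true_and, hE] at h2
          simp only [hE, h2]
        · rw [if_neg hy]
          refine le_of_eq (Finset.sum_eq_zero fun x _ => ?_)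
          rw [if_neg]
          rw [hE0]; tauto
      refine (Finset.sum_le_sum fun y _ => h1 y).trans (le_of_eq ?_)
      rw [← Finset.sum_filter, Finset.sum_comm]
      exact Finset.sum_congr rfl fun S _ => (Finset.mul_sum _ _ _).symm
    refine hJ.trans ?_
    have hw : ∀ S : Finset (Fin k), 0 ≤ splitWeight p S := by
      intro S; unfold splitWeight; split_ifs <;> positivity
    refine (Finset.sum_le_sum fun S _ => mul_le_mul_of_nonneg_left (main S) (hw S)).trans ?_
    have hB : 0 ≤ ∏ q ∈ a.primeFactors, (1 + (1 + κ) ^ k / (q : ℝ)) :=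
      Finset.prod_nonneg fun q _ => by positivity
    have hPA : 0 ≤ ∏ i, A i := Finset.prod_nonneg fun i _ => hA i
    have hpp : p ∉ a.primeFactors := fun hmem =>
      (Nat.Prime.coprime_iff_not_dvd hp).1 hcop (Nat.dvd_of_mem_primeFactors hmem)
    have hpf : (p * a).primeFactors = insert p a.primeFactors := by
      rw [Nat.primeFactors_mul hp.ne_zero ha0, hp.primeFactors]; rfl
    rw [hpf, Finset.prod_insert hpp]
    have hfin := mul_le_mul_of_nonneg_left (sum_splitWeight_mul_prod_le hp0 κ k)
      (mul_nonneg hB hPA)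
    calc _ = (∏ q ∈ a.primeFactors, (1 + (1 + κ) ^ k / (q : ℝ))) * (∏ i, A i) *
        ∑ S : Finset (Fin k), splitWeight p S * ∏ i, (if i ∈ S then κ / √p else 1) := by
          rw [Finset.mul_sum]
          exact Finset.sum_congr rfl fun S _ => by ring
      _ ≤ _ := hfin.trans (le_of_eq (by ring))

/-! ### The circle distance and the kernel -/

/-- The distance of `α / Q` to the nearest integer. -/
noncomputable def circleDist {Q : ℕ} (α : ZMod Q) : ℝ := (α.valMinAbs.natAbs : ℝ) / Q

/-- A smooth version of `min h (1 / ‖α / Q‖)`. -/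
noncomputable def kern (h : ℝ) {Q : ℕ} (α : ZMod Q) : ℝ := h / (1 + h * circleDist α)

lemma circleDist_nonneg {Q : ℕ} (α : ZMod Q) : 0 ≤ circleDist α := by
  unfold circleDist; positivity

lemma circleDist_neg {Q : ℕ} (α : ZMod Q) : circleDist (-α) = circleDist α := by
  unfold circleDist; rw [ZMod.natAbs_valMinAbs_neg]

lemma circleDist_add_le {Q : ℕ} (α β : ZMod Q) :
    circleDist (α + β) ≤ circleDist α + circleDist β := by
  unfold circleDist
  rw [← add_div]
  gcongr
  exact_mod_cast (ZMod.natAbs_valMinAbs_add_le α β).trans (Int.natAbs_add_le _ _)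

lemma kern_pos {h : ℝ} (hh : 0 < h) {Q : ℕ} (α : ZMod Q) : 0 < kern h α := by
  have := circleDist_nonneg α
  unfold kern; positivity

lemma kern_le {h : ℝ} (hh : 0 < h) {Q : ℕ} (α : ZMod Q) : kern h α ≤ h := by
  have := circleDist_nonneg α
  unfold kern
  exact div_le_self hh.le (by nlinarith)

lemma kern_neg (h : ℝ) {Q : ℕ} (α : ZMod Q) : kern h (-α) = kern h α := by
  unfold kern; rw [circleDist_neg]

/-- The reciprocal of the kernel is 1/h plus the distance, so by the triangle inequality it is
subadditive; clearing denominators gives the claim. -/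
lemma kern_mul_kern_le {h : ℝ} (hh : 0 < h) {Q : ℕ} (α β : ZMod Q) :
    kern h α * kern h β ≤ (kern h α + kern h β) * kern h (α + β) := by
  have h1 := circleDist_nonneg α
  have h2 := circleDist_nonneg β
  have h3 := circleDist_nonneg (α + β)
  have h4 := circleDist_add_le α β
  unfold kern
  rw [div_add_div _ _ (by positivity) (by positivity), div_mul_div_comm, div_mul_div_comm,
    div_le_div_iff₀ (by positivity) (by positivity)]
  have : 0 ≤ h * h * ((1 + h * circleDist α) * (1 + h * circleDist β)) := by positivity
  nlinarith [mul_le_mul_of_nonneg_left (show 1 + h * circleDist (α + β) ≤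
    (1 + h * circleDist α) + (1 + h * circleDist β) by nlinarith) this]

lemma circleDist_eq_min {Q : ℕ} [NeZero Q] (α : ZMod Q) :
    circleDist α = min (α.val : ℝ) ((Q : ℝ) - α.val) / Q := by
  unfold circleDist
  rw [ZMod.valMinAbs_natAbs_eq_min, Nat.cast_min, Nat.cast_sub (ZMod.val_lt α).le]

lemma sum_div_one_add_mul_le {x : ℝ} (hx : 0 < x) (n : ℕ) :
    ∑ j ∈ Finset.range n, x / (1 + x * (j + 1)) ≤ Real.log (1 + x * n) := by
  induction n with
  | zero => simp
  | succ n ih =>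
    rw [Finset.sum_range_succ]
    have h1 : 0 < 1 + x * n := by positivity
    have h2 : 0 < 1 + x * (n + 1) := by positivity
    have h3 := Real.log_le_sub_one_of_pos (div_pos h1 h2)
    rw [Real.log_div h1.ne' h2.ne'] at h3
    have h4 : x / (1 + x * (n + 1)) = 1 - (1 + x * n) / (1 + x * (n + 1)) := by
      field_simp; ring
    push_cast
    linarith

lemma sum_one_div_one_add_mul_sq_le {x : ℝ} (hx : 0 < x) (n : ℕ) :
    ∑ j ∈ Finset.range n, (1 / (1 + x * (j + 1))) ^ 2 ≤ 1 / x := by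
  have key : ∑ j ∈ Finset.range n, (1 / (1 + x * (j + 1))) ^ 2 ≤
      1 / x * (1 - 1 / (1 + x * n)) := by
    induction n with
    | zero => simp
    | succ n ih =>
      rw [Finset.sum_range_succ]
      have h1 : 0 < 1 + x * n := by positivity
      have h2 : 0 < 1 + x * (n + 1) := by positivity
      have h4 : (1 / (1 + x * ((n : ℝ) + 1))) ^ 2 ≤
          1 / x * (1 / (1 + x * n) - 1 / (1 + x * (n + 1))) := by
        have : 1 / x * (1 / (1 + x * n) - 1 / (1 + x * ((n : ℝ) + 1))) =
            1 / ((1 + x * n) * (1 + x * (n + 1))) := by field_simp; ring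
        rw [this, div_pow, one_pow, sq]
        gcongr
        linarith
      push_cast
      linarith
  refine key.trans ?_
  have h1 : 0 ≤ 1 / (1 + x * n) := by positivity
  exact mul_le_of_le_one_right (by positivity) (by linarith)

lemma sum_one_div_succ_sq_le (n : ℕ) :
    ∑ j ∈ Finset.range n, (1 / ((j : ℝ) + 1)) ^ 2 ≤ 2 := by
  have key : ∑ j ∈ Finset.range n, (1 / ((j : ℝ) + 1)) ^ 2 ≤ 2 - 1 / (n : ℝ) := by
    induction n with
    | zero => norm_num
    | succ n ih =>
      rcases Nat.eq_zero_or_pos n with rfl | hn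
      · norm_num
      rw [Finset.sum_range_succ]
      have hn' : (0 : ℝ) < n := by exact_mod_cast hn
      have h1 : (1 / ((n : ℝ) + 1)) ^ 2 ≤ 1 / n - 1 / (n + 1) := by
        have : 1 / (n : ℝ) - 1 / (n + 1) = 1 / (n * (n + 1)) := by
          field_simp; ring
        rw [this, div_pow, one_pow, sq]
        gcongr
        linarith
      push_cast
      linarith
  have : (0 : ℝ) ≤ 1 / (n : ℝ) := by positivity
  linarith

/-- Sums over the `r`-torsion elements of `ℤ/Q` other than `0`. -/
lemma sum_torsion_le {Q r : ℕ} [NeZero Q] (hr : r ∣ Q) (u : ℕ → ℝ) (hu : ∀ j, 0 ≤ u j)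
    (F : ZMod Q → ℝ)
    (hF : ∀ α : ZMod Q, ∀ j, 0 < j → j < r → circleDist α = min (j : ℝ) ((r : ℝ) - j) / r →
      F α ≤ u j + u (r - j)) :
    ∑ α : ZMod Q with r • α = 0 ∧ α ≠ 0, F α ≤ 2 * ∑ j ∈ Finset.range (r - 1), u (j + 1) := by
  obtain ⟨M, hM⟩ := hr
  have hQ0 : Q ≠ 0 := NeZero.ne Q
  have hr0 : 0 < r := Nat.pos_of_ne_zero (by rintro rfl; simp at hM; exact hQ0 hM)
  have hM0 : 0 < M := Nat.pos_of_ne_zero (by rintro rfl; simp at hM; exact hQ0 hM)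
  have hval : ∀ α : ZMod Q, r • α = 0 → α.val = M * (α.val / M) := by
    intro α hα
    have h1 : ((r * α.val : ℕ) : ZMod Q) = 0 := by
      push_cast; rw [ZMod.natCast_zmod_val, ← nsmul_eq_mul]; exact hα
    rw [ZMod.natCast_eq_zero_iff] at h1
    exact (Nat.mul_div_cancel' (Nat.dvd_of_mul_dvd_mul_left hr0
      ((dvd_of_eq hM.symm).trans h1))).symm
  have hrange : ∀ α ∈ (Finset.univ.filter fun α : ZMod Q => r • α = 0 ∧ α ≠ 0),
      α.val / M ∈ Finset.Ico 1 r := by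
    intro α hα
    simp only [Finset.mem_filter, Finset.mem_univ, true_and] at hα
    have h1 := hval α hα.1
    have h2 := ZMod.val_lt α
    rw [Finset.mem_Ico]
    constructor
    · by_contra hcon
      have : α.val / M = 0 := Nat.lt_one_iff.1 (not_le.1 hcon)
      rw [this, mul_zero] at h1
      exact hα.2 ((ZMod.val_eq_zero α).1 h1)
    · rw [Nat.div_lt_iff_lt_mul hM0]; omega
  have hinj : Set.InjOn (fun α : ZMod Q => α.val / M)
      (Finset.univ.filter fun α : ZMod Q => r • α = 0 ∧ α ≠ 0) := by
    intro α hα β hβ hab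
    simp only [Finset.coe_filter, Finset.mem_univ, true_and, Set.mem_ofPred_eq] at hα hβ hab
    apply ZMod.val_injective Q
    rw [hval α hα.1, hval β hβ.1, hab]
  calc ∑ α : ZMod Q with r • α = 0 ∧ α ≠ 0, F α
      ≤ ∑ α : ZMod Q with r • α = 0 ∧ α ≠ 0, (u (α.val / M) + u (r - α.val / M)) := by
        refine Finset.sum_le_sum fun α hα => ?_
        have hj := Finset.mem_Ico.1 (hrange α hα)
        simp only [Finset.mem_filter, Finset.mem_univ, true_and] at hα
        refine hF α _ (by omega) hj.2 ?_
        rw [circleDist_eq_min]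
        have h1 : (α.val : ℝ) = M * (α.val / M : ℕ) := by exact_mod_cast hval α hα.1
        have h2 : (Q : ℝ) = r * M := by exact_mod_cast hM
        have hM' : (0 : ℝ) < M := by exact_mod_cast hM0
        have hr' : (0 : ℝ) < r := by exact_mod_cast hr0
        rw [h1, h2, show (r : ℝ) * M - M * (α.val / M : ℕ) = M * (r - (α.val / M : ℕ)) by ring,
          ← mul_min_of_nonneg _ _ hM'.le]
        field_simp
    _ = ∑ j ∈ (Finset.univ.filter fun α : ZMod Q => r • α = 0 ∧ α ≠ 0).image
          (fun α => α.val / M), (u j + u (r - j)) :=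
        (Finset.sum_image (f := fun j => u j + u (r - j)) hinj).symm
    _ ≤ ∑ j ∈ Finset.Ico 1 r, (u j + u (r - j)) := by
        refine Finset.sum_le_sum_of_subset_of_nonneg ?_ fun j _ _ => add_nonneg (hu _) (hu _)
        intro j hj
        obtain ⟨α, hα, rfl⟩ := Finset.mem_image.1 hj
        exact hrange α hα
    _ = 2 * ∑ j ∈ Finset.range (r - 1), u (j + 1) := by
        rw [Finset.sum_add_distrib, two_mul]
        congr 1
        · rw [Finset.sum_Ico_eq_sum_range]
          exact Finset.sum_congr rfl fun j _ => by rw [add_comm]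
        · rw [Finset.sum_Ico_eq_sum_range, ← Finset.sum_range_reflect]
          refine Finset.sum_congr rfl fun j hj => ?_
          rw [Finset.mem_range] at hj
          congr 1; omega

lemma kern_le_of_circleDist {h : ℝ} (hh : 0 < h) {Q : ℕ} {α : ZMod Q} {c : ℝ} (hc : 0 ≤ c)
    (hα : c ≤ circleDist α) : kern h α ≤ h / (1 + h * c) := by
  unfold kern
  gcongr

lemma kern_le_or {h : ℝ} (hh : 0 < h) {Q r j : ℕ} {α : ZMod Q} (hj : j < r)
    (hα : circleDist α = min (j : ℝ) ((r : ℝ) - j) / r) :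
    kern h α ≤ h / (1 + h / r * j) ∨ kern h α ≤ h / (1 + h / r * (r - j : ℕ)) := by
  have hr : (0 : ℝ) < r := by exact_mod_cast (Nat.zero_le j).trans_lt hj
  have hj' : (0 : ℝ) ≤ (r : ℝ) - j := by
    have : (j : ℝ) < r := by exact_mod_cast hj
    linarith
  rcases min_choice (j : ℝ) ((r : ℝ) - j) with h1 | h1
  · left
    rw [h1] at hα
    refine (kern_le_of_circleDist hh (by positivity) hα.ge).trans (le_of_eq ?_)
    congr 2; ring
  · right
    rw [h1] at hα
    refine (kern_le_of_circleDist hh (by positivity) hα.ge).trans (le_of_eq ?_)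
    rw [Nat.cast_sub hj.le]
    congr 2; ring

lemma sum_kern_torsion_le {h : ℝ} (hh : 0 < h) {Q r : ℕ} [NeZero Q] (hr : r ∣ Q) :
    ∑ α : ZMod Q with r • α = 0 ∧ α ≠ 0, kern h α ≤ 2 * r * Real.log (1 + h) := by
  have hr0 : (0 : ℝ) < r := by
    exact_mod_cast Nat.pos_of_ne_zero (by rintro rfl; exact NeZero.ne Q (zero_dvd_iff.1 hr))
  refine (sum_torsion_le hr (fun j => h / (1 + h / r * j)) (fun j => by positivity) _ ?_).trans ?_
  · intro α j _ hj hα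
    have a1 : 0 ≤ h / (1 + h / r * j) := by positivity
    have a2 : 0 ≤ h / (1 + h / r * (r - j : ℕ)) := by positivity
    rcases kern_le_or hh hj hα with h1 | h1 <;> linarith
  · rw [mul_assoc]
    gcongr
    have h1 := sum_div_one_add_mul_le (div_pos hh hr0) (r - 1)
    have h2 : Real.log (1 + h / r * (r - 1 : ℕ)) ≤ Real.log (1 + h) := by
      apply Real.log_le_log (by positivity)
      have : ((r - 1 : ℕ) : ℝ) ≤ r := by exact_mod_cast Nat.sub_le _ _
      have h3 : h / r * (r - 1 : ℕ) ≤ h / r * r := by gcongr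
      rw [div_mul_cancel₀ _ hr0.ne'] at h3
      linarith
    have h3 := mul_le_mul_of_nonneg_left (h1.trans h2) hr0.le
    refine le_trans (le_of_eq ?_) h3
    rw [Finset.mul_sum]
    refine Finset.sum_congr rfl fun j _ => ?_
    push_cast
    field_simp

lemma sum_kern_sq_torsion_le {h : ℝ} (hh : 0 < h) {Q r : ℕ} [NeZero Q] (hr : r ∣ Q) :
    ∑ α : ZMod Q with r • α = 0 ∧ α ≠ 0, kern h α ^ 2 ≤ 4 * (r * min h r) := by
  have hr0 : (0 : ℝ) < r := by
    exact_mod_cast Nat.pos_of_ne_zero (by rintro rfl; exact NeZero.ne Q (zero_dvd_iff.1 hr))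
  refine (sum_torsion_le hr (fun j => (h / (1 + h / r * j)) ^ 2) (fun j => by positivity) _
    ?_).trans ?_
  · intro α j _ hj hα
    have h0 := (kern_pos hh α).le
    have a1 : 0 ≤ (h / (1 + h / r * j)) ^ 2 := by positivity
    have a2 : 0 ≤ (h / (1 + h / r * (r - j : ℕ))) ^ 2 := by positivity
    rcases kern_le_or hh hj hα with h1 | h1
    · have := pow_le_pow_left₀ h0 h1 2; linarith
    · have := pow_le_pow_left₀ h0 h1 2; linarith
  · have e1 : ∑ j ∈ Finset.range (r - 1), (h / (1 + h / r * (j + 1 : ℕ))) ^ 2 ≤ r * h := by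
      have h1 := mul_le_mul_of_nonneg_left (sum_one_div_one_add_mul_sq_le (div_pos hh hr0) (r - 1))
        (sq_nonneg h)
      have h2 : h ^ 2 * (1 / (h / r)) = r * h := by field_simp
      rw [h2] at h1
      refine le_trans (le_of_eq ?_) h1
      rw [Finset.mul_sum]
      refine Finset.sum_congr rfl fun j _ => ?_
      push_cast
      ring
    -- The bound for r ≤ h: replacing the kernel by the inverse distance r/j loses the dependence on
    -- h, and the inverse squares converge.
    have e2 : ∑ j ∈ Finset.range (r - 1), (h / (1 + h / r * (j + 1 : ℕ))) ^ 2 ≤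
        2 * ((r : ℝ) * r) := by
      have h1 := mul_le_mul_of_nonneg_left (sum_one_div_succ_sq_le (r - 1)) (sq_nonneg (r : ℝ))
      have h2 : (r : ℝ) ^ 2 * 2 = 2 * (r * r) := by ring
      rw [h2] at h1
      refine le_trans ?_ h1
      rw [Finset.mul_sum]
      refine Finset.sum_le_sum fun j _ => ?_
      rw [← mul_pow]
      gcongr
      rw [mul_one_div, div_le_div_iff₀ (by positivity) (by positivity)]
      push_cast
      have : (r : ℝ) * (h / r * (j + 1)) = h * (j + 1) := by field_simp
      nlinarith
    have e3 : 0 ≤ (r : ℝ) * h := by positivity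
    rcases le_total h (r : ℝ) with hm | hm
    · rw [min_eq_left hm]; linarith
    · rw [min_eq_right hm]; linarith

/-- Sums of the kernel over a coset of the `g`-torsion subgroup. -/
lemma sum_kern_coset_le {h : ℝ} (hh : 0 < h) {Q g : ℕ} [NeZero Q] (hg : g ∣ Q) (a : ZMod Q) :
    ∑ α : ZMod Q with g • (α - a) = 0, kern h α ≤ 2 * h + 2 * g * Real.log (1 + h) := by
  have hQ0 : Q ≠ 0 := NeZero.ne Q
  have hg0 : 0 < g := Nat.pos_of_ne_zero (by rintro rfl; exact hQ0 (zero_dvd_iff.1 hg))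
  obtain ⟨M, hM⟩ := hg
  have hM0 : 0 < M := Nat.pos_of_ne_zero (by rintro rfl; simp at hM; exact hQ0 hM)
  have hM' : (0 : ℝ) < M := by exact_mod_cast hM0
  have hg' : (0 : ℝ) < g := by exact_mod_cast hg0
  have hQg : (Q : ℝ) = g * M := by exact_mod_cast hM
  have hmod : ∀ α : ZMod Q, g • (α - a) = 0 → α.val % M = a.val % M := by
    intro α hα
    have h1 : ((g * ((α.val : ℤ) - a.val) : ℤ) : ZMod Q) = 0 := by
      push_cast
      rw [ZMod.natCast_zmod_val, ZMod.natCast_zmod_val, ← nsmul_eq_mul]; exact hα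
    rw [ZMod.intCast_zmod_eq_zero_iff_dvd] at h1
    have h1' : (g : ℤ) * M ∣ g * ((α.val : ℤ) - a.val) := by
      have : (Q : ℤ) = g * M := by exact_mod_cast hM
      rwa [← this]
    have h2 := Int.dvd_of_mul_dvd_mul_left (by exact_mod_cast hg0.ne') h1'
    exact ((Nat.modEq_iff_dvd.2 h2) : a.val ≡ α.val [MOD M]).symm
  have hinj : Set.InjOn (fun α : ZMod Q => α.val / M)
      (Finset.univ.filter fun α : ZMod Q => g • (α - a) = 0) := by
    intro α hα β hβ hab
    simp only [Finset.coe_filter, Finset.mem_univ, true_and, Set.mem_ofPred_eq] at hα hβ hab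
    apply ZMod.val_injective Q
    rw [← Nat.div_add_mod α.val M, ← Nat.div_add_mod β.val M, hmod α hα, hmod β hβ, hab]
  have hlt : ∀ α : ZMod Q, α.val / M < g := by
    intro α
    rw [Nat.div_lt_iff_lt_mul hM0]
    have := ZMod.val_lt α
    omega
  let u : ℕ → ℝ := fun j => h / (1 + h / g * j)
  have hu : ∀ j, 0 ≤ u j := fun j => by positivity
  -- The residues are cut into g cells of length M = Q/g, and a coset has at most one point in each.
  -- A point of cell j is at distance at least j/g or at least (g - 1 - j)/g; adding the bounds for
  -- both covers the two cases.
  calc ∑ α : ZMod Q with g • (α - a) = 0, kern h α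
      ≤ ∑ α : ZMod Q with g • (α - a) = 0, (u (α.val / M) + u (g - 1 - α.val / M)) := by
        refine Finset.sum_le_sum fun α _ => ?_
        have hd := circleDist_eq_min α
        have h1 : ((α.val / M : ℕ) : ℝ) * M ≤ α.val := by exact_mod_cast Nat.div_mul_le_self _ _
        have h2 : (α.val : ℝ) < ((α.val / M : ℕ) + 1) * M := by
          exact_mod_cast Nat.lt_mul_of_div_lt (Nat.lt_succ_self _) hM0
        have h3 : ((g - 1 - α.val / M : ℕ) : ℝ) = g - 1 - (α.val / M : ℕ) := by
          have := hlt α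
          rw [Nat.cast_sub (by omega), Nat.cast_sub (by omega)]; simp
        rcases min_choice (α.val : ℝ) ((Q : ℝ) - α.val) with hm | hm
        · rw [hm] at hd
          have := kern_le_of_circleDist hh (c := (α.val / M : ℕ) / g) (by positivity) (by
            rw [hd, hQg, div_le_div_iff₀ hg' (by positivity)]
            nlinarith)
          refine this.trans (le_trans (le_of_eq ?_) (le_add_of_nonneg_right (hu _)))
          simp only [u]; congr 2; ring
        · rw [hm] at hd
          have := kern_le_of_circleDist hh (c := ((g - 1 - α.val / M : ℕ) : ℝ) / g)
            (by positivity) (by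
            rw [hd, h3, hQg, div_le_div_iff₀ hg' (by positivity)]
            nlinarith)
          refine this.trans (le_trans (le_of_eq ?_) (le_add_of_nonneg_left (hu _)))
          simp only [u]; congr 2; ring
    _ = ∑ j ∈ (Finset.univ.filter fun α : ZMod Q => g • (α - a) = 0).image
          (fun α => α.val / M), (u j + u (g - 1 - j)) :=
        (Finset.sum_image (f := fun j => u j + u (g - 1 - j)) hinj).symm
    _ ≤ ∑ j ∈ Finset.range g, (u j + u (g - 1 - j)) := by
        refine Finset.sum_le_sum_of_subset_of_nonneg ?_ fun j _ _ => add_nonneg (hu _) (hu _)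
        intro j hj
        obtain ⟨α, hα, rfl⟩ := Finset.mem_image.1 hj
        exact Finset.mem_range.2 (hlt α)
    _ = 2 * ∑ j ∈ Finset.range g, u j := by
        rw [Finset.sum_add_distrib, Finset.sum_range_reflect, two_mul]
    _ ≤ 2 * h + 2 * g * Real.log (1 + h) := by
        obtain ⟨n, rfl⟩ : ∃ n, g = n + 1 := ⟨g - 1, by omega⟩
        rw [Finset.sum_range_succ']
        have h1 := sum_div_one_add_mul_le (div_pos hh hg') n
        have h2 : Real.log (1 + h / (n + 1 : ℕ) * n) ≤ Real.log (1 + h) := by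
          apply Real.log_le_log (by positivity)
          have : (n : ℝ) ≤ (n + 1 : ℕ) := by exact_mod_cast Nat.le_succ _
          have h3 : h / (n + 1 : ℕ) * n ≤ h / (n + 1 : ℕ) * (n + 1 : ℕ) := by gcongr
          rw [div_mul_cancel₀ _ hg'.ne'] at h3
          linarith
        have h3 := mul_le_mul_of_nonneg_left (h1.trans h2) hg'.le
        have h4 : ∑ j ∈ Finset.range n, u (j + 1) ≤ (n + 1 : ℕ) * Real.log (1 + h) := by
          refine le_trans (le_of_eq ?_) h3
          rw [Finset.mul_sum]
          refine Finset.sum_congr rfl fun j _ => ?_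
          simp only [u]
          push_cast
          field_simp
        have h5 : u 0 = h := by simp [u]
        rw [h5]
        linarith

/-! ### Sums over primes, Euler products and the divisor bound -/

/-- Chebyshev's bound for θ at 2^(j+1), divided by the lower bound 2^j · j log 2 for p log p on the
dyadic block. -/
lemma sum_inv_primes_dyadic_le {j : ℕ} (hj : 0 < j) :
    ∑ p ∈ Nat.primesLE (2 ^ (j + 1)) \ Nat.primesLE (2 ^ j), (1 : ℝ) / p ≤ 4 / j := by
  have hj' : (0 : ℝ) < j := by exact_mod_cast hj
  have hl2 : 0 < Real.log 2 := Real.log_pos (by norm_num)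
  have h1 : ∀ p ∈ Nat.primesLE (2 ^ (j + 1)) \ Nat.primesLE (2 ^ j),
      (1 : ℝ) / p ≤ Real.log p * (1 / (2 ^ j * (j * Real.log 2))) := by
    intro p hp
    simp only [Finset.mem_sdiff, Nat.mem_primesLE, not_and_or, not_le] at hp
    have hlt : 2 ^ j < p := by
      rcases hp.2 with h | h
      · exact h
      · exact absurd hp.1.2 h
    have hlt' : (2 : ℝ) ^ j ≤ p := by exact_mod_cast hlt.le
    have hlog : j * Real.log 2 ≤ Real.log p := by
      rw [← Real.log_pow]
      exact Real.log_le_log (by positivity) hlt'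
    have hp0 : (0 : ℝ) < p := lt_of_lt_of_le (by positivity) hlt'
    rw [mul_one_div, div_le_div_iff₀ hp0 (by positivity)]
    nlinarith [mul_le_mul hlog hlt' (by positivity) (hlog.trans' (by positivity))]
  refine (Finset.sum_le_sum h1).trans ?_
  rw [← Finset.sum_mul]
  have h2 : ∑ p ∈ Nat.primesLE (2 ^ (j + 1)) \ Nat.primesLE (2 ^ j), Real.log p ≤
      Real.log 4 * 2 ^ (j + 1) := by
    have h3 := Chebyshev.theta_eq_sum_primesLE_log (2 ^ (j + 1))
    have h4 := Chebyshev.theta_le_log4_mul_x (x := ((2 ^ (j + 1) : ℕ) : ℝ)) (by positivity)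
    rw [h3] at h4
    push_cast at h4
    refine (Finset.sum_le_sum_of_subset_of_nonneg Finset.sdiff_subset fun p hp _ => ?_).trans h4
    exact Real.log_natCast_nonneg p
  have h5 : Real.log 4 = 2 * Real.log 2 := by
    rw [show (4 : ℝ) = 2 ^ 2 by norm_num, Real.log_pow]; norm_num
  rw [h5] at h2
  refine (mul_le_mul_of_nonneg_right h2 (by positivity)).trans (le_of_eq ?_)
  rw [pow_succ]
  field_simp
  norm_num

/-- An arbitrarily small multiple of log N is enough for Euler products to be smaller than any power
of N, so no sharper form of Mertens' theorem is needed. -/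
lemma sum_inv_primes_le {ε : ℝ} (hε : 0 < ε) :
    ∃ K : ℝ, ∀ N : ℕ, 1 ≤ N → ∑ p ∈ Nat.primesLE N, (1 : ℝ) / p ≤ ε * Real.log N + K := by
  -- Beyond 2^j0 each dyadic block contributes at most 4/j ≤ ε log 2, that is, ε times its
  -- logarithmic length.
  obtain ⟨j0, hj0⟩ := exists_nat_gt (4 / (ε * Real.log 2))
  have hl2 : 0 < Real.log 2 := Real.log_pos (by norm_num)
  have hj0' : (0 : ℝ) < j0 := lt_trans (by positivity) hj0
  have hmono : ∀ a b : ℕ, a ≤ b → Nat.primesLE a ⊆ Nat.primesLE b := by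
    intro a b hab p hp
    rw [Nat.mem_primesLE] at hp ⊢
    exact ⟨hp.1.trans hab, hp.2⟩
  set S : ℕ → ℝ := fun n => ∑ p ∈ Nat.primesLE n, (1 : ℝ) / p with hS
  have hSm : ∀ a b : ℕ, a ≤ b → S a ≤ S b := fun a b hab =>
    Finset.sum_le_sum_of_subset_of_nonneg (hmono a b hab) fun _ _ _ => by positivity
  have hstep : ∀ i : ℕ, S (2 ^ (j0 + i)) ≤ S (2 ^ j0) + i * (ε * Real.log 2) := by
    intro i
    induction i with
    | zero => simp
    | succ i ih =>
      have h1 := sum_inv_primes_dyadic_le (j := j0 + i) (by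
        have : 0 < j0 := by exact_mod_cast hj0'
        omega)
      have h2 : S (2 ^ (j0 + i + 1)) = S (2 ^ (j0 + i)) +
          ∑ p ∈ Nat.primesLE (2 ^ (j0 + i + 1)) \ Nat.primesLE (2 ^ (j0 + i)), (1 : ℝ) / p := by
        have h5 : 2 ^ (j0 + i) ≤ 2 ^ (j0 + i + 1) :=
          Nat.pow_le_pow_right (by norm_num) (Nat.le_succ _)
        have h6 := Finset.sum_sdiff (f := fun p : ℕ => (1 : ℝ) / p) (hmono _ _ h5)
        simp only [hS]
        linarith
      have h3 : (4 : ℝ) / (j0 + i : ℕ) ≤ ε * Real.log 2 := by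
        rw [div_lt_iff₀ (by positivity)] at hj0
        have : (0 : ℝ) < (j0 + i : ℕ) := by push_cast; positivity
        rw [div_le_iff₀ this]
        push_cast
        have : 0 ≤ (i : ℝ) * (ε * Real.log 2) := by positivity
        nlinarith
      rw [← add_assoc, h2]
      push_cast at h1 h3 ⊢
      linarith
  refine ⟨S (2 ^ j0) + ε * Real.log 2, fun N hN => ?_⟩
  have hN0 : N ≠ 0 := by omega
  have h1 : N ≤ 2 ^ (j0 + (Nat.log 2 N + 1)) :=
    (Nat.lt_pow_succ_log_self (by norm_num) N).le.trans
      (Nat.pow_le_pow_right (by norm_num) (by omega))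
  have h2 := (hSm _ _ h1).trans (hstep _)
  have h3 : (Nat.log 2 N : ℝ) * Real.log 2 ≤ Real.log N := by
    rw [← Real.log_pow]
    exact Real.log_le_log (by positivity) (by exact_mod_cast Nat.pow_log_le_self 2 hN0)
  push_cast at h2
  have h4 := mul_le_mul_of_nonneg_left h3 hε.le
  change S N ≤ _
  linarith

/-- Products `∏ (1 + C / p)` over primes at most `N` grow slower than any power of `N`. -/
lemma exists_prod_primes_le (C : ℝ) (hC : 0 ≤ C) {ε : ℝ} (hε : 0 < ε) :
    ∃ K : ℝ, 1 ≤ K ∧ ∀ N Q : ℕ, 1 ≤ N → (∀ p ∈ Q.primeFactors, p ≤ N) →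
      ∏ p ∈ Q.primeFactors, (1 + C / (p : ℝ)) ≤ K * (N : ℝ) ^ ε := by
  obtain ⟨K, hK⟩ := sum_inv_primes_le (show 0 < ε / (C + 1) by positivity)
  refine ⟨max 1 (Real.exp (C * K)), le_max_left _ _, fun N Q hN hQ => ?_⟩
  have hN' : (0 : ℝ) < N := by exact_mod_cast hN
  have h1 : ∏ p ∈ Q.primeFactors, (1 + C / (p : ℝ)) ≤
      Real.exp (C * ∑ p ∈ Nat.primesLE N, (1 : ℝ) / p) := by
    calc ∏ p ∈ Q.primeFactors, (1 + C / (p : ℝ))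
        ≤ ∏ p ∈ Q.primeFactors, Real.exp (C / p) := by
          refine Finset.prod_le_prod (fun p _ => by positivity) fun p _ => ?_
          rw [add_comm]; exact Real.add_one_le_exp _
      _ = Real.exp (∑ p ∈ Q.primeFactors, C / p) := (Real.exp_sum _ _).symm
      _ ≤ _ := by
          rw [Real.exp_le_exp, Finset.mul_sum]
          refine (Finset.sum_le_sum_of_subset_of_nonneg (t := Nat.primesLE N) ?_
            fun _ _ _ => by positivity).trans (le_of_eq ?_)
          · intro p hp
            exact Nat.mem_primesLE.2 ⟨hQ p hp, Nat.prime_of_mem_primeFactors hp⟩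
          · exact Finset.sum_congr rfl fun p _ => by ring
  refine h1.trans ?_
  have h2 := mul_le_mul_of_nonneg_left (hK N hN) hC
  have hlog : 0 ≤ Real.log N := Real.log_natCast_nonneg N
  calc Real.exp (C * ∑ p ∈ Nat.primesLE N, (1 : ℝ) / p)
      ≤ Real.exp (C * K + Real.log N * ε) := by
        rw [Real.exp_le_exp]
        refine h2.trans ?_
        have : C * (ε / (C + 1)) ≤ ε := by
          rw [mul_div_assoc', div_le_iff₀ (by positivity)]; nlinarith
        nlinarith [mul_le_mul_of_nonneg_right this hlog]
    _ = Real.exp (C * K) * (N : ℝ) ^ ε := by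
        rw [Real.exp_add, Real.rpow_def_of_pos hN']
    _ ≤ _ := by gcongr; exact le_max_right _ _

/-- The divisor bound. -/
lemma exists_card_divisors_le {ε : ℝ} (hε : 0 < ε) :
    ∃ K : ℝ, 1 ≤ K ∧ ∀ n : ℕ, n ≠ 0 → (n.divisors.card : ℝ) ≤ K * (n : ℝ) ^ ε := by
  have hl2 : 0 < Real.log 2 := Real.log_pos (by norm_num)
  -- For p ≥ P one has p^ε ≥ 2, so the divisor factor a + 1 ≤ 2^a needs no constant. Each of the
  -- fewer than P smaller primes costs one factor B.
  obtain ⟨P, hP⟩ := exists_nat_gt ((2 : ℝ) ^ (1 / ε))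
  set B : ℝ := max 1 (1 / (ε * Real.log 2)) with hB
  have hB1 : 1 ≤ B := le_max_left _ _
  have hBa : ∀ a : ℕ, (a : ℝ) + 1 ≤ B * ((2 : ℝ) ^ ε) ^ a := by
    intro a
    have h1 : 1 + a * (ε * Real.log 2) ≤ ((2 : ℝ) ^ ε) ^ a := by
      rw [← Real.rpow_natCast, ← Real.rpow_mul (by norm_num), Real.rpow_def_of_pos (by norm_num)]
      have := Real.add_one_le_exp (Real.log 2 * (ε * a))
      linarith
    have h2 : (a : ℝ) + 1 ≤ B * (1 + a * (ε * Real.log 2)) := by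
      have h3 : 1 ≤ B * (ε * Real.log 2) := by
        have := mul_le_mul_of_nonneg_right (le_max_right 1 (1 / (ε * Real.log 2)))
          (show 0 ≤ ε * Real.log 2 by positivity)
        rwa [one_div_mul_cancel (by positivity)] at this
      nlinarith [Nat.cast_nonneg (α := ℝ) a]
    exact h2.trans (mul_le_mul_of_nonneg_left h1 (by positivity))
  refine ⟨B ^ P, one_le_pow₀ hB1, fun n hn => ?_⟩
  rw [Nat.card_divisors hn]
  push_cast
  have hn2 : (n : ℝ) ^ ε = ∏ p ∈ n.primeFactors, ((p : ℝ) ^ ε) ^ n.factorization p := by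
    conv_lhs => rw [← Nat.prod_factorization_pow_eq_self hn]
    rw [Finsupp.prod, Nat.support_factorization]
    push_cast
    rw [← Real.finsetProd_rpow _ _ (fun p _ => by positivity)]
    refine Finset.prod_congr rfl fun p _ => ?_
    rw [← Real.rpow_natCast, ← Real.rpow_natCast, ← Real.rpow_mul (by positivity),
      ← Real.rpow_mul (by positivity), mul_comm]
  rw [hn2]
  have key : ∀ p ∈ n.primeFactors, (n.factorization p : ℝ) + 1 ≤
      (if p < P then B else 1) * ((p : ℝ) ^ ε) ^ n.factorization p := by
    intro p hp
    have hp2 : (2 : ℝ) ≤ p := by exact_mod_cast (Nat.prime_of_mem_primeFactors hp).two_le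
    split_ifs with h
    · refine (hBa _).trans ?_
      gcongr
    · have h1 : (2 : ℝ) ≤ (p : ℝ) ^ ε := by
        have h2 : (2 : ℝ) ^ (1 / ε) ≤ p := hP.le.trans (by exact_mod_cast not_lt.1 h)
        have h3 := Real.rpow_le_rpow (by positivity) h2 hε.le
        rwa [← Real.rpow_mul (by norm_num), one_div_mul_cancel hε.ne', Real.rpow_one] at h3
      have h2 : (n.factorization p : ℝ) + 1 ≤ 2 ^ n.factorization p := by
        exact_mod_cast Nat.succ_le_of_lt (Nat.lt_two_pow_self)
      rw [one_mul]
      exact h2.trans (by gcongr)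
  refine (Finset.prod_le_prod (fun p _ => by positivity) key).trans ?_
  rw [Finset.prod_mul_distrib]
  gcongr
  rw [Finset.prod_ite, Finset.prod_const_one, mul_one, Finset.prod_const]
  refine pow_le_pow_right₀ hB1 ?_
  refine (Finset.card_le_card (t := Finset.range P) fun p hp => ?_).trans (by simp)
  exact Finset.mem_range.2 (Finset.mem_filter.1 hp).2

lemma two_pow_card_primeFactors_le {n : ℕ} (hn : n ≠ 0) :
    2 ^ n.primeFactors.card ≤ n.divisors.card := by
  rw [Nat.card_divisors hn, ← Finset.prod_const]
  refine Finset.prod_le_prod' fun p hp => ?_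
  have := (Nat.prime_of_mem_primeFactors hp).factorization_pos_of_dvd hn
    (Nat.dvd_of_mem_primeFactors hp)
  omega

/-! ### Convolutions of the kernel over elements of prescribed order -/

lemma sum_kern_le_of_torsion {h : ℝ} (hh : 0 < h) {Q g : ℕ} [NeZero Q] (hg : g ∣ Q)
    (S : Finset (ZMod Q)) (hS : ∀ x ∈ S, ∀ y ∈ S, g • (x - y) = 0) :
    ∑ α ∈ S, kern h α ≤ 2 * h + 2 * g * Real.log (1 + h) := by
  rcases S.eq_empty_or_nonempty with rfl | ⟨a, ha⟩
  · have : 0 ≤ Real.log (1 + h) := Real.log_nonneg (by linarith)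
    simp only [Finset.sum_empty]; positivity
  · refine le_trans (Finset.sum_le_sum_of_subset_of_nonneg ?_ fun α _ _ => (kern_pos hh α).le)
      (sum_kern_coset_le hh hg a)
    intro α hα
    simpa using hS α hα a ha

lemma sum_kern_sub_le_of_torsion {h : ℝ} (hh : 0 < h) {Q g : ℕ} [NeZero Q] (hg : g ∣ Q)
    (S : Finset (ZMod Q)) (hS : ∀ x ∈ S, ∀ y ∈ S, g • (x - y) = 0) (β : ZMod Q) :
    ∑ α ∈ S, kern h (β - α) ≤ 2 * h + 2 * g * Real.log (1 + h) := by
  rw [← Finset.sum_image (f := fun x => kern h x) (g := fun α => β - α) (s := S)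
    (fun x _ y _ hxy => sub_right_injective hxy)]
  refine sum_kern_le_of_torsion hh hg _ fun x hx y hy => ?_
  obtain ⟨a, ha, rfl⟩ := Finset.mem_image.1 hx
  obtain ⟨c, hc, rfl⟩ := Finset.mem_image.1 hy
  rw [sub_sub_sub_cancel_left]
  exact hS c hc a ha

lemma nsmul_sub_eq_zero_of_addOrderOf {G : Type*} [AddCommGroup G] {x y : G} {m : ℕ}
    (hx : addOrderOf x = m) (hy : addOrderOf y = m) : m • (x - y) = 0 := by
  rw [nsmul_sub, ← hx, addOrderOf_nsmul_eq_zero, hx, ← hy, addOrderOf_nsmul_eq_zero, sub_zero]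

/-- The convolution of the kernel restricted to elements of order `r₁` and of order `r₂`. -/
noncomputable def orderConv (h : ℝ) {Q : ℕ} [NeZero Q] (r₁ r₂ : ℕ) (β : ZMod Q) : ℝ :=
  ∑ α with addOrderOf α = r₁ ∧ addOrderOf (β - α) = r₂, kern h α * kern h (β - α)

lemma orderConv_nonneg {h : ℝ} (hh : 0 < h) {Q : ℕ} [NeZero Q] (r₁ r₂ : ℕ) (β : ZMod Q) :
    0 ≤ orderConv h r₁ r₂ β :=
  Finset.sum_nonneg fun _ _ => mul_nonneg (kern_pos hh _).le (kern_pos hh _).le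

lemma orderConv_comm (h : ℝ) {Q : ℕ} [NeZero Q] (r₁ r₂ : ℕ) (β : ZMod Q) :
    orderConv h r₁ r₂ β = orderConv h r₂ r₁ β := by
  unfold orderConv
  rw [Finset.sum_filter, Finset.sum_filter, ← (Equiv.subLeft β).sum_comp]
  refine Finset.sum_congr rfl fun α _ => ?_
  simp only [Equiv.subLeft_apply, sub_sub_cancel]
  simp only [and_comm, mul_comm]

/-- By `kern_mul_kern_le` a factor `kern h β` comes out and single kernel sums over α remain. The
admissible α differ by elements annihilated by both r₁ and r₂, so they lie in one coset of the
gcd-torsion. -/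
lemma orderConv_le {h : ℝ} (hh : 0 < h) {Q : ℕ} [NeZero Q] {r₁ r₂ : ℕ} (hr : Nat.gcd r₁ r₂ ∣ Q)
    (β : ZMod Q) :
    orderConv h r₁ r₂ β ≤ 4 * kern h β * (h + Nat.gcd r₁ r₂ * Real.log (1 + h)) := by
  unfold orderConv
  set S := Finset.univ.filter fun α : ZMod Q => addOrderOf α = r₁ ∧ addOrderOf (β - α) = r₂
    with hSdef
  have hS : ∀ x ∈ S, ∀ y ∈ S, Nat.gcd r₁ r₂ • (x - y) = 0 := by
    intro x hx y hy
    simp only [hSdef, Finset.mem_filter, Finset.mem_univ, true_and] at hx hy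
    refine gcd_nsmul_eq_zero.2 ⟨nsmul_sub_eq_zero_of_addOrderOf hx.1 hy.1, ?_⟩
    have := nsmul_sub_eq_zero_of_addOrderOf hy.2 hx.2
    rwa [sub_sub_sub_cancel_left] at this
  have h1 := sum_kern_le_of_torsion hh hr S hS
  have h2 := sum_kern_sub_le_of_torsion hh hr S hS β
  calc ∑ α ∈ S, kern h α * kern h (β - α)
      ≤ ∑ α ∈ S, (kern h α + kern h (β - α)) * kern h β := by
        refine Finset.sum_le_sum fun α _ => ?_
        simpa using kern_mul_kern_le hh α (β - α)
    _ = (∑ α ∈ S, kern h α + ∑ α ∈ S, kern h (β - α)) * kern h β := by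
        rw [← Finset.sum_mul, Finset.sum_add_distrib]
    _ ≤ (4 * (h + Nat.gcd r₁ r₂ * Real.log (1 + h))) * kern h β := by
        refine mul_le_mul_of_nonneg_right ?_ (kern_pos hh β).le
        linarith
    _ = _ := by ring

/-- With α fixed, the β of order b for which β - α has order r₂ lie in one coset of the gcd(b,
r₂)-torsion. The sum over α is then a torsion sum; the condition r₁ ≠ 1 removes α = 0, where the
kernel has its full height h. -/
lemma sum_orderConv_le {h : ℝ} (hh : 0 < h) {Q : ℕ} [NeZero Q] {r₁ r₂ b : ℕ} (hr₁ : r₁ ∣ Q)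
    (hr₁1 : r₁ ≠ 1) (hr : Nat.gcd b r₂ ∣ Q) :
    ∑ β : ZMod Q with addOrderOf β = b, orderConv h r₁ r₂ β ≤
      2 * r₁ * Real.log (1 + h) * (2 * h + 2 * Nat.gcd b r₂ * Real.log (1 + h)) := by
  have hlog : 0 ≤ Real.log (1 + h) := Real.log_nonneg (by linarith)
  calc ∑ β : ZMod Q with addOrderOf β = b, orderConv h r₁ r₂ β
      = ∑ α : ZMod Q with addOrderOf α = r₁, kern h α *
          ∑ β : ZMod Q with addOrderOf β = b ∧ addOrderOf (β - α) = r₂, kern h (β - α) := by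
        unfold orderConv
        simp only [Finset.sum_filter, Finset.mul_sum]
        have : ∀ β : ZMod Q, (if addOrderOf β = b then
            ∑ α, if addOrderOf α = r₁ ∧ addOrderOf (β - α) = r₂ then
              kern h α * kern h (β - α) else 0 else 0) =
            ∑ α, if addOrderOf α = r₁ then if addOrderOf β = b ∧ addOrderOf (β - α) = r₂ then
              kern h α * kern h (β - α) else 0 else 0 := by
          intro β
          by_cases hb : addOrderOf β = b
          · rw [if_pos hb]
            refine Finset.sum_congr rfl fun α _ => ?_
            by_cases h1 : addOrderOf α = r₁ <;> simp [hb, h1]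
          · rw [if_neg hb]
            refine (Finset.sum_eq_zero fun α _ => ?_).symm
            simp [hb]
        rw [Finset.sum_congr rfl fun β _ => this β, Finset.sum_comm]
        refine Finset.sum_congr rfl fun α _ => ?_
        by_cases h1 : addOrderOf α = r₁
        · simp only [h1, if_true, mul_ite, mul_zero]
        · simp [h1]
    _ ≤ ∑ α : ZMod Q with addOrderOf α = r₁, kern h α *
          (2 * h + 2 * Nat.gcd b r₂ * Real.log (1 + h)) := by
        refine Finset.sum_le_sum fun α _ => mul_le_mul_of_nonneg_left ?_ (kern_pos hh α).le
        rw [← Finset.sum_image (f := fun x => kern h x) (g := fun β => β - α)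
          (fun x _ y _ hxy => sub_left_injective hxy)]
        refine sum_kern_le_of_torsion hh hr _ fun x hx y hy => ?_
        obtain ⟨x, hx', rfl⟩ := Finset.mem_image.1 hx
        obtain ⟨y, hy', rfl⟩ := Finset.mem_image.1 hy
        have hx2 := (Finset.mem_filter.1 hx').2
        have hy2 := (Finset.mem_filter.1 hy').2
        have h1 := nsmul_sub_eq_zero_of_addOrderOf hx2.1 hy2.1
        have h2 := nsmul_sub_eq_zero_of_addOrderOf hx2.2 hy2.2
        refine gcd_nsmul_eq_zero.2 ⟨?_, h2⟩
        rwa [sub_sub_sub_cancel_right]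
    _ ≤ 2 * r₁ * Real.log (1 + h) * (2 * h + 2 * Nat.gcd b r₂ * Real.log (1 + h)) := by
        rw [← Finset.sum_mul]
        refine mul_le_mul_of_nonneg_right ?_ (by positivity)
        refine le_trans (Finset.sum_le_sum_of_subset_of_nonneg ?_
          fun α _ _ => (kern_pos hh α).le) (sum_kern_torsion_le hh hr₁)
        intro α hα
        simp only [Finset.mem_filter, Finset.mem_univ, true_and] at hα ⊢
        refine ⟨by rw [← hα]; exact addOrderOf_nsmul_eq_zero α, ?_⟩
        rintro rfl
        rw [addOrderOf_zero] at hα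
        exact hr₁1 hα.symm

/-- Coordinates of the pairs `(α, β - α)` counted by `orderConv`. -/
lemma exists_coord {Q : ℕ} [NeZero Q] {r M : ℕ} (hQ : Q = r * M) (α : ZMod Q)
    (hα : addOrderOf α = r) : ∃ a : ℤ, α.valMinAbs = M * a := by
  have hQ0 : Q ≠ 0 := NeZero.ne Q
  have hr0 : r ≠ 0 := by rintro rfl; simp at hQ; exact hQ0 hQ
  have h1 : ((r * α.valMinAbs : ℤ) : ZMod Q) = 0 := by
    push_cast
    rw [← nsmul_eq_mul, ← hα, addOrderOf_nsmul_eq_zero]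
  rw [ZMod.intCast_zmod_eq_zero_iff_dvd] at h1
  have h2 : (r : ℤ) * M ∣ r * α.valMinAbs := by
    have : (Q : ℤ) = r * M := by exact_mod_cast hQ
    rwa [← this]
  exact Int.dvd_of_mul_dvd_mul_left (by exact_mod_cast hr0) h2

lemma kern_le_of_coord {h : ℝ} (hh : 0 < h) {Q : ℕ} [NeZero Q] {r M : ℕ} (hQ : Q = r * M)
    {α : ZMod Q} {a : ℤ} (ha : α.valMinAbs = M * a) (ha0 : a ≠ 0) :
    kern h α ≤ r / |(a : ℝ)| := by
  have hQ0 : Q ≠ 0 := NeZero.ne Q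
  have hr0 : (0 : ℝ) < r := by
    exact_mod_cast Nat.pos_of_ne_zero (by rintro rfl; simp at hQ; exact hQ0 hQ)
  have hM0 : (0 : ℝ) < M := by
    exact_mod_cast Nat.pos_of_ne_zero (by rintro rfl; simp at hQ; exact hQ0 hQ)
  have hQr : (Q : ℝ) = r * M := by exact_mod_cast hQ
  have ha' : 0 < |(a : ℝ)| := abs_pos.2 (by exact_mod_cast ha0)
  have hd : circleDist α = |(a : ℝ)| / r := by
    unfold circleDist
    rw [Nat.cast_natAbs, ha, hQr]
    push_cast
    rw [abs_mul, Nat.abs_cast]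
    field_simp
  unfold kern
  rw [hd, div_le_div_iff₀ (by positivity) ha']
  have : (r : ℝ) * (1 + h * (|(a : ℝ)| / r)) = r + h * |(a : ℝ)| := by field_simp
  rw [this]
  linarith

lemma coord_natAbs_le {Q : ℕ} [NeZero Q] {r M : ℕ} (hQ : Q = r * M)
    {α : ZMod Q} {a : ℤ} (ha : α.valMinAbs = M * a) : a.natAbs ≤ r := by
  have hQ0 : Q ≠ 0 := NeZero.ne Q
  have hM0 : 0 < M := Nat.pos_of_ne_zero (by rintro rfl; simp at hQ; exact hQ0 hQ)
  have h1 := ZMod.natAbs_valMinAbs_le α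
  rw [ha, Int.natAbs_mul, Int.natAbs_natCast] at h1
  have h2 : M * a.natAbs ≤ M * r := h1.trans ((Nat.div_le_self _ _).trans (by
    rw [mul_comm M r]; exact hQ.le))
  exact Nat.le_of_mul_le_mul_left h2 hM0

/-- The nonzero integers of absolute value at most `M`. -/
noncomputable def nonzeroBox (M : ℕ) : Finset ℤ := (Finset.Icc (-(M : ℤ)) M).erase 0

lemma mem_nonzeroBox {M : ℕ} {a : ℤ} : a ∈ nonzeroBox M ↔ a ≠ 0 ∧ a.natAbs ≤ M := by
  unfold nonzeroBox
  rw [Finset.mem_erase, Finset.mem_Icc]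
  omega

/-- Write the two elements as a₁ u₂ m and a₂ u₁ m modulo Q, with representatives of least absolute
value. Their sum is m (a₁ u₂ + a₂ u₁), and it is annihilated by s u₁ u₂ exactly when t divides a₁ u₂
+ a₂ u₁; this integer is nonzero because the order of the sum is not 1. The kernels are at most
r₁/|a₁| and r₂/|a₂|. The divisibility by t is what a divisor bound later exploits. -/
lemma sum_orderConv_le_box {h : ℝ} (hh : 0 < h) {Q : ℕ} [NeZero Q] {s t u₁ u₂ m M : ℕ}
    (hQ : Q = s * t * u₁ * u₂ * m) (hb : s * u₁ * u₂ ≠ 1) (h₁ : s * t * u₁ ≠ 1)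
    (h₂ : s * t * u₂ ≠ 1) (hM₁ : s * t * u₁ ≤ M) (hM₂ : s * t * u₂ ≤ M) :
    ∑ β : ZMod Q with addOrderOf β = s * u₁ * u₂, orderConv h (s * t * u₁) (s * t * u₂) β ≤
      ∑ x ∈ nonzeroBox M ×ˢ nonzeroBox M with
          (t : ℤ) ∣ x.1 * (u₂ : ℤ) + x.2 * (u₁ : ℤ) ∧ x.1 * (u₂ : ℤ) + x.2 * (u₁ : ℤ) ≠ 0,
        ((s * t * u₁ : ℕ) : ℝ) * (s * t * u₂ : ℕ) / (|(x.1 : ℝ)| * |(x.2 : ℝ)|) := by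
  have hQ0 : Q ≠ 0 := NeZero.ne Q
  have hQ₁ : Q = s * t * u₁ * (u₂ * m) := by rw [hQ]; ring
  have hQ₂ : Q = s * t * u₂ * (u₁ * m) := by rw [hQ]; ring
  let S : Finset (ZMod Q × ZMod Q) := Finset.univ.filter fun x =>
    addOrderOf x.1 = s * t * u₁ ∧ addOrderOf x.2 = s * t * u₂ ∧
      addOrderOf (x.1 + x.2) = s * u₁ * u₂
  have hLHS : ∑ β : ZMod Q with addOrderOf β = s * u₁ * u₂,
      orderConv h (s * t * u₁) (s * t * u₂) β = ∑ x ∈ S, kern h x.1 * kern h x.2 := by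
    unfold orderConv
    simp only [S]
    rw [Finset.sum_filter, Finset.sum_filter, Fintype.sum_prod_type]
    simp only [Finset.sum_filter]
    rw [show (∑ x : ZMod Q, ∑ y : ZMod Q, if addOrderOf x = s * t * u₁ ∧
          addOrderOf y = s * t * u₂ ∧ addOrderOf (x + y) = s * u₁ * u₂ then
          kern h x * kern h y else 0) = ∑ x : ZMod Q, ∑ y : ZMod Q,
          if addOrderOf x = s * t * u₁ ∧ addOrderOf (y - x) = s * t * u₂ ∧
          addOrderOf y = s * u₁ * u₂ then kern h x * kern h (y - x) else 0 from ?_]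
    · rw [Finset.sum_comm]
      refine Finset.sum_congr rfl fun β _ => ?_
      by_cases h1 : addOrderOf β = s * u₁ * u₂
      · simp [h1]
      · simp [h1]
    · refine Finset.sum_congr rfl fun x _ => ?_
      rw [← Equiv.sum_comp (Equiv.addLeft x) (fun y => if addOrderOf x = s * t * u₁ ∧
        addOrderOf (y - x) = s * t * u₂ ∧ addOrderOf y = s * u₁ * u₂ then
          kern h x * kern h (y - x) else 0)]
      refine Finset.sum_congr rfl fun y _ => ?_
      simp only [Equiv.coe_addLeft, add_sub_cancel_left]
  rw [hLHS]
  have hc : ∀ x ∈ S, ∃ a : ℤ × ℤ, x.1.valMinAbs = (u₂ * m : ℕ) * a.1 ∧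
      x.2.valMinAbs = (u₁ * m : ℕ) * a.2 := by
    intro x hx
    simp only [S, Finset.mem_filter, Finset.mem_univ, true_and] at hx
    obtain ⟨a, ha⟩ := exists_coord hQ₁ x.1 hx.1
    obtain ⟨c, hc⟩ := exists_coord hQ₂ x.2 hx.2.1
    exact ⟨(a, c), ha, hc⟩
  choose! A hA using hc
  have hne : ∀ x ∈ S, (A x).1 ≠ 0 ∧ (A x).2 ≠ 0 := by
    intro x hx
    obtain ⟨ha, hc⟩ := hA x hx
    simp only [S, Finset.mem_filter, Finset.mem_univ, true_and] at hx
    constructor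
    · intro h0
      rw [h0, mul_zero, ZMod.valMinAbs_eq_zero] at ha
      rw [ha, addOrderOf_zero] at hx
      exact h₁ hx.1.symm
    · intro h0
      rw [h0, mul_zero, ZMod.valMinAbs_eq_zero] at hc
      rw [hc, addOrderOf_zero] at hx
      exact h₂ hx.2.1.symm
  have hmaps : ∀ x ∈ S, A x ∈ (nonzeroBox M ×ˢ nonzeroBox M).filter (fun x =>
      (t : ℤ) ∣ x.1 * (u₂ : ℤ) + x.2 * (u₁ : ℤ) ∧ x.1 * (u₂ : ℤ) + x.2 * (u₁ : ℤ) ≠ 0) := by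
    intro x hx
    obtain ⟨ha, hc⟩ := hA x hx
    obtain ⟨hn1, hn2⟩ := hne x hx
    simp only [S, Finset.mem_filter, Finset.mem_univ, true_and] at hx
    have hsum : x.1 + x.2 = ((m * ((A x).1 * u₂ + (A x).2 * u₁) : ℤ) : ZMod Q) := by
      conv_lhs => rw [← ZMod.coe_valMinAbs x.1, ← ZMod.coe_valMinAbs x.2, ha, hc]
      push_cast; ring
    rw [Finset.mem_filter, Finset.mem_product, mem_nonzeroBox, mem_nonzeroBox]
    refine ⟨⟨⟨hn1, (coord_natAbs_le hQ₁ ha).trans hM₁⟩, hn2, (coord_natAbs_le hQ₂ hc).trans hM₂⟩,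
      ?_, ?_⟩
    · have h1 : (((s * u₁ * u₂ : ℕ) : ℤ) * (m * ((A x).1 * u₂ + (A x).2 * u₁)) : ℤ) =
          ((0 : ℤ) : ZMod Q) := by
        rw [Int.cast_mul, ← hsum, Int.cast_natCast, ← nsmul_eq_mul, ← hx.2.2,
          addOrderOf_nsmul_eq_zero, Int.cast_zero]
      rw [Int.cast_zero, ZMod.intCast_zmod_eq_zero_iff_dvd] at h1
      have h2 : ((s * u₁ * u₂ * m : ℕ) : ℤ) * t ∣
          ((s * u₁ * u₂ * m : ℕ) : ℤ) * ((A x).1 * u₂ + (A x).2 * u₁) := by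
        have e1 : (Q : ℤ) = ((s * u₁ * u₂ * m : ℕ) : ℤ) * t := by rw [hQ]; push_cast; ring
        rw [← e1]
        refine h1.trans (dvd_of_eq ?_)
        push_cast; ring
      refine Int.dvd_of_mul_dvd_mul_left ?_ h2
      have : s * u₁ * u₂ * m ≠ 0 := by
        intro h0
        apply hQ0
        rw [hQ, show s * t * u₁ * u₂ * m = t * (s * u₁ * u₂ * m) by ring, h0, mul_zero]
      exact_mod_cast this
    · intro h0
      rw [h0, mul_zero, Int.cast_zero] at hsum
      rw [hsum, addOrderOf_zero] at hx
      exact hb hx.2.2.symm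
  have hinj : Set.InjOn A S := by
    intro x hx y hy hxy
    obtain ⟨h1, h2⟩ := hA x hx
    obtain ⟨h3, h4⟩ := hA y hy
    rw [← hxy] at h3 h4
    exact Prod.ext (ZMod.injective_valMinAbs (h1.trans h3.symm))
      (ZMod.injective_valMinAbs (h2.trans h4.symm))
  calc ∑ x ∈ S, kern h x.1 * kern h x.2
      ≤ ∑ x ∈ S, ((s * t * u₁ : ℕ) : ℝ) * (s * t * u₂ : ℕ) /
          (|((A x).1 : ℝ)| * |((A x).2 : ℝ)|) := by
        refine Finset.sum_le_sum fun x hx => ?_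
        obtain ⟨ha, hc⟩ := hA x hx
        obtain ⟨hn1, hn2⟩ := hne x hx
        rw [mul_div_mul_comm]
        exact mul_le_mul (kern_le_of_coord hh hQ₁ ha hn1) (kern_le_of_coord hh hQ₂ hc hn2)
          (kern_pos hh _).le (by positivity)
    _ = ∑ a ∈ S.image A, ((s * t * u₁ : ℕ) : ℝ) * (s * t * u₂ : ℕ) /
          (|(a.1 : ℝ)| * |(a.2 : ℝ)|) := (Finset.sum_image
            (f := fun a : ℤ × ℤ => ((s * t * u₁ : ℕ) : ℝ) * (s * t * u₂ : ℕ) /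
              (|(a.1 : ℝ)| * |(a.2 : ℝ)|)) hinj).symm
    _ ≤ _ := by
        refine Finset.sum_le_sum_of_subset_of_nonneg ?_ fun _ _ _ => by positivity
        intro a ha
        obtain ⟨x, hx, rfl⟩ := Finset.mem_image.1 ha
        exact hmaps x hx

/-! ### Mean squares over pairs whose orders share a large divisor -/

lemma sum_divisors_pow_card_div {C : ℝ} {n : ℕ} (hn : Squarefree n) :
    ∑ t ∈ n.divisors, C ^ t.primeFactors.card / (t : ℝ) =
      ∏ p ∈ n.primeFactors, (1 + C / (p : ℝ)) := by
  have hm := ArithmeticFunction.IsMultiplicative.prodPrimeFactors (fun p : ℕ => C / (p : ℝ))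
  have h1 := hm.prodPrimeFactors_one_add_of_squarefree hn
  have h2 : ∀ d ∈ n.divisors,
      ArithmeticFunction.prodPrimeFactors (fun p : ℕ => C / (p : ℝ)) d =
        C ^ d.primeFactors.card / (d : ℝ) := by
    intro d hd
    have hdn := Nat.dvd_of_mem_divisors hd
    have hd0 : d ≠ 0 := by rintro rfl; exact hn.ne_zero (zero_dvd_iff.1 hdn)
    rw [ArithmeticFunction.prodPrimeFactors_apply hd0, Finset.prod_div_distrib, Finset.prod_const,
      ← Nat.cast_prod, Nat.prod_primeFactors_of_squarefree (hn.squarefree_of_dvd hdn)]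
  rw [← Finset.sum_congr rfl h2, ← h1]
  refine Finset.prod_congr rfl fun p hp => ?_
  have hpp := Nat.prime_of_mem_primeFactors hp
  rw [ArithmeticFunction.prodPrimeFactors_apply hpp.ne_zero, hpp.primeFactors,
    Finset.prod_singleton]

lemma exists_one_add_log_le {δ : ℝ} (hδ : 0 < δ) :
    ∃ K : ℝ, 1 ≤ K ∧ ∀ N : ℕ, 1 ≤ N → 1 + Real.log (1 + N) ≤ K * (N : ℝ) ^ δ := by
  refine ⟨1 + 2 ^ δ / δ, by have : (0 : ℝ) < 2 ^ δ / δ := by positivity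
                            linarith, fun N hN => ?_⟩
  have hN' : (1 : ℝ) ≤ N := by exact_mod_cast hN
  have h1 := Real.log_le_rpow_div (show (0 : ℝ) ≤ 1 + N by positivity) hδ
  have h2 : (1 + (N : ℝ)) ^ δ ≤ 2 ^ δ * (N : ℝ) ^ δ := by
    rw [← Real.mul_rpow (by norm_num) (by positivity)]
    gcongr; linarith
  have h3 : 1 ≤ (N : ℝ) ^ δ := Real.one_le_rpow hN' hδ.le
  have h4 : (1 + (N : ℝ)) ^ δ / δ ≤ 2 ^ δ * (N : ℝ) ^ δ / δ := by gcongr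
  have h5 : (1 + 2 ^ δ / δ) * (N : ℝ) ^ δ = (N : ℝ) ^ δ + 2 ^ δ * (N : ℝ) ^ δ / δ := by ring
  linarith

lemma sum_nonzeroBox_inv_le (M : ℕ) :
    ∑ a ∈ nonzeroBox M, 1 / |(a : ℝ)| ≤ 2 * (1 + Real.log M) := by
  have h1 : ∑ a ∈ nonzeroBox M, 1 / |(a : ℝ)| ≤
      ∑ a ∈ (Finset.range M).image (fun i : ℕ => ((i : ℤ) + 1)) ∪
        (Finset.range M).image (fun i : ℕ => -((i : ℤ) + 1)), 1 / |(a : ℝ)| := by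
    refine Finset.sum_le_sum_of_subset_of_nonneg ?_ fun _ _ _ => by positivity
    intro a ha
    rw [mem_nonzeroBox] at ha
    simp only [Finset.mem_union, Finset.mem_image, Finset.mem_range]
    rcases lt_or_gt_of_ne ha.1 with h | h
    · right; exact ⟨a.natAbs - 1, by omega, by omega⟩
    · left; exact ⟨a.natAbs - 1, by omega, by omega⟩
  have h2 : ∀ (S T : Finset ℤ), ∑ a ∈ S ∪ T, 1 / |(a : ℝ)| ≤
      ∑ a ∈ S, 1 / |(a : ℝ)| + ∑ a ∈ T, 1 / |(a : ℝ)| := by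
    intro S T
    rw [← Finset.sum_union_inter]
    exact le_add_of_nonneg_right (Finset.sum_nonneg fun _ _ => by positivity)
  refine h1.trans ((h2 _ _).trans ?_)
  rw [Finset.sum_image (by intro a _ b _ h; simpa using h),
    Finset.sum_image (by intro a _ b _ h; simpa using h)]
  have h3 := harmonic_le_one_add_log M
  unfold harmonic at h3
  push_cast at h3
  have h4 : ∀ i : ℕ, |((i : ℝ) + 1)| = i + 1 := fun i => abs_of_pos (by positivity)
  have h5 : ∀ i : ℕ, |(-1 : ℝ) + -(i : ℝ)| = i + 1 := fun i => by
    rw [← neg_add, abs_neg, add_comm, h4]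
  push_cast
  simp only [one_div, neg_add_rev, h4, h5]
  linarith

/-- The contribution of a factorisation `b = s u₁ u₂` of the order of `β` to the convolution of
two kernels whose orders have a large common divisor. -/
noncomputable def pairSum (h D : ℝ) {Q : ℕ} [NeZero Q] (s u₁ u₂ Q' : ℕ) (β : ZMod Q) : ℝ :=
  ∑ t ∈ Q'.divisors with D < ((s * t : ℕ) : ℝ), (4 : ℝ) ^ t.primeFactors.card /
    (((s * t * u₁ : ℕ) : ℝ) * (s * t * u₂ : ℕ)) * orderConv h (s * t * u₁) (s * t * u₂) β

lemma sum_divisors_four_pow_le {K δ : ℝ} (hK : ∀ n : ℕ, n ≠ 0 →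
    (n.divisors.card : ℝ) ≤ K * (n : ℝ) ^ δ) {n : ℕ} (hn : n ≠ 0) :
    ∑ t ∈ n.divisors, (4 : ℝ) ^ t.primeFactors.card ≤ (K * (n : ℝ) ^ δ) ^ 3 := by
  have h1 : ∀ t ∈ n.divisors, (4 : ℝ) ^ t.primeFactors.card ≤ (n.divisors.card : ℝ) ^ 2 := by
    intro t ht
    have htn := Nat.dvd_of_mem_divisors ht
    have ht0 : t ≠ 0 := by rintro rfl; exact hn (zero_dvd_iff.1 htn)
    have h2 : (2 : ℝ) ^ t.primeFactors.card ≤ n.divisors.card := by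
      exact_mod_cast (two_pow_card_primeFactors_le ht0).trans
        (Finset.card_le_card (Nat.divisors_subset_of_dvd hn htn))
    calc (4 : ℝ) ^ t.primeFactors.card = ((2 : ℝ) ^ t.primeFactors.card) ^ 2 := by
          rw [← pow_mul, mul_comm, pow_mul]; norm_num
      _ ≤ _ := by gcongr
  refine (Finset.sum_le_sum h1).trans ?_
  rw [Finset.sum_const, nsmul_eq_mul]
  have := hK n hn
  calc (n.divisors.card : ℝ) * (n.divisors.card : ℝ) ^ 2 = (n.divisors.card : ℝ) ^ 3 := by ring
    _ ≤ _ := by gcongr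

lemma triple_coprime {Q s u₁ u₂ Q' : ℕ} (hQ : Q = s * u₁ * u₂ * Q') (hsq : Squarefree Q) {t : ℕ} (ht : t ∣ Q') :
    Nat.Coprime u₁ u₂ ∧ Nat.Coprime u₁ t ∧ Nat.Coprime u₂ t := by
  obtain ⟨m, rfl⟩ := ht
  rw [hQ] at hsq
  have key : ∀ x y z : ℕ, s * u₁ * u₂ * (t * m) = x * y * z → Nat.Coprime x y := by
    intro x y z h
    rw [h] at hsq
    exact Nat.coprime_of_squarefree_mul (hsq.squarefree_of_dvd (Dvd.intro _ rfl))
  exact ⟨key u₁ u₂ (s * (t * m)) (by ring), key u₁ t (s * u₂ * m) (by ring),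
    key u₂ t (s * u₁ * m) (by ring)⟩

section triple

variable {Q s u₁ u₂ Q' N : ℕ} [NeZero Q]

lemma triple_pos (hQ : Q = s * u₁ * u₂ * Q') : 0 < s ∧ 0 < u₁ ∧ 0 < u₂ ∧ 0 < Q' := by
  have h0 : s * u₁ * u₂ * Q' ≠ 0 := hQ ▸ NeZero.ne Q
  simp only [ne_eq, mul_eq_zero, not_or] at h0
  omega

lemma orderConv_triple_le (hN : 1 ≤ N) (hQ : Q = s * u₁ * u₂ * Q') (hsq : Squarefree Q) {t : ℕ}
    (ht : t ∣ Q') (β : ZMod Q) :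
    orderConv (N : ℝ) (s * t * u₁) (s * t * u₂) β ≤
      4 * kern (N : ℝ) β * (N + (s * t : ℕ) * Real.log (1 + N)) := by
  have hN' : (0 : ℝ) < N := by exact_mod_cast hN
  have hg : Nat.gcd (s * t * u₁) (s * t * u₂) = s * t := by
    rw [Nat.gcd_mul_left, (triple_coprime hQ hsq ht).1, mul_one]
  have h := orderConv_le hN' (Q := Q) (r₁ := s * t * u₁) (r₂ := s * t * u₂) (by
    rw [hg, hQ]
    obtain ⟨m, rfl⟩ := ht
    exact ⟨u₁ * u₂ * m, by ring⟩) β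
  rwa [hg] at h

/-- When s t > N the gcd term dominates in `orderConv_triple_le`, and its factor s t cancels against
the denominators to leave 1/(b t) with b = s u₁ u₂. The sum over t is an Euler product, so pointwise
this part is a small multiple of `kern N β / b`, whose mean square over order b is known. -/
lemma sum_sq_pairSum_large_le (hN : 1 ≤ N) (hQ : Q = s * u₁ * u₂ * Q') (hsq : Squarefree Q)
    (hb : s * u₁ * u₂ ≠ 1) :
    ∑ β : ZMod Q with addOrderOf β = s * u₁ * u₂, (pairSum N N s u₁ u₂ Q' β) ^ 2 ≤
      64 * (1 + Real.log (1 + N)) ^ 2 *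
        (∑ t ∈ Q'.divisors, (4 : ℝ) ^ t.primeFactors.card / (t : ℝ)) ^ 2 * N /
        (s * u₁ * u₂ : ℕ) := by
  have hN' : (0 : ℝ) < N := by exact_mod_cast hN
  obtain ⟨hs, hu₁, hu₂, hQ'⟩ := triple_pos hQ
  have hL : 0 ≤ Real.log (1 + N) := Real.log_nonneg (by linarith)
  set L := Real.log (1 + N)
  set W := ∑ t ∈ Q'.divisors, (4 : ℝ) ^ t.primeFactors.card / (t : ℝ)
  have hW : 0 ≤ W := Finset.sum_nonneg fun _ _ => by positivity
  set b := s * u₁ * u₂ with hbdef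
  have hb0 : (0 : ℝ) < b := by
    have : 0 < b := by positivity
    exact_mod_cast this
  have hpt : ∀ β : ZMod Q, pairSum N N s u₁ u₂ Q' β ≤ 4 * (1 + L) * W / b * kern N β := by
    intro β
    have hk := (kern_pos hN' β).le
    unfold pairSum
    calc ∑ t ∈ Q'.divisors with (N : ℝ) < ((s * t : ℕ) : ℝ), (4 : ℝ) ^ t.primeFactors.card /
          (((s * t * u₁ : ℕ) : ℝ) * (s * t * u₂ : ℕ)) *
            orderConv (N : ℝ) (s * t * u₁) (s * t * u₂) β
        ≤ ∑ t ∈ Q'.divisors with (N : ℝ) < ((s * t : ℕ) : ℝ),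
            4 * (1 + L) / b * kern N β * ((4 : ℝ) ^ t.primeFactors.card / t) := by
          refine Finset.sum_le_sum fun t ht => ?_
          rw [Finset.mem_filter] at ht
          have htQ := Nat.dvd_of_mem_divisors ht.1
          have ht0 : (0 : ℝ) < t := by exact_mod_cast Nat.pos_of_dvd_of_pos htQ hQ'
          have hs' : (0 : ℝ) < s := by exact_mod_cast hs
          have hu₁' : (0 : ℝ) < u₁ := by exact_mod_cast hu₁
          have hu₂' : (0 : ℝ) < u₂ := by exact_mod_cast hu₂
          have h1 := orderConv_triple_le hN hQ hsq htQ β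
          have h2 : (N : ℝ) + (s * t : ℕ) * L ≤ (s * t : ℕ) * (1 + L) := by
            have := ht.2.le; linarith
          have h3 : orderConv (N : ℝ) (s * t * u₁) (s * t * u₂) β ≤
              4 * kern (N : ℝ) β * ((s * t : ℕ) * (1 + L)) :=
            h1.trans (mul_le_mul_of_nonneg_left h2 (by positivity))
          refine (mul_le_mul_of_nonneg_left h3 (by positivity)).trans (le_of_eq ?_)
          rw [hbdef]
          push_cast
          field_simp
      _ ≤ ∑ t ∈ Q'.divisors, 4 * (1 + L) / b * kern N β * ((4 : ℝ) ^ t.primeFactors.card / t) :=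
          Finset.sum_le_sum_of_subset_of_nonneg (Finset.filter_subset _ _)
            fun _ _ _ => by positivity
      _ = _ := by rw [← Finset.mul_sum]; ring
  have hpos : ∀ β : ZMod Q, 0 ≤ pairSum N N s u₁ u₂ Q' β := fun β =>
    Finset.sum_nonneg fun t _ => mul_nonneg (by positivity) (orderConv_nonneg hN' _ _ _)
  have hbQ : b ∣ Q := ⟨Q', hQ⟩
  calc ∑ β : ZMod Q with addOrderOf β = b, (pairSum N N s u₁ u₂ Q' β) ^ 2
      ≤ ∑ β : ZMod Q with addOrderOf β = b, (4 * (1 + L) * W / b) ^ 2 * kern N β ^ 2 := by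
        refine Finset.sum_le_sum fun β _ => ?_
        rw [← mul_pow]
        exact pow_le_pow_left₀ (hpos β) (hpt β) 2
    _ ≤ (4 * (1 + L) * W / b) ^ 2 * (4 * (b * N)) := by
        rw [← Finset.mul_sum]
        refine mul_le_mul_of_nonneg_left ?_ (by positivity)
        refine le_trans (Finset.sum_le_sum_of_subset_of_nonneg ?_ fun _ _ _ => by positivity)
          ((sum_kern_sq_torsion_le hN' hbQ).trans ?_)
        · intro β hβ
          simp only [Finset.mem_filter, Finset.mem_univ, true_and] at hβ ⊢
          refine ⟨by rw [← hβ]; exact addOrderOf_nsmul_eq_zero β, ?_⟩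
          rintro rfl
          rw [addOrderOf_zero] at hβ
          exact hb hβ.symm
        · gcongr
          exact min_le_left _ _
    _ = _ := by field_simp; ring

end triple

/-- The part of `pairSum` where the common divisor of the orders is between `D` and `h`. -/
noncomputable def pairMid (h D : ℝ) {Q : ℕ} [NeZero Q] (s u₁ u₂ Q' : ℕ) (β : ZMod Q) : ℝ :=
  ∑ t ∈ Q'.divisors with D < ((s * t : ℕ) : ℝ) ∧ ((s * t : ℕ) : ℝ) ≤ h,
    (4 : ℝ) ^ t.primeFactors.card / (((s * t * u₁ : ℕ) : ℝ) * (s * t * u₂ : ℕ)) *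
      orderConv h (s * t * u₁) (s * t * u₂) β

lemma pairSum_eq_pairMid_add {h D : ℝ} (hD : D ≤ h) {Q : ℕ} [NeZero Q] (s u₁ u₂ Q' : ℕ)
    (β : ZMod Q) :
    pairSum h D s u₁ u₂ Q' β = pairMid h D s u₁ u₂ Q' β + pairSum h h s u₁ u₂ Q' β := by
  unfold pairSum pairMid
  simp only [Finset.sum_filter]
  rw [← Finset.sum_add_distrib]
  refine Finset.sum_congr rfl fun t _ => ?_
  by_cases h1 : h < ((s * t : ℕ) : ℝ)
  · rw [if_pos (hD.trans_lt h1), if_neg (fun h2 => absurd h2.2 (not_le.2 h1)), if_pos h1, zero_add]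
  · rw [if_neg h1, add_zero]
    simp only [not_lt.1 h1, and_true]

lemma pairMid_nonneg {h : ℝ} (hh : 0 < h) (D : ℝ) {Q : ℕ} [NeZero Q] (s u₁ u₂ Q' : ℕ)
    (β : ZMod Q) : 0 ≤ pairMid h D s u₁ u₂ Q' β :=
  Finset.sum_nonneg fun t _ => mul_nonneg (by positivity) (orderConv_nonneg hh _ _ _)

section triple

variable {Q s u₁ u₂ Q' N : ℕ} [NeZero Q]

/-- For s t ≤ N the term N dominates in the coset sum, and one of the denominators still contains s
t > D. This is the supremum bound, and it carries the saving in D. -/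
lemma pairMid_le (hN : 1 ≤ N) (hQ : Q = s * u₁ * u₂ * Q') (hsq : Squarefree Q)
    {D : ℝ} (hD : 1 ≤ D) (β : ZMod Q) :
    pairMid (N : ℝ) D s u₁ u₂ Q' β ≤ 4 * (N : ℝ) ^ 2 * (1 + Real.log (1 + N)) *
      (∑ t ∈ Q'.divisors, (4 : ℝ) ^ t.primeFactors.card / (t : ℝ)) /
        ((s * u₁ * u₂ : ℕ) * D) := by
  have hN' : (0 : ℝ) < N := by exact_mod_cast hN
  have hD' : 0 < D := by linarith
  obtain ⟨hs, hu₁, hu₂, hQ'⟩ := triple_pos hQ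
  have hL : 0 ≤ Real.log (1 + N) := Real.log_nonneg (by linarith)
  set L := Real.log (1 + N)
  unfold pairMid
  calc ∑ t ∈ Q'.divisors with D < ((s * t : ℕ) : ℝ) ∧ ((s * t : ℕ) : ℝ) ≤ N,
        (4 : ℝ) ^ t.primeFactors.card / (((s * t * u₁ : ℕ) : ℝ) * (s * t * u₂ : ℕ)) *
          orderConv (N : ℝ) (s * t * u₁) (s * t * u₂) β
      ≤ ∑ t ∈ Q'.divisors with D < ((s * t : ℕ) : ℝ) ∧ ((s * t : ℕ) : ℝ) ≤ N,
          4 * (N : ℝ) ^ 2 * (1 + L) / ((s * u₁ * u₂ : ℕ) * D) *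
            ((4 : ℝ) ^ t.primeFactors.card / t) := by
        refine Finset.sum_le_sum fun t ht => ?_
        rw [Finset.mem_filter] at ht
        have htQ := Nat.dvd_of_mem_divisors ht.1
        have ht0 : (0 : ℝ) < t := by exact_mod_cast Nat.pos_of_dvd_of_pos htQ hQ'
        have hs' : (0 : ℝ) < s := by exact_mod_cast hs
        have hu₁' : (0 : ℝ) < u₁ := by exact_mod_cast hu₁
        have hu₂' : (0 : ℝ) < u₂ := by exact_mod_cast hu₂
        have h1 := orderConv_triple_le hN hQ hsq htQ β
        have h2 : (N : ℝ) + (s * t : ℕ) * L ≤ N * (1 + L) := by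
          have := mul_le_mul_of_nonneg_right ht.2.2 hL; linarith
        have h3 : orderConv (N : ℝ) (s * t * u₁) (s * t * u₂) β ≤ 4 * N * (N * (1 + L)) := by
          refine h1.trans (mul_le_mul ?_ h2 (by positivity) (by positivity))
          linarith [kern_le hN' β]
        have h4 : D ≤ s * t := by have := ht.2.1.le; push_cast at this; exact this
        refine (mul_le_mul_of_nonneg_left h3 (by positivity)).trans ?_
        push_cast
        calc (4 : ℝ) ^ t.primeFactors.card / (s * t * u₁ * (s * t * u₂)) *
              (4 * N * (N * (1 + L)))
            = 4 * (N : ℝ) ^ 2 * (1 + L) / (s * u₁ * u₂ * (s * t)) *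
              ((4 : ℝ) ^ t.primeFactors.card / t) := by field_simp
          _ ≤ _ := by gcongr
    _ ≤ ∑ t ∈ Q'.divisors, 4 * (N : ℝ) ^ 2 * (1 + L) / ((s * u₁ * u₂ : ℕ) * D) *
          ((4 : ℝ) ^ t.primeFactors.card / t) :=
        Finset.sum_le_sum_of_subset_of_nonneg (Finset.filter_subset _ _)
          fun _ _ _ => by positivity
    _ = _ := by rw [← Finset.mul_sum]; ring

/-- Orders larger than `N²`. -/
lemma sum_orderConv_triple_le (hN : 1 ≤ N) (hQ : Q = s * u₁ * u₂ * Q') (hsq : Squarefree Q)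
    {t : ℕ} (ht : t ∣ Q') (h1 : s * t * u₁ ≠ 1) (hst : s * t ≤ N) (hr : N ^ 2 < s * t * u₂) :
    (4 : ℝ) ^ t.primeFactors.card / (((s * t * u₁ : ℕ) : ℝ) * (s * t * u₂ : ℕ)) *
      ∑ β : ZMod Q with addOrderOf β = s * u₁ * u₂,
        orderConv (N : ℝ) (s * t * u₁) (s * t * u₂) β ≤
      4 * Real.log (1 + N) * (1 + Real.log (1 + N)) * ((4 : ℝ) ^ t.primeFactors.card / t) := by
  have hN' : (0 : ℝ) < N := by exact_mod_cast hN
  obtain ⟨hs, hu₁, hu₂, hQ'⟩ := triple_pos hQ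
  have hL : 0 ≤ Real.log (1 + N) := Real.log_nonneg (by linarith)
  set L := Real.log (1 + N)
  have hg : Nat.gcd (s * u₁ * u₂) (s * t * u₂) = s * u₂ := by
    rw [show s * u₁ * u₂ = s * u₂ * u₁ by ring, show s * t * u₂ = s * u₂ * t by ring,
      Nat.gcd_mul_left, (triple_coprime hQ hsq ht).2.1, mul_one]
  have ht0' : 0 < t := Nat.pos_of_dvd_of_pos ht hQ'
  have ht0 : (0 : ℝ) < t := by exact_mod_cast ht0'
  have hs' : (0 : ℝ) < s := by exact_mod_cast hs
  have hu₁' : (0 : ℝ) < u₁ := by exact_mod_cast hu₁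
  have hu₂' : (0 : ℝ) < u₂ := by exact_mod_cast hu₂
  have h2 := sum_orderConv_le hN' (Q := Q) (r₁ := s * t * u₁) (r₂ := s * t * u₂)
    (b := s * u₁ * u₂) (by
      obtain ⟨m, rfl⟩ := ht
      exact ⟨u₂ * m, by rw [hQ]; ring⟩) h1 (by
      rw [hg, hQ]; exact ⟨u₁ * Q', by ring⟩)
  rw [hg] at h2
  refine (mul_le_mul_of_nonneg_left h2 (by positivity)).trans ?_
  have h3 : (4 : ℝ) ^ t.primeFactors.card / (((s * t * u₁ : ℕ) : ℝ) * (s * t * u₂ : ℕ)) *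
      (2 * (s * t * u₁ : ℕ) * L * (2 * N + 2 * (s * u₂ : ℕ) * L)) =
      4 * L * (N / (s * t * u₂ : ℕ) + L * (1 / t)) * (4 : ℝ) ^ t.primeFactors.card := by
    push_cast
    field_simp
    ring
  rw [h3]
  -- The order s t u₂ exceeds N², while t ≤ s t ≤ N.
  have h4 : (N : ℝ) / (s * t * u₂ : ℕ) ≤ 1 / t := by
    have e1 : ((N : ℝ)) ^ 2 ≤ (s * t * u₂ : ℕ) := by exact_mod_cast hr.le
    have e2 : (t : ℝ) ≤ N := by
      exact_mod_cast (Nat.le_mul_of_pos_left t hs).trans hst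
    rw [div_le_div_iff₀ (lt_of_lt_of_le (by positivity) e1) ht0]
    nlinarith
  calc 4 * L * (N / (s * t * u₂ : ℕ) + L * (1 / t)) * (4 : ℝ) ^ t.primeFactors.card
      ≤ 4 * L * (1 / t + L * (1 / t)) * (4 : ℝ) ^ t.primeFactors.card := by gcongr
    _ = _ := by ring

/-- With both orders at most N², the sums over t and over the coordinates (a₁, a₂) are interchanged.
For fixed coordinates t divides a nonzero integer of absolute value at most 2N⁴, so few t occur, and
the sum of 1/|a₁ a₂| costs only logarithms. -/
lemma sum_small_orders_le (hN : 1 ≤ N) (hQ : Q = s * u₁ * u₂ * Q')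
    (hb : s * u₁ * u₂ ≠ 1) {D : ℝ} (hD : 1 ≤ D) {K δ : ℝ} (hK1 : 1 ≤ K) (hδ : 0 < δ)
    (hK : ∀ n : ℕ, n ≠ 0 → (n.divisors.card : ℝ) ≤ K * (n : ℝ) ^ δ) :
    ∑ t ∈ Q'.divisors with (D < ((s * t : ℕ) : ℝ) ∧ ((s * t : ℕ) : ℝ) ≤ N) ∧
        s * t * u₁ ≤ N ^ 2 ∧ s * t * u₂ ≤ N ^ 2,
      (4 : ℝ) ^ t.primeFactors.card / (((s * t * u₁ : ℕ) : ℝ) * (s * t * u₂ : ℕ)) *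
        ∑ β : ZMod Q with addOrderOf β = s * u₁ * u₂,
          orderConv (N : ℝ) (s * t * u₁) (s * t * u₂) β ≤
      (K * (2 * (N : ℝ) ^ 4) ^ δ) ^ 3 * (2 * (1 + Real.log ((N ^ 2 : ℕ) : ℝ))) ^ 2 := by
  have hN' : (0 : ℝ) < N := by exact_mod_cast hN
  obtain ⟨hs, hu₁, hu₂, hQ'⟩ := triple_pos hQ
  set M := N ^ 2 with hM
  let n : ℤ × ℤ → ℤ := fun x => x.1 * (u₂ : ℤ) + x.2 * (u₁ : ℤ)
  let T := Q'.divisors.filter fun t => (D < ((s * t : ℕ) : ℝ) ∧ ((s * t : ℕ) : ℝ) ≤ N) ∧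
    s * t * u₁ ≤ M ∧ s * t * u₂ ≤ M
  let B := nonzeroBox M ×ˢ nonzeroBox M
  have hterm : ∀ t ∈ T, (4 : ℝ) ^ t.primeFactors.card /
      (((s * t * u₁ : ℕ) : ℝ) * (s * t * u₂ : ℕ)) *
        ∑ β : ZMod Q with addOrderOf β = s * u₁ * u₂,
          orderConv (N : ℝ) (s * t * u₁) (s * t * u₂) β ≤
      ∑ x ∈ B, if (t : ℤ) ∣ n x ∧ n x ≠ 0 then (4 : ℝ) ^ t.primeFactors.card *
        (1 / |(x.1 : ℝ)| * (1 / |(x.2 : ℝ)|)) else 0 := by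
    intro t ht
    simp only [T, Finset.mem_filter] at ht
    have htQ := Nat.dvd_of_mem_divisors ht.1
    have ht0' : 0 < t := Nat.pos_of_dvd_of_pos htQ hQ'
    have hst : 1 < s * t := by
      have := hD.trans_lt ht.2.1.1
      exact_mod_cast this
    obtain ⟨m, hm⟩ := htQ
    have h1 := sum_orderConv_le_box hN' (Q := Q) (s := s) (t := t) (u₁ := u₁) (u₂ := u₂) (m := m)
      (M := M) (by rw [hQ, hm]; ring) hb (Nat.lt_of_lt_of_le hst
        (Nat.le_mul_of_pos_right _ hu₁)).ne' (Nat.lt_of_lt_of_le hst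
        (Nat.le_mul_of_pos_right _ hu₂)).ne' ht.2.2.1 ht.2.2.2
    refine (mul_le_mul_of_nonneg_left h1 (by positivity)).trans (le_of_eq ?_)
    rw [← Finset.sum_filter, Finset.mul_sum]
    refine Finset.sum_congr rfl fun x hx => ?_
    have hx' := (Finset.mem_product.1 (Finset.mem_filter.1 hx).1)
    have hx1 : (x.1 : ℝ) ≠ 0 := by exact_mod_cast (mem_nonzeroBox.1 hx'.1).1
    have hx2 : (x.2 : ℝ) ≠ 0 := by exact_mod_cast (mem_nonzeroBox.1 hx'.2).1
    have a1 : |(x.1 : ℝ)| ≠ 0 := abs_ne_zero.2 hx1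
    have a2 : |(x.2 : ℝ)| ≠ 0 := abs_ne_zero.2 hx2
    have a3 : ((s * t * u₁ : ℕ) : ℝ) ≠ 0 := by
      have : 0 < s * t * u₁ := by positivity
      exact_mod_cast this.ne'
    have a4 : ((s * t * u₂ : ℕ) : ℝ) ≠ 0 := by
      have : 0 < s * t * u₂ := by positivity
      exact_mod_cast this.ne'
    field_simp
  refine (Finset.sum_le_sum hterm).trans ?_
  rw [Finset.sum_comm]
  -- The bounds on u₁ and u₂ come from some admissible t, so the empty case is separate.
  rcases T.eq_empty_or_nonempty with hT | ⟨t₀, ht₀⟩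
  · rw [hT]; simp only [Finset.sum_empty, Finset.sum_const_zero]; positivity
  simp only [T, Finset.mem_filter] at ht₀
  have ht₀0 : 0 < t₀ := Nat.pos_of_dvd_of_pos (Nat.dvd_of_mem_divisors ht₀.1) hQ'
  have hu₁M : u₁ ≤ M := (Nat.le_mul_of_pos_left u₁ (by positivity)).trans ht₀.2.2.1
  have hu₂M : u₂ ≤ M := (Nat.le_mul_of_pos_left u₂ (by positivity)).trans ht₀.2.2.2
  have hx : ∀ x ∈ B, (∑ t ∈ T, if (t : ℤ) ∣ n x ∧ n x ≠ 0 then (4 : ℝ) ^ t.primeFactors.card *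
        (1 / |(x.1 : ℝ)| * (1 / |(x.2 : ℝ)|)) else 0) ≤
      (K * (2 * (N : ℝ) ^ 4) ^ δ) ^ 3 * (1 / |(x.1 : ℝ)| * (1 / |(x.2 : ℝ)|)) := by
    intro x hxB
    by_cases hn : n x = 0
    · simp only [hn, ne_eq, not_true_eq_false, and_false, if_false, Finset.sum_const_zero]
      positivity
    · have hn' : (n x).natAbs ≠ 0 := Int.natAbs_ne_zero.2 hn
      have hnM : (n x).natAbs ≤ 2 * N ^ 4 := by
        have hx' := Finset.mem_product.1 hxB
        have e1 := (mem_nonzeroBox.1 hx'.1).2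
        have e2 := (mem_nonzeroBox.1 hx'.2).2
        calc (n x).natAbs ≤ (x.1 * (u₂ : ℤ)).natAbs + (x.2 * (u₁ : ℤ)).natAbs :=
              Int.natAbs_add_le _ _
          _ = x.1.natAbs * u₂ + x.2.natAbs * u₁ := by
              rw [Int.natAbs_mul, Int.natAbs_mul, Int.natAbs_natCast, Int.natAbs_natCast]
          _ ≤ M * M + M * M := by gcongr
          _ = 2 * N ^ 4 := by rw [hM]; ring
      calc (∑ t ∈ T, if (t : ℤ) ∣ n x ∧ n x ≠ 0 then (4 : ℝ) ^ t.primeFactors.card *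
            (1 / |(x.1 : ℝ)| * (1 / |(x.2 : ℝ)|)) else 0)
          ≤ ∑ t ∈ (n x).natAbs.divisors, (4 : ℝ) ^ t.primeFactors.card *
            (1 / |(x.1 : ℝ)| * (1 / |(x.2 : ℝ)|)) := by
            rw [← Finset.sum_filter]
            refine Finset.sum_le_sum_of_subset_of_nonneg ?_ fun _ _ _ => by positivity
            intro t ht
            have := (Finset.mem_filter.1 ht).2.1
            rw [Nat.mem_divisors]
            exact ⟨Int.natCast_dvd.1 this, hn'⟩
        _ = (∑ t ∈ (n x).natAbs.divisors, (4 : ℝ) ^ t.primeFactors.card) *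
            (1 / |(x.1 : ℝ)| * (1 / |(x.2 : ℝ)|)) := (Finset.sum_mul _ _ _).symm
        _ ≤ _ := by
            refine mul_le_mul_of_nonneg_right ((sum_divisors_four_pow_le hK hn').trans ?_)
              (by positivity)
            gcongr
            exact_mod_cast hnM
  refine (Finset.sum_le_sum hx).trans ?_
  rw [← Finset.mul_sum]
  refine mul_le_mul_of_nonneg_left ?_ (by positivity)
  rw [Finset.sum_product, sq]
  have h5 := sum_nonzeroBox_inv_le M
  have h6 : 0 ≤ ∑ a ∈ nonzeroBox M, 1 / |(a : ℝ)| := Finset.sum_nonneg fun _ _ => by positivity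
  simp only [← Finset.mul_sum, ← Finset.sum_mul]
  exact mul_le_mul h5 h5 h6 (h6.trans h5)

/-- The ℓ¹ counterpart of `pairMid_le`. If one of the orders exceeds N², the torsion estimate
applies, after exchanging u₁ and u₂ if necessary; otherwise the divisor argument applies. -/
lemma sum_pairMid_le (hN : 1 ≤ N) (hQ : Q = s * u₁ * u₂ * Q') (hsq : Squarefree Q)
    (hb : s * u₁ * u₂ ≠ 1) {D : ℝ} (hD : 1 ≤ D) {K δ : ℝ} (hK1 : 1 ≤ K) (hδ : 0 < δ)
    (hK : ∀ n : ℕ, n ≠ 0 → (n.divisors.card : ℝ) ≤ K * (n : ℝ) ^ δ) :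
    ∑ β : ZMod Q with addOrderOf β = s * u₁ * u₂, pairMid (N : ℝ) D s u₁ u₂ Q' β ≤
      4 * Real.log (1 + N) * (1 + Real.log (1 + N)) *
        (∑ t ∈ Q'.divisors, (4 : ℝ) ^ t.primeFactors.card / (t : ℝ)) +
      (K * (2 * (N : ℝ) ^ 4) ^ δ) ^ 3 * (2 * (1 + Real.log ((N ^ 2 : ℕ) : ℝ))) ^ 2 := by
  have hN' : (0 : ℝ) < N := by exact_mod_cast hN
  obtain ⟨hs, hu₁, hu₂, hQ'⟩ := triple_pos hQ
  have hL : 0 ≤ Real.log (1 + N) := Real.log_nonneg (by linarith)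
  set L := Real.log (1 + N)
  unfold pairMid
  rw [Finset.sum_comm]
  simp only [← Finset.mul_sum]
  rw [← Finset.sum_filter_add_sum_filter_not _ (fun t => ¬ (s * t * u₁ ≤ N ^ 2 ∧
    s * t * u₂ ≤ N ^ 2))]
  refine add_le_add ?_ ?_
  · rw [Finset.mul_sum]
    refine le_trans (Finset.sum_le_sum (g := fun t : ℕ => 4 * L * (1 + L) *
      ((4 : ℝ) ^ t.primeFactors.card / t)) fun t ht => ?_)
      (Finset.sum_le_sum_of_subset_of_nonneg ((Finset.filter_subset _ _).trans
        (Finset.filter_subset _ _)) fun _ _ _ => by positivity)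
    simp only [Finset.mem_filter] at ht
    have htQ := Nat.dvd_of_mem_divisors ht.1.1
    have hst : 1 < s * t := by
      have := hD.trans_lt ht.1.2.1
      exact_mod_cast this
    have hstN : s * t ≤ N := by exact_mod_cast ht.1.2.2
    have n1 : s * t * u₁ ≠ 1 :=
      (Nat.lt_of_lt_of_le hst (Nat.le_mul_of_pos_right _ hu₁)).ne'
    have n2 : s * t * u₂ ≠ 1 :=
      (Nat.lt_of_lt_of_le hst (Nat.le_mul_of_pos_right _ hu₂)).ne'
    by_cases h2 : s * t * u₂ ≤ N ^ 2
    · have h1 : N ^ 2 < s * t * u₁ := by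
        by_contra hcon
        exact ht.2 ⟨not_lt.1 hcon, h2⟩
      have hQs : Q = s * u₂ * u₁ * Q' := by rw [hQ]; ring
      have := sum_orderConv_triple_le hN hQs hsq htQ n2 hstN h1
      simp only [orderConv_comm (N : ℝ) (s * t * u₁)]
      rw [show s * u₁ * u₂ = s * u₂ * u₁ by ring,
        mul_comm ((s * t * u₁ : ℕ) : ℝ) ((s * t * u₂ : ℕ) : ℝ)]
      exact this
    · exact sum_orderConv_triple_le hN hQ hsq htQ n1 hstN (not_le.1 h2)
  · simp only [not_not, Finset.filter_filter]
    exact sum_small_orders_le hN hQ hb hD hK1 hδ hK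

end triple

lemma one_add_log_sq_le {N : ℕ} (hN : 1 ≤ N) :
    1 + Real.log ((N ^ 2 : ℕ) : ℝ) ≤ 2 * (1 + Real.log (1 + N)) := by
  have hN' : (0 : ℝ) < N := by exact_mod_cast hN
  rw [Nat.cast_pow, Real.log_pow]
  have h1 : Real.log N ≤ Real.log (1 + N) := Real.log_le_log hN' (by linarith)
  push_cast
  linarith

/-- The square mean of `pairSum` over the elements of order `s u₁ u₂`. -/
lemma exists_sum_sq_pairSum_le {ε : ℝ} (hε : 0 < ε) :
    ∃ K : ℝ, 1 ≤ K ∧ ∀ (Q N : ℕ) [NeZero Q], 1 ≤ N → Squarefree Q →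
      (∀ p ∈ Q.primeFactors, p ≤ N) → ∀ (D : ℝ), 1 ≤ D → D ≤ N → ∀ s u₁ u₂ Q' : ℕ,
      Q = s * u₁ * u₂ * Q' → s * u₁ * u₂ ≠ 1 →
      ∑ β : ZMod Q with addOrderOf β = s * u₁ * u₂, (pairSum N D s u₁ u₂ Q' β) ^ 2 ≤
        K * (N : ℝ) ^ (2 + ε) / (D * (s * u₁ * u₂ : ℕ)) := by
  -- With X = N^δ the losses amount to X^16: the ℓ¹ bound loses X^14 (divisors X^12, logarithms X^2)
  -- and the supremum bound X^2.
  set δ := ε / 16 with hδdef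
  have hδ : 0 < δ := by positivity
  obtain ⟨K₁, hK₁1, hK₁⟩ := exists_card_divisors_le hδ
  obtain ⟨K₂, hK₂1, hK₂⟩ := exists_one_add_log_le hδ
  obtain ⟨K₃, hK₃1, hK₃⟩ := exists_prod_primes_le 4 (by norm_num) hδ
  refine ⟨128 * K₂ ^ 2 * K₃ ^ 2 + 8 * K₂ * K₃ * (4 * K₂ ^ 2 * K₃ +
    16 * K₂ ^ 2 * (K₁ * 2 ^ δ) ^ 3), ?_, ?_⟩
  · have h1 : 1 ≤ K₂ ^ 2 * K₃ ^ 2 := one_le_mul_of_one_le_of_one_le (one_le_pow₀ hK₂1)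
      (one_le_pow₀ hK₃1)
    have h2 : 0 ≤ 8 * K₂ * K₃ * (4 * K₂ ^ 2 * K₃ + 16 * K₂ ^ 2 * (K₁ * 2 ^ δ) ^ 3) := by positivity
    linarith
  intro Q N _ hN hsq hQp D hD hDN s u₁ u₂ Q' hQ hb
  have hN1 : (1 : ℝ) ≤ N := by exact_mod_cast hN
  have hN' : (0 : ℝ) < N := by linarith
  have hD' : 0 < D := by linarith
  obtain ⟨hs, hu₁, hu₂, hQ'⟩ := triple_pos hQ
  have hL : 0 ≤ Real.log (1 + N) := Real.log_nonneg (by linarith)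
  have hA := sum_sq_pairSum_large_le hN hQ hsq hb
  have hS := fun β : ZMod Q => pairMid_le hN hQ hsq hD β
  have hB := sum_pairMid_le hN hQ hsq hb hD hK₁1 hδ hK₁
  set L := Real.log (1 + N) with hLdef
  set W := ∑ t ∈ Q'.divisors, (4 : ℝ) ^ t.primeFactors.card / (t : ℝ) with hWdef
  have hW0 : 0 ≤ W := Finset.sum_nonneg fun _ _ => by positivity
  set X := (N : ℝ) ^ δ with hX
  have hX1 : 1 ≤ X := Real.one_le_rpow hN1 hδ.le
  have hLX : 1 + L ≤ K₂ * X := hK₂ N hN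
  have hWX : W ≤ K₃ * X := by
    have hQ'Q : Q' ∣ Q := ⟨s * u₁ * u₂, by rw [hQ]; ring⟩
    rw [hWdef, sum_divisors_pow_card_div (hsq.squarefree_of_dvd hQ'Q)]
    exact hK₃ N Q' hN fun p hp => hQp p (Nat.primeFactors_mono hQ'Q (NeZero.ne Q) hp)
  set b := s * u₁ * u₂ with hbdef
  have hb0 : (0 : ℝ) < b := by
    have : 0 < b := by positivity
    exact_mod_cast this
  have hXε : (N : ℝ) ^ (2 + ε) = (N : ℝ) ^ 2 * X ^ 16 := by
    have h1 : X ^ 16 = (N : ℝ) ^ ε := by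
      rw [hX, ← Real.rpow_mul_natCast hN'.le]
      congr 1; rw [hδdef]; push_cast; ring
    rw [h1, Real.rpow_add hN', Real.rpow_two]
  have hpow4 : (2 * (N : ℝ) ^ 4) ^ δ = 2 ^ δ * X ^ 4 := by
    have h1 : ((N : ℝ) ^ 4) ^ δ = X ^ 4 := by
      rw [hX, ← Real.rpow_mul_natCast hN'.le, ← Real.rpow_natCast_mul hN'.le]
      congr 1; push_cast; ring
    rw [Real.mul_rpow (by norm_num) (by positivity), h1]
  rw [hpow4] at hB
  have hXm : ∀ m n : ℕ, m ≤ n → X ^ m ≤ X ^ n := fun m n h => pow_le_pow_right₀ hX1 h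
  -- the part with large common divisor
  have hA' : ∑ β : ZMod Q with addOrderOf β = b, (pairSum N N s u₁ u₂ Q' β) ^ 2 ≤
      64 * K₂ ^ 2 * K₃ ^ 2 * ((N : ℝ) ^ 2 * X ^ 16) / (D * b) := by
    refine hA.trans ?_
    calc 64 * (1 + L) ^ 2 * W ^ 2 * N / b
        ≤ 64 * (K₂ * X) ^ 2 * (K₃ * X) ^ 2 * N / b := by gcongr
      _ = 64 * K₂ ^ 2 * K₃ ^ 2 * (N * D * X ^ 4) / (D * b) := by field_simp
      _ ≤ 64 * K₂ ^ 2 * K₃ ^ 2 * (N * N * X ^ 16) / (D * b) := by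
          gcongr
          norm_num
      _ = _ := by ring
  have hB' : ∑ β : ZMod Q with addOrderOf β = b, pairMid N D s u₁ u₂ Q' β ≤
      (4 * K₂ ^ 2 * K₃ + 16 * K₂ ^ 2 * (K₁ * 2 ^ δ) ^ 3) * X ^ 14 := by
    refine hB.trans ?_
    have e1 : 4 * L * (1 + L) * W ≤ 4 * (K₂ * X) * (K₂ * X) * (K₃ * X) := by
      have : L ≤ K₂ * X := by linarith
      gcongr
    have e2 : (2 * (1 + Real.log ((N ^ 2 : ℕ) : ℝ))) ^ 2 ≤ 16 * (K₂ * X) ^ 2 := by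
      have h1 := one_add_log_sq_le hN
      have h2 : 0 ≤ Real.log ((N ^ 2 : ℕ) : ℝ) := Real.log_natCast_nonneg _
      have h3 : 2 * (1 + Real.log ((N ^ 2 : ℕ) : ℝ)) ≤ 4 * (K₂ * X) := by linarith
      calc _ ≤ (4 * (K₂ * X)) ^ 2 := by gcongr
        _ = _ := by ring
    calc 4 * L * (1 + L) * W + (K₁ * (2 ^ δ * X ^ 4)) ^ 3 *
          (2 * (1 + Real.log ((N ^ 2 : ℕ) : ℝ))) ^ 2
        ≤ 4 * (K₂ * X) * (K₂ * X) * (K₃ * X) + (K₁ * (2 ^ δ * X ^ 4)) ^ 3 *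
          (16 * (K₂ * X) ^ 2) := by gcongr
      _ = 4 * K₂ ^ 2 * K₃ * X ^ 3 + 16 * K₂ ^ 2 * (K₁ * 2 ^ δ) ^ 3 * X ^ 14 := by ring
      _ ≤ 4 * K₂ ^ 2 * K₃ * X ^ 14 + 16 * K₂ ^ 2 * (K₁ * 2 ^ δ) ^ 3 * X ^ 14 := by
          gcongr 4 * K₂ ^ 2 * K₃ * ?_ + _
          exact hXm 3 14 (by norm_num)
      _ = _ := by ring
  have hM0 := fun β : ZMod Q => pairMid_nonneg hN' D s u₁ u₂ Q' β
  -- The mean square is at most the supremum times the ℓ¹ norm: the first is about N²/(bD), the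
  -- second is smaller than any power of N.
  have hM : ∑ β : ZMod Q with addOrderOf β = b, (pairMid N D s u₁ u₂ Q' β) ^ 2 ≤
      4 * K₂ * K₃ * (4 * K₂ ^ 2 * K₃ + 16 * K₂ ^ 2 * (K₁ * 2 ^ δ) ^ 3) *
        ((N : ℝ) ^ 2 * X ^ 16) / (D * b) := by
    have hS' : ∀ β : ZMod Q, pairMid N D s u₁ u₂ Q' β ≤
        4 * (N : ℝ) ^ 2 * (K₂ * X) * (K₃ * X) / (b * D) := fun β => by
      refine (hS β).trans ?_
      gcongr
    calc ∑ β : ZMod Q with addOrderOf β = b, (pairMid N D s u₁ u₂ Q' β) ^ 2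
        ≤ ∑ β : ZMod Q with addOrderOf β = b, 4 * (N : ℝ) ^ 2 * (K₂ * X) * (K₃ * X) / (b * D) *
            pairMid N D s u₁ u₂ Q' β := by
          refine Finset.sum_le_sum fun β _ => ?_
          rw [sq]
          exact mul_le_mul_of_nonneg_right (hS' β) (hM0 β)
      _ ≤ 4 * (N : ℝ) ^ 2 * (K₂ * X) * (K₃ * X) / (b * D) *
            ((4 * K₂ ^ 2 * K₃ + 16 * K₂ ^ 2 * (K₁ * 2 ^ δ) ^ 3) * X ^ 14) := by
          rw [← Finset.mul_sum]
          exact mul_le_mul_of_nonneg_left hB' (by positivity)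
      _ = _ := by field_simp
  rw [hXε]
  calc ∑ β : ZMod Q with addOrderOf β = b, (pairSum N D s u₁ u₂ Q' β) ^ 2
      ≤ ∑ β : ZMod Q with addOrderOf β = b, (2 * (pairMid N D s u₁ u₂ Q' β) ^ 2 +
          2 * (pairSum N N s u₁ u₂ Q' β) ^ 2) := by
        refine Finset.sum_le_sum fun β _ => ?_
        rw [pairSum_eq_pairMid_add hDN]
        nlinarith [sq_nonneg (pairMid N D s u₁ u₂ Q' β - pairSum N N s u₁ u₂ Q' β)]
    _ = 2 * ∑ β : ZMod Q with addOrderOf β = b, (pairMid N D s u₁ u₂ Q' β) ^ 2 +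
          2 * ∑ β : ZMod Q with addOrderOf β = b, (pairSum N N s u₁ u₂ Q' β) ^ 2 := by
        rw [Finset.sum_add_distrib, Finset.mul_sum, Finset.mul_sum]
    _ ≤ 2 * (4 * K₂ * K₃ * (4 * K₂ ^ 2 * K₃ + 16 * K₂ ^ 2 * (K₁ * 2 ^ δ) ^ 3) *
        ((N : ℝ) ^ 2 * X ^ 16) / (D * b)) +
        2 * (64 * K₂ ^ 2 * K₃ ^ 2 * ((N : ℝ) ^ 2 * X ^ 16) / (D * b)) := by gcongr
    _ = _ := by ring

/-! ### The majorant of the Fourier coefficients and its convolution square -/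

/-- The majorant of the Fourier coefficients. -/
noncomputable def coeffBound (h : ℝ) {Q : ℕ} (α : ZMod Q) : ℝ :=
  if α = 0 then 0 else
    2 * 2 ^ (addOrderOf α).primeFactors.card / (addOrderOf α : ℝ) * kern h α

lemma coeffBound_nonneg {h : ℝ} (hh : 0 < h) {Q : ℕ} (α : ZMod Q) : 0 ≤ coeffBound h α := by
  unfold coeffBound
  have := (kern_pos hh α).le
  split_ifs <;> positivity

lemma coeffBound_neg (h : ℝ) {Q : ℕ} (α : ZMod Q) : coeffBound h (-α) = coeffBound h α := by
  unfold coeffBound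
  simp only [neg_eq_zero, addOrderOf_neg, kern_neg]

/-- This is the shape required by `sum_zeroSum_prod_le_of_sum_sq_le`. The minimum is kept because
elements of small order have a smaller constant than √h. -/
lemma sum_sq_coeffBound_le {h : ℝ} (hh : 0 < h) {Q : ℕ} [NeZero Q] {r : ℕ} (hr : r ∣ Q) :
    ∑ α : ZMod Q with addOrderOf α = r, coeffBound h α ^ 2 ≤
      (4 * √(min h r) * 2 ^ r.primeFactors.card) ^ 2 / r := by
  have hr0 : (0 : ℝ) < r := by
    exact_mod_cast Nat.pos_of_ne_zero (by rintro rfl; exact NeZero.ne Q (zero_dvd_iff.1 hr))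
  have h1 : ∑ α : ZMod Q with addOrderOf α = r, coeffBound h α ^ 2 ≤
      ∑ α : ZMod Q with r • α = 0 ∧ α ≠ 0, (2 * 2 ^ r.primeFactors.card / (r : ℝ)) ^ 2 *
        kern h α ^ 2 := by
    rw [Finset.sum_filter, Finset.sum_filter]
    refine Finset.sum_le_sum fun α _ => ?_
    by_cases hα : addOrderOf α = r
    · rw [if_pos hα]
      by_cases h0 : α = 0
      · rw [if_neg (fun h => h.2 h0)]
        simp [coeffBound, h0]
      · rw [if_pos ⟨by rw [← hα]; exact addOrderOf_nsmul_eq_zero α, h0⟩]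
        unfold coeffBound
        rw [if_neg h0, hα, mul_pow]
    · rw [if_neg hα]
      split_ifs <;> positivity
  refine h1.trans ?_
  rw [← Finset.mul_sum]
  refine (mul_le_mul_of_nonneg_left (sum_kern_sq_torsion_le hh hr) (by positivity)).trans
    (le_of_eq ?_)
  have : √(min h r) ^ 2 = min h r := Real.sq_sqrt (le_min hh.le hr0.le)
  rw [mul_pow (4 * √(min h r)), mul_pow 4, this]
  field_simp
  ring

/-- Decomposition of the orders of two elements and of their sum. -/
lemma exists_order_decomposition {Q r₁ r₂ b : ℕ} (hsq : Squarefree Q) (h₁ : r₁ ∣ Q) (h₂ : r₂ ∣ Q)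
    (h12 : r₁ ∣ Nat.lcm b r₂) (h21 : r₂ ∣ Nat.lcm b r₁) (hb : b ∣ Nat.lcm r₁ r₂) (hb0 : 0 < b) :
    (r₁ / Nat.gcd r₁ r₂) * (r₂ / Nat.gcd r₁ r₂) ∣ b ∧
      Nat.lcm r₁ r₂ / b ∣ Q / b ∧
      r₁ = b / ((r₁ / Nat.gcd r₁ r₂) * (r₂ / Nat.gcd r₁ r₂)) * (Nat.lcm r₁ r₂ / b) *
        (r₁ / Nat.gcd r₁ r₂) ∧
      r₂ = b / ((r₁ / Nat.gcd r₁ r₂) * (r₂ / Nat.gcd r₁ r₂)) * (Nat.lcm r₁ r₂ / b) *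
        (r₂ / Nat.gcd r₁ r₂) ∧
      Nat.gcd r₁ r₂ = b / ((r₁ / Nat.gcd r₁ r₂) * (r₂ / Nat.gcd r₁ r₂)) *
        (Nat.lcm r₁ r₂ / b) := by
  have hr₁ : 0 < r₁ := Nat.pos_of_ne_zero fun h => hsq.ne_zero (by simpa [h] using h₁)
  have hr₂ : 0 < r₂ := Nat.pos_of_ne_zero fun h => hsq.ne_zero (by simpa [h] using h₂)
  have hlQ : Nat.lcm r₁ r₂ ∣ Q := Nat.lcm_dvd h₁ h₂
  have hg : 0 < Nat.gcd r₁ r₂ := Nat.gcd_pos_of_pos_left _ hr₁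
  obtain ⟨u₁, hu₁⟩ := Nat.gcd_dvd_left r₁ r₂
  obtain ⟨u₂, hu₂⟩ := Nat.gcd_dvd_right r₁ r₂
  obtain ⟨t, ht⟩ := hb
  have hcop := Nat.coprime_div_gcd_div_gcd hg
  have hgl := Nat.gcd_mul_lcm r₁ r₂
  set g := Nat.gcd r₁ r₂
  set l := Nat.lcm r₁ r₂
  have e₁ : r₁ / g = u₁ := Nat.div_eq_of_eq_mul_right hg hu₁
  have e₂ : r₂ / g = u₂ := Nat.div_eq_of_eq_mul_right hg hu₂
  have et : l / b = t := Nat.div_eq_of_eq_mul_right hb0 ht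
  rw [e₁, e₂] at hcop
  have c₁ : Nat.Coprime u₁ r₂ := by
    rw [hu₂]
    exact Nat.Coprime.mul_right (Nat.coprime_of_squarefree_mul
      (hu₁ ▸ hsq.squarefree_of_dvd h₁)).symm hcop
  have c₂ : Nat.Coprime u₂ r₁ := by
    rw [hu₁]
    exact Nat.Coprime.mul_right (Nat.coprime_of_squarefree_mul
      (hu₂ ▸ hsq.squarefree_of_dvd h₂)).symm hcop.symm
  -- Squarefreeness makes u₁ coprime to the gcd, hence to r₂; as u₁ divides lcm(b, r₂), which
  -- divides b r₂, it must divide b.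
  have d₁ : u₁ ∣ b := c₁.dvd_of_dvd_mul_right
    (((Dvd.intro_left g hu₁.symm).trans h12).trans (Nat.lcm_dvd_mul b r₂))
  have d₂ : u₂ ∣ b := c₂.dvd_of_dvd_mul_right
    (((Dvd.intro_left g hu₂.symm).trans h21).trans (Nat.lcm_dvd_mul b r₁))
  have d : u₁ * u₂ ∣ b := hcop.mul_dvd_of_dvd_of_dvd d₁ d₂
  obtain ⟨s, hs⟩ := d
  have hu₁0 : 0 < u₁ := Nat.pos_of_ne_zero fun h => by simp [h] at hu₁; omega
  have hu₂0 : 0 < u₂ := Nat.pos_of_ne_zero fun h => by simp [h] at hu₂; omega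
  have es : b / (u₁ * u₂) = s := Nat.div_eq_of_eq_mul_right (by positivity) hs
  have hl : l = g * u₁ * u₂ := by
    have : g * l = g * (g * u₁ * u₂) := by
      rw [hgl]
      calc r₁ * r₂ = (g * u₁) * (g * u₂) := by rw [← hu₁, ← hu₂]
        _ = _ := by ring
    exact Nat.eq_of_mul_eq_mul_left hg this
  have hgs : g = s * t := by
    have : (u₁ * u₂) * g = (u₁ * u₂) * (s * t) := by
      calc (u₁ * u₂) * g = l := by rw [hl]; ring
        _ = _ := by rw [ht, hs]; ring
    exact Nat.eq_of_mul_eq_mul_left (by positivity) this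
  rw [e₁, e₂, et, es]
  refine ⟨⟨s, hs⟩, ?_, by rw [← hgs]; exact hu₁, by rw [← hgs]; exact hu₂, hgs⟩
  obtain ⟨m, hm⟩ := hlQ
  exact ⟨m, Nat.div_eq_of_eq_mul_right hb0 (by rw [hm, ht]; ring)⟩

/-- The contribution to the convolution square of `coeffBound` of the pairs of elements whose
orders have a large common divisor. -/
noncomputable def gcdConv (h D : ℝ) {Q : ℕ} [NeZero Q] (β : ZMod Q) : ℝ :=
  if β = 0 then 0 else
    ∑ α with D < (Nat.gcd (addOrderOf α) (addOrderOf (β - α)) : ℝ),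
      coeffBound h α * coeffBound h (β - α)

lemma gcdConv_nonneg {h : ℝ} (hh : 0 < h) (D : ℝ) {Q : ℕ} [NeZero Q] (β : ZMod Q) :
    0 ≤ gcdConv h D β := by
  unfold gcdConv
  split_ifs
  · exact le_rfl
  · exact Finset.sum_nonneg fun _ _ => mul_nonneg (coeffBound_nonneg hh _) (coeffBound_nonneg hh _)

lemma coeffBound_le {h : ℝ} (hh : 0 < h) {Q : ℕ} (α : ZMod Q) :
    coeffBound h α ≤ 2 * 2 ^ (addOrderOf α).primeFactors.card / (addOrderOf α : ℝ) * kern h α := by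
  unfold coeffBound
  have := (kern_pos hh α).le
  split_ifs
  · positivity
  · exact le_rfl

lemma addOrderOf_dvd_lcm_sub {G : Type*} [AddCommGroup G] (x y : G) :
    addOrderOf x ∣ Nat.lcm (addOrderOf y) (addOrderOf (y - x)) := by
  have h : x = y + -(y - x) := by abel
  conv_lhs => rw [h]
  have := AddCommute.addOrderOf_add_dvd_lcm (AddCommute.all y (-(y - x)))
  rwa [addOrderOf_neg] at this

lemma card_primeFactors_mul_le {m n : ℕ} (hm : m ≠ 0) (hn : n ≠ 0) :
    (m * n).primeFactors.card ≤ m.primeFactors.card + n.primeFactors.card := by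
  rw [Nat.primeFactors_mul hm hn]
  exact Finset.card_union_le _ _

lemma coeffBound_mul_le {h : ℝ} (hh : 0 < h) {Q : ℕ} (α β : ZMod Q) {s t u₁ u₂ : ℕ}
    (hs : 0 < s) (ht : 0 < t) (hu₁ : 0 < u₁) (hu₂ : 0 < u₂)
    (hcop : Nat.Coprime s (u₁ * u₂)) (hcop' : Nat.Coprime u₁ u₂)
    (h₁ : addOrderOf α = s * t * u₁) (h₂ : addOrderOf β = s * t * u₂) :
    coeffBound h α * coeffBound h β ≤ 4 * 4 ^ (s * u₁ * u₂).primeFactors.card *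
      ((4 : ℝ) ^ t.primeFactors.card / (((s * t * u₁ : ℕ) : ℝ) * (s * t * u₂ : ℕ)) *
        (kern h α * kern h β)) := by
  have hω : (s * t * u₁).primeFactors.card + (s * t * u₂).primeFactors.card ≤
      2 * ((s * u₁ * u₂).primeFactors.card + t.primeFactors.card) := by
    have e : (s * u₁ * u₂).primeFactors.card =
        s.primeFactors.card + (u₁.primeFactors.card + u₂.primeFactors.card) := by
      rw [mul_assoc, hcop.primeFactors_mul, Finset.card_union_of_disjoint hcop.disjoint_primeFactors,
        hcop'.primeFactors_mul, Finset.card_union_of_disjoint hcop'.disjoint_primeFactors]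
    have a1 := card_primeFactors_mul_le (mul_pos hs ht).ne' hu₁.ne'
    have a2 := card_primeFactors_mul_le (mul_pos hs ht).ne' hu₂.ne'
    have a3 := card_primeFactors_mul_le hs.ne' ht.ne'
    omega
  have hk₁ := (kern_pos hh α).le
  have hk₂ := (kern_pos hh β).le
  calc coeffBound h α * coeffBound h β
      ≤ (2 * 2 ^ (addOrderOf α).primeFactors.card / (addOrderOf α : ℝ) * kern h α) *
        (2 * 2 ^ (addOrderOf β).primeFactors.card / (addOrderOf β : ℝ) * kern h β) :=
        mul_le_mul (coeffBound_le hh α) (coeffBound_le hh β) (coeffBound_nonneg hh β)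
          (by positivity)
    _ = 4 * 2 ^ ((s * t * u₁).primeFactors.card + (s * t * u₂).primeFactors.card) *
        (1 / (((s * t * u₁ : ℕ) : ℝ) * (s * t * u₂ : ℕ)) * (kern h α * kern h β)) := by
        rw [h₁, h₂, pow_add]; ring
    _ ≤ 4 * 2 ^ (2 * ((s * u₁ * u₂).primeFactors.card + t.primeFactors.card)) *
        (1 / (((s * t * u₁ : ℕ) : ℝ) * (s * t * u₂ : ℕ)) * (kern h α * kern h β)) := by
        gcongr
        norm_num
    _ = _ := by rw [pow_mul, pow_add]; norm_num; ring

/-- For fixed β the elements α are classified by the factorization b = s u₁ u₂ and the extra divisor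
t that the orders of α and β - α determine; the gcd of the two orders is s t. Each class is a single
`orderConv`. -/
lemma gcdConv_le {h : ℝ} (hh : 0 < h) (D : ℝ) {Q : ℕ} [NeZero Q] (hsq : Squarefree Q)
    {β : ZMod Q} {b : ℕ} (hβ : addOrderOf β = b) :
    gcdConv h D β ≤ 4 * 4 ^ b.primeFactors.card *
      ∑ u ∈ (b.divisors ×ˢ b.divisors) with u.1 * u.2 ∣ b ∧ Nat.Coprime u.1 u.2,
        pairSum h D (b / (u.1 * u.2)) u.1 u.2 (Q / b) β := by
  have hbQ : b ∣ Q := hβ ▸ ZMod.addOrderOf_dvd Q β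
  have hb0 : 0 < b := Nat.pos_of_dvd_of_pos hbQ (NeZero.pos Q)
  have hps : ∀ s u₁ u₂ Q' : ℕ, 0 ≤ pairSum h D s u₁ u₂ Q' β := fun s u₁ u₂ Q' =>
    Finset.sum_nonneg fun _ _ => mul_nonneg (by positivity) (orderConv_nonneg hh _ _ _)
  unfold gcdConv
  split_ifs with h0
  · exact mul_nonneg (by positivity) (Finset.sum_nonneg fun _ _ => hps _ _ _ _)
  set I := (b.divisors ×ˢ b.divisors).filter fun u => u.1 * u.2 ∣ b ∧ Nat.Coprime u.1 u.2
  set v : ZMod Q → ℕ × ℕ := fun α =>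
    (addOrderOf α / Nat.gcd (addOrderOf α) (addOrderOf (β - α)),
      addOrderOf (β - α) / Nat.gcd (addOrderOf α) (addOrderOf (β - α)))
  set T : ZMod Q → ℕ := fun α => Nat.lcm (addOrderOf α) (addOrderOf (β - α)) / b
  have key : ∀ α : ZMod Q, v α ∈ I ∧ T α ∈ (Q / b).divisors ∧
      addOrderOf α = b / ((v α).1 * (v α).2) * T α * (v α).1 ∧
      addOrderOf (β - α) = b / ((v α).1 * (v α).2) * T α * (v α).2 ∧
      Nat.gcd (addOrderOf α) (addOrderOf (β - α)) = b / ((v α).1 * (v α).2) * T α := by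
    intro α
    have hb : b ∣ Nat.lcm (addOrderOf α) (addOrderOf (β - α)) := by
      have := AddCommute.addOrderOf_add_dvd_lcm (AddCommute.all α (β - α))
      rwa [add_sub_cancel, hβ] at this
    have h12 : addOrderOf α ∣ Nat.lcm b (addOrderOf (β - α)) := by
      have := addOrderOf_dvd_lcm_sub α β
      rwa [hβ] at this
    have h21 : addOrderOf (β - α) ∣ Nat.lcm b (addOrderOf α) := by
      have := addOrderOf_dvd_lcm_sub (β - α) β
      rwa [hβ, sub_sub_cancel] at this
    obtain ⟨k1, k2, k3, k4, k5⟩ := exists_order_decomposition hsq (ZMod.addOrderOf_dvd Q α)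
      (ZMod.addOrderOf_dvd Q (β - α)) h12 h21 hb hb0
    refine ⟨?_, ?_, k3, k4, k5⟩
    · simp only [I, Finset.mem_filter, Finset.mem_product, Nat.mem_divisors]
      exact ⟨⟨⟨(Dvd.intro _ rfl).trans k1, hb0.ne'⟩, ⟨(Dvd.intro_left _ rfl).trans k1, hb0.ne'⟩⟩,
        k1, Nat.coprime_div_gcd_div_gcd (Nat.gcd_pos_of_pos_left _ (addOrderOf_pos α))⟩
    · rw [Nat.mem_divisors]
      exact ⟨k2, (Nat.div_pos (Nat.le_of_dvd (NeZero.pos Q) hbQ) hb0).ne'⟩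
  rw [← Finset.sum_fiberwise_of_maps_to (g := v) (t := I) (fun α _ => (key α).1), Finset.mul_sum]
  refine Finset.sum_le_sum fun u hu => ?_
  have hu' := hu
  simp only [I, Finset.mem_filter, Finset.mem_product, Nat.mem_divisors] at hu'
  obtain ⟨⟨⟨hu1, -⟩, hu2, -⟩, hub, huc⟩ := hu'
  have hu10 : 0 < u.1 := Nat.pos_of_dvd_of_pos hu1 hb0
  have hu20 : 0 < u.2 := Nat.pos_of_dvd_of_pos hu2 hb0
  obtain ⟨s, hs⟩ := hub
  have es : b / (u.1 * u.2) = s := Nat.div_eq_of_eq_mul_right (by positivity) hs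
  have hbs : b = s * u.1 * u.2 := by rw [hs]; ring
  have hs0 : 0 < s := Nat.pos_of_ne_zero fun h => by simp [h] at hs; omega
  have hcs : Nat.Coprime s (u.1 * u.2) := Nat.coprime_of_squarefree_mul
    ((hsq.squarefree_of_dvd hbQ).squarefree_of_dvd ⟨1, by rw [hbs]; ring⟩)
  rw [es]
  have hT : ∀ α ∈ Finset.filter (fun α => v α = u) (Finset.filter (fun α : ZMod Q =>
      D < (Nat.gcd (addOrderOf α) (addOrderOf (β - α)) : ℝ)) Finset.univ),
      T α ∈ (Q / b).divisors.filter (fun t => D < ((s * t : ℕ) : ℝ)) := by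
    intro α hα
    simp only [Finset.mem_filter, Finset.mem_univ, true_and] at hα
    obtain ⟨-, k2, -, -, k5⟩ := key α
    rw [hα.2, es] at k5
    rw [Finset.mem_filter]
    exact ⟨k2, k5 ▸ hα.1⟩
  rw [← Finset.sum_fiberwise_of_maps_to (g := T) hT]
  unfold pairSum
  rw [Finset.mul_sum]
  refine Finset.sum_le_sum fun t ht => ?_
  rw [Finset.mem_filter, Nat.mem_divisors] at ht
  have ht0 : 0 < t := Nat.pos_of_ne_zero fun h => by
    have := ht.1
    rw [h, zero_dvd_iff] at this
    exact this.2 this.1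
  unfold orderConv
  rw [Finset.mul_sum, Finset.mul_sum]
  have hsub : Finset.filter (fun α => T α = t) (Finset.filter (fun α => v α = u)
      (Finset.filter (fun α : ZMod Q =>
      D < (Nat.gcd (addOrderOf α) (addOrderOf (β - α)) : ℝ)) Finset.univ)) ⊆
      Finset.univ.filter (fun α : ZMod Q => addOrderOf α = s * t * u.1 ∧
        addOrderOf (β - α) = s * t * u.2) := by
    intro α hα
    simp only [Finset.mem_filter, Finset.mem_univ, true_and] at hα ⊢
    obtain ⟨-, -, k3, k4, -⟩ := key α
    rw [hα.2, hα.1.2, es] at k3 k4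
    exact ⟨k3, k4⟩
  refine (Finset.sum_le_sum_of_subset_of_nonneg hsub fun α _ _ => mul_nonneg
    (coeffBound_nonneg hh _) (coeffBound_nonneg hh _)).trans (Finset.sum_le_sum fun α hα => ?_)
  rw [Finset.mem_filter] at hα
  have := coeffBound_mul_le hh α (β - α) hs0 ht0 hu10 hu20 hcs huc hα.2.1 hα.2.2
  rwa [← hbs] at this

/-- Cauchy–Schwarz over the at most 4^ω(b) pairs (u₁, u₂) reduces to the mean squares of `pairSum`.
The powers of 4 collected on the way give the factor 16^ω(b), which fixes the value κ = 16 used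
below. At b = 1 there is nothing to prove, because `gcdConv` vanishes at 0 by definition. -/
lemma exists_sum_sq_gcdConv_le {ε : ℝ} (hε : 0 < ε) :
    ∃ K : ℝ, 1 ≤ K ∧ ∀ (Q N : ℕ) [NeZero Q], 1 ≤ N → Squarefree Q →
      (∀ p ∈ Q.primeFactors, p ≤ N) → ∀ (D : ℝ), 1 ≤ D → D ≤ N → ∀ b : ℕ, b ∣ Q →
      ∑ β : ZMod Q with addOrderOf β = b, gcdConv N D β ^ 2 ≤
        (K * √((N : ℝ) ^ (2 + ε) / D) * 16 ^ b.primeFactors.card) ^ 2 / b := by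
  obtain ⟨K, hK1, hK⟩ := exists_sum_sq_pairSum_le hε
  refine ⟨4 * √K, by nlinarith [Real.one_le_sqrt.2 hK1], ?_⟩
  intro Q N _ hN hsq hQp D hD hDN b hbQ
  have hN' : (0 : ℝ) < N := by exact_mod_cast hN
  have hb0 : 0 < b := Nat.pos_of_dvd_of_pos hbQ (NeZero.pos Q)
  have hbR : (0 : ℝ) < b := by exact_mod_cast hb0
  rcases eq_or_ne b 1 with hb1 | hb1
  · refine le_trans (le_of_eq (Finset.sum_eq_zero fun β hβ => ?_)) (by positivity)
    rw [Finset.mem_filter, hb1, AddMonoid.addOrderOf_eq_one_iff] at hβ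
    simp [gcdConv, hβ.2]
  set I := (b.divisors ×ˢ b.divisors).filter fun u => u.1 * u.2 ∣ b ∧ Nat.Coprime u.1 u.2
  have hsqb := hsq.squarefree_of_dvd hbQ
  have hI : (I.card : ℝ) ≤ 4 ^ b.primeFactors.card := by
    have h1 : I.card ≤ b.divisors.card * b.divisors.card := by
      rw [← Finset.card_product]
      exact Finset.card_filter_le _ _
    have h2 : b.divisors.card ≤ 2 ^ b.primeFactors.card := by
      rw [Nat.card_divisors hb0.ne', ← Finset.prod_const]
      exact Finset.prod_le_prod' fun p _ => Nat.succ_le_succ (hsqb.natFactorization_le_one p)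
    have h3 := h1.trans (Nat.mul_le_mul h2 h2)
    rw [← pow_add, ← two_mul, pow_mul] at h3
    exact_mod_cast h3
  calc ∑ β : ZMod Q with addOrderOf β = b, gcdConv N D β ^ 2
      ≤ ∑ β : ZMod Q with addOrderOf β = b, (4 * 4 ^ b.primeFactors.card) ^ 2 *
        (4 ^ b.primeFactors.card *
          ∑ u ∈ I, pairSum N D (b / (u.1 * u.2)) u.1 u.2 (Q / b) β ^ 2) := by
        refine Finset.sum_le_sum fun β hβ => ?_
        rw [Finset.mem_filter] at hβ
        calc gcdConv N D β ^ 2 ≤ (4 * 4 ^ b.primeFactors.card *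
              ∑ u ∈ I, pairSum N D (b / (u.1 * u.2)) u.1 u.2 (Q / b) β) ^ 2 :=
              pow_le_pow_left₀ (gcdConv_nonneg hN' D β) (gcdConv_le hN' D hsq hβ.2) 2
          _ = (4 * 4 ^ b.primeFactors.card) ^ 2 *
              (∑ u ∈ I, pairSum N D (b / (u.1 * u.2)) u.1 u.2 (Q / b) β) ^ 2 := by ring
          _ ≤ _ := by
              gcongr
              exact sq_sum_le_card_mul_sum_sq.trans (mul_le_mul_of_nonneg_right hI
                (Finset.sum_nonneg fun _ _ => sq_nonneg _))
    _ = 16 * 64 ^ b.primeFactors.card * ∑ u ∈ I,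
          ∑ β : ZMod Q with addOrderOf β = b,
            pairSum N D (b / (u.1 * u.2)) u.1 u.2 (Q / b) β ^ 2 := by
        rw [← Finset.mul_sum, ← Finset.mul_sum, Finset.sum_comm, ← mul_assoc]
        congr 1
        rw [show (64 : ℝ) = 4 ^ 3 by norm_num, ← pow_mul]
        ring
    _ ≤ 16 * 64 ^ b.primeFactors.card * ∑ u ∈ I, K * (N : ℝ) ^ (2 + ε) / (D * b) := by
        gcongr with u hu
        simp only [I, Finset.mem_filter, Finset.mem_product, Nat.mem_divisors] at hu
        obtain ⟨-, ⟨s, hs⟩, -⟩ := hu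
        have hu0 : 0 < u.1 * u.2 := Nat.pos_of_ne_zero fun h => by simp [h] at hs; omega
        have es : b / (u.1 * u.2) = s := Nat.div_eq_of_eq_mul_right hu0 hs
        have hbs : b = s * u.1 * u.2 := by rw [hs]; ring
        have := hK Q N hN hsq hQp D hD hDN s u.1 u.2 (Q / b)
          (by rw [← hbs]; exact (Nat.mul_div_cancel' hbQ).symm) (hbs ▸ hb1)
        rw [← hbs] at this
        rwa [es]
    _ ≤ 16 * 64 ^ b.primeFactors.card * (4 ^ b.primeFactors.card *
          (K * (N : ℝ) ^ (2 + ε) / (D * b))) := by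
        rw [Finset.sum_const, nsmul_eq_mul]
        gcongr
    _ = _ := by
        rw [mul_pow, mul_pow, mul_pow, Real.sq_sqrt (by linarith), Real.sq_sqrt (by positivity),
          ← pow_mul, mul_comm b.primeFactors.card 2, pow_mul, show (16 : ℝ) ^ 2 = 64 * 4 by norm_num,
          mul_pow]
        field_simp
        ring

/-! ### Zero-sum tuples and the removal of opposite pairs -/

lemma sum_fin_succ_pi {G M : Type*} [Fintype G] [AddCommMonoid M] {n : ℕ} (j : Fin (n + 1))
    (F : (Fin (n + 1) → G) → M) :
    ∑ x, F x = ∑ a, ∑ y : Fin n → G, F (Fin.insertNth j a y) := by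
  rw [← (Fin.insertNthEquiv (fun _ => G) j).sum_comp, Fintype.sum_prod_type]
  rfl

section PairRemoval

variable {G : Type*} [AddCommGroup G] [Fintype G] [DecidableEq G]

/-- The sum over zero-sum tuples, with the first entry and a second one singled out. -/
lemma sum_zeroSum_eq_sum_pair {M : Type*} [AddCommMonoid M] {m : ℕ} (j : Fin (m + 1))
    (F : (Fin (m + 2) → G) → M) :
    ∑ x : Fin (m + 2) → G with ∑ i, x i = 0, F x =
      ∑ β, ∑ y : Fin m → G, if β + ∑ i, y i = 0 then
        ∑ a, F (Fin.cons a (Fin.insertNth j (β - a) y)) else 0 := by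
  rw [Finset.sum_filter, sum_fin_succ_pi 0]
  simp_rw [sum_fin_succ_pi j]
  have h1 : ∀ a : G, (∑ b, ∑ y : Fin m → G,
      if ∑ i, (Fin.insertNth 0 a (Fin.insertNth j b y : Fin (m + 1) → G) : Fin (m + 2) → G) i = 0
      then F (Fin.insertNth 0 a (Fin.insertNth j b y : Fin (m + 1) → G)) else 0) =
      ∑ β, ∑ y : Fin m → G, if β + ∑ i, y i = 0 then
        F (Fin.cons a (Fin.insertNth j (β - a) y)) else 0 := by
    intro a
    rw [← (Equiv.subRight a).sum_comp]
    refine Finset.sum_congr rfl fun β _ => Finset.sum_congr rfl fun y _ => ?_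
    have : ∑ i, (Fin.insertNth 0 a (Fin.insertNth j (β - a) y : Fin (m + 1) → G) :
        Fin (m + 2) → G) i = β + ∑ i, y i := by
      rw [Fin.sum_univ_succAbove _ 0, Fin.insertNth_apply_same]
      simp only [Fin.insertNth_apply_succAbove]
      rw [Fin.sum_univ_succAbove _ j, Fin.insertNth_apply_same]
      simp only [Fin.insertNth_apply_succAbove]
      abel
    simp only [Equiv.subRight_apply, this]
    rw [Fin.insertNth_zero']
  simp_rw [h1]
  rw [Finset.sum_comm]
  refine Finset.sum_congr rfl fun β _ => ?_
  rw [Finset.sum_comm]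
  refine Finset.sum_congr rfl fun y _ => ?_
  split_ifs <;> simp

lemma prod_cons_insertNth {M : Type*} [CommMonoid M] {m : ℕ} (w : G → M) (j : Fin (m + 1))
    (a b : G) (y : Fin m → G) :
    ∏ i, w ((Fin.cons a (Fin.insertNth j b y : Fin (m + 1) → G) : Fin (m + 2) → G) i) =
      w a * w b * ∏ i, w (y i) := by
  rw [Fin.prod_univ_succ, Fin.cons_zero]
  simp only [Fin.cons_succ]
  rw [Fin.prod_univ_succAbove _ j, Fin.insertNth_apply_same]
  simp only [Fin.insertNth_apply_succAbove]
  rw [mul_assoc]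

/-- The number of later entries which cancel the first entry. -/
def cancelCount {m : ℕ} (x : Fin (m + 2) → G) : ℕ :=
  (Finset.univ.filter fun j : Fin (m + 1) => x j.succ = -x 0).card

/-- Double counting of the tuples together with a position j whose entry is opposite to the first.
Deleting the pair leaves a zero-sum tuple y and a free element a. -/
lemma sum_cancelCount_smul {R : Type*} [CommRing R] {m : ℕ} (F : (Fin (m + 2) → G) → R) :
    ∑ x : Fin (m + 2) → G with ∑ i, x i = 0, (cancelCount x : R) * F x =
      ∑ j : Fin (m + 1), ∑ y : Fin m → G with ∑ i, y i = 0,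
        ∑ a, F (Fin.cons a (Fin.insertNth j (-a) y)) := by
  have h1 : ∀ x : Fin (m + 2) → G, (cancelCount x : R) * F x =
      ∑ j : Fin (m + 1), if x j.succ = -x 0 then F x else 0 := by
    intro x
    rw [cancelCount, Finset.card_filter, Nat.cast_sum, Finset.sum_mul]
    refine Finset.sum_congr rfl fun j _ => ?_
    split_ifs <;> simp
  simp_rw [h1]
  rw [Finset.sum_comm]
  refine Finset.sum_congr rfl fun j _ => ?_
  rw [sum_zeroSum_eq_sum_pair j, Finset.sum_eq_single (0 : G)]
  · rw [Finset.sum_filter]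
    refine Finset.sum_congr rfl fun y _ => ?_
    rw [zero_add]
    refine if_congr Iff.rfl (Finset.sum_congr rfl fun a _ => ?_) rfl
    rw [Fin.cons_succ, Fin.insertNth_apply_same, Fin.cons_zero, if_pos (zero_sub a), zero_sub]
  · intro β _ hβ
    refine Finset.sum_eq_zero fun y _ => ?_
    split_ifs
    · refine Finset.sum_eq_zero fun a _ => ?_
      rw [Fin.cons_succ, Fin.insertNth_apply_same, Fin.cons_zero, if_neg]
      rw [sub_eq_add_neg, add_eq_right]
      exact hβ
    · rfl
  · simp

lemma cancelCount_cons_insertNth {m : ℕ} (j : Fin (m + 1)) (a : G) (y : Fin m → G) :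
    cancelCount (Fin.cons a (Fin.insertNth j (-a) y) : Fin (m + 2) → G) =
      1 + ∑ i, if y i = -a then 1 else 0 := by
  rw [cancelCount, Finset.card_filter]
  simp only [Fin.cons_succ, Fin.cons_zero]
  rw [Fin.sum_univ_succAbove _ j, Fin.insertNth_apply_same, if_pos rfl]
  simp only [Fin.insertNth_apply_succAbove]

/-- The recursion for the zero-sum moments of `w`: the pairs of opposite entries
give the main term. -/
lemma norm_zeroSum_recursion_le {w : G → ℂ} {f : G → ℝ} (hf : ∀ a, ‖w a‖ ≤ f a)
    (hneg : ∀ a, f (-a) = f a) (m : ℕ) :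
    ‖∑ x : Fin (m + 2) → G with ∑ i, x i = 0, ∏ i, w (x i) -
      (m + 1) * (∑ a, w a * w (-a)) * ∑ y : Fin m → G with ∑ i, y i = 0, ∏ i, w (y i)‖ ≤
    ∑ x : Fin (m + 2) → G with ∑ i, x i = 0, (if cancelCount x = 0 then ∏ i, f (x i) else 0) +
      (m + 1) * ∑ l : Fin m, ∑ y : Fin m → G with ∑ i, y i = 0, f (y l) ^ 2 * ∏ i, f (y i) := by
  have hf0 : ∀ a, 0 ≤ f a := fun a => (norm_nonneg _).trans (hf a)
  -- The product term counts each tuple as often as its first entry is cancelled, so the difference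
  -- weights a tuple by 1 - c with c = `cancelCount x`. The case c = 0 is the first error sum and c
  -- = 1 contributes nothing.
  have hmain : (m + 1) * (∑ a, w a * w (-a)) * ∑ y : Fin m → G with ∑ i, y i = 0, ∏ i, w (y i) =
      ∑ x : Fin (m + 2) → G with ∑ i, x i = 0, (cancelCount x : ℂ) * ∏ i, w (x i) := by
    rw [sum_cancelCount_smul]
    simp only [prod_cons_insertNth, ← Finset.sum_mul]
    rw [← Finset.mul_sum]
    simp
    ring
  -- For c ≥ 1 one uses c - 1 ≤ c (c - 1). The sum of c (c - 1) counts two cancelling positions, so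
  -- after one pair is removed some entry of y again equals -a; this produces the extra square.
  have herr : (m + 1) * ∑ l : Fin m, ∑ y : Fin m → G with ∑ i, y i = 0,
      f (y l) ^ 2 * ∏ i, f (y i) =
      ∑ x : Fin (m + 2) → G with ∑ i, x i = 0,
        (cancelCount x : ℝ) * (((cancelCount x : ℝ) - 1) * ∏ i, f (x i)) := by
    rw [sum_cancelCount_smul]
    simp only [prod_cons_insertNth, cancelCount_cons_insertNth]
    rw [Finset.sum_const, Finset.card_univ, Fintype.card_fin, nsmul_eq_mul]
    push_cast
    congr 1
    rw [Finset.sum_comm]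
    refine Finset.sum_congr rfl fun y _ => ?_
    have : ∀ a : G, (1 + ∑ i, (if y i = -a then (1 : ℝ) else 0) - 1) *
        (f a * f (-a) * ∏ i, f (y i)) =
        ∑ i, if a = -y i then f a ^ 2 * ∏ i, f (y i) else 0 := by
      intro a
      rw [add_sub_cancel_left, Finset.sum_mul]
      refine Finset.sum_congr rfl fun i _ => ?_
      have e : y i = -a ↔ a = -y i := by rw [eq_comm, neg_eq_iff_eq_neg]
      simp only [e, hneg]
      split_ifs <;> ring
    simp_rw [this]
    rw [Finset.sum_comm]
    refine Finset.sum_congr rfl fun i _ => ?_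
    simp [hneg]
  rw [hmain, herr, ← Finset.sum_sub_distrib, ← Finset.sum_add_distrib]
  refine (norm_sum_le _ _).trans (Finset.sum_le_sum fun x _ => ?_)
  have hp : ‖∏ i, w (x i)‖ ≤ ∏ i, f (x i) := by
    rw [norm_prod]
    exact Finset.prod_le_prod (fun _ _ => norm_nonneg _) fun i _ => hf _
  have hp0 : 0 ≤ ∏ i, f (x i) := Finset.prod_nonneg fun i _ => hf0 _
  rcases Nat.eq_zero_or_pos (cancelCount x) with h0 | h0
  · simpa [h0] using hp
  · rw [if_neg h0.ne', zero_add, ← one_sub_mul, norm_mul]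
    have h1 : (1 : ℝ) ≤ cancelCount x := by exact_mod_cast h0
    have h2 : ‖(1 : ℂ) - cancelCount x‖ = (cancelCount x : ℝ) - 1 := by
      have : (1 : ℂ) - cancelCount x = ((1 - cancelCount x : ℝ) : ℂ) := by push_cast; rfl
      rw [this, Complex.norm_real, Real.norm_eq_abs, abs_sub_comm, abs_of_nonneg (by linarith)]
    rw [h2]
    calc ((cancelCount x : ℝ) - 1) * ‖∏ i, w (x i)‖
        ≤ 1 * (((cancelCount x : ℝ) - 1) * ∏ i, f (x i)) := by
          rw [one_mul]
          exact mul_le_mul_of_nonneg_left hp (by linarith)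
      _ ≤ _ := mul_le_mul_of_nonneg_right h1 (mul_nonneg (by linarith) hp0)

end PairRemoval

lemma Nat.dvd_prod_gcd_of_dvd_prod {ι : Type*} (s : Finset ι) (r : ι → ℕ) {a : ℕ}
    (h : a ∣ ∏ i ∈ s, r i) : a ∣ ∏ i ∈ s, Nat.gcd a (r i) := by
  classical
  have h1 : ∀ s : Finset ι, Nat.gcd a (∏ i ∈ s, r i) ∣ ∏ i ∈ s, Nat.gcd a (r i) := by
    intro s
    induction s using Finset.induction_on with
    | empty => simp
    | insert i s hi ih =>
      rw [Finset.prod_insert hi, Finset.prod_insert hi]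
      exact (Nat.gcd_mul_right_dvd_mul_gcd _ _ _).trans (mul_dvd_mul_left _ ih)
  have h2 := h1 s
  rwa [Nat.gcd_eq_left h] at h2

lemma addOrderOf_sum_dvd_prod {G ι : Type*} [AddCommGroup G] (s : Finset ι) (x : ι → G) :
    addOrderOf (∑ i ∈ s, x i) ∣ ∏ i ∈ s, addOrderOf (x i) := by
  apply addOrderOf_dvd_of_nsmul_eq_zero
  rw [Finset.smul_sum]
  refine Finset.sum_eq_zero fun i hi => ?_
  rw [← addOrderOf_dvd_iff_nsmul_eq_zero]
  exact Finset.dvd_prod_of_mem _ hi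

/-- In a zero-sum tuple without cancelling pair, the first entry has small order or its order
has a large common divisor with the order of another entry. -/
lemma addOrderOf_le_or_gcd {G : Type*} [AddCommGroup G] {m : ℕ} {x : Fin (m + 2) → G}
    (hx : ∑ i, x i = 0) (hfin : ∀ a : G, 0 < addOrderOf a) (D : ℝ) :
    (addOrderOf (x 0) : ℝ) ≤ D ^ (m + 1) ∨
      ∃ j : Fin (m + 1), D < (Nat.gcd (addOrderOf (x 0)) (addOrderOf (x j.succ)) : ℝ) := by
  by_contra! hcon
  obtain ⟨h1, h2⟩ := hcon
  -- The first entry is minus the sum of the others, so its order divides the product of their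
  -- orders, and therefore also the product of the gcds with them.
  have h3 : addOrderOf (x 0) ∣ ∏ j : Fin (m + 1), addOrderOf (x j.succ) := by
    rw [Fin.sum_univ_succ] at hx
    rw [eq_neg_of_add_eq_zero_left hx, addOrderOf_neg]
    exact addOrderOf_sum_dvd_prod _ _
  have h4 := Nat.le_of_dvd (Finset.prod_pos fun j _ => Nat.gcd_pos_of_pos_left _ (hfin _))
    (Nat.dvd_prod_gcd_of_dvd_prod _ _ h3)
  have h5 : (addOrderOf (x 0) : ℝ) ≤
      ∏ j : Fin (m + 1), (Nat.gcd (addOrderOf (x 0)) (addOrderOf (x j.succ)) : ℝ) := by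
    exact_mod_cast h4
  have h6 : ∏ j : Fin (m + 1), (Nat.gcd (addOrderOf (x 0)) (addOrderOf (x j.succ)) : ℝ) ≤
      ∏ j : Fin (m + 1), D :=
    Finset.prod_le_prod (fun _ _ => Nat.cast_nonneg _) fun j _ => h2 j
  rw [Finset.prod_const, Finset.card_univ, Fintype.card_fin] at h6
  linarith

/-! ### Bounds for zero-sum tuples of majorants -/

/-- A nonzero element of order r is at distance at least 1/r from 0. -/
lemma kern_le_addOrderOf {h : ℝ} (hh : 0 < h) {Q : ℕ} [NeZero Q] {α : ZMod Q} (hα : α ≠ 0) :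
    kern h α ≤ addOrderOf α := by
  obtain ⟨M, hM⟩ := ZMod.addOrderOf_dvd Q α
  obtain ⟨a, ha⟩ := exists_coord hM α rfl
  have ha0 : a ≠ 0 := by
    rintro rfl
    rw [mul_zero, ZMod.valMinAbs_eq_zero] at ha
    exact hα ha
  refine (kern_le_of_coord hh hM ha ha0).trans (div_le_self (Nat.cast_nonneg _) ?_)
  exact_mod_cast Int.one_le_abs ha0

lemma coeffBound_le_two_pow {h : ℝ} (hh : 0 < h) {Q : ℕ} [NeZero Q] (α : ZMod Q) :
    coeffBound h α ≤ 2 * 2 ^ (addOrderOf α).primeFactors.card := by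
  unfold coeffBound
  have hr : (0 : ℝ) < addOrderOf α := by exact_mod_cast addOrderOf_pos α
  split_ifs with h0
  · positivity
  · calc _ ≤ 2 * 2 ^ (addOrderOf α).primeFactors.card / (addOrderOf α : ℝ) * addOrderOf α := by
          gcongr
          exact kern_le_addOrderOf hh h0
      _ = _ := by field_simp

section Bounds

variable {Q : ℕ} [NeZero Q]

/-- The constants 4 and 2 are weakened to 16 so that all factors, including `gcdConv`, enter the
multilinear estimate with the same κ. -/
lemma sum_sq_coeffBound_le_of_min_le {h B : ℝ} (hh : 0 < h) {r : ℕ} (hr : r ∣ Q)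
    (hB : min h r ≤ B) :
    ∑ α : ZMod Q with addOrderOf α = r, coeffBound h α ^ 2 ≤
      (16 * √B * 16 ^ r.primeFactors.card) ^ 2 / r := by
  refine (sum_sq_coeffBound_le hh hr).trans ?_
  gcongr <;> norm_num

/-- The majorant is pointwise at most 2 · 2^ω(r), so cubing it does not change the power of h. This
is why a triple coincidence costs a full factor h compared with the main term. -/
lemma sum_sq_coeffBound_cube_le {h : ℝ} (hh : 0 < h) {r : ℕ} (hr : r ∣ Q) :
    ∑ α : ZMod Q with addOrderOf α = r, (coeffBound h α ^ 2 * coeffBound h α) ^ 2 ≤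
      (16 * √h * 16 ^ r.primeFactors.card) ^ 2 / r := by
  calc ∑ α : ZMod Q with addOrderOf α = r, (coeffBound h α ^ 2 * coeffBound h α) ^ 2
      ≤ ∑ α : ZMod Q with addOrderOf α = r,
        (2 * 2 ^ r.primeFactors.card) ^ 4 * coeffBound h α ^ 2 := by
        refine Finset.sum_le_sum fun α hα => ?_
        rw [Finset.mem_filter] at hα
        have h1 := coeffBound_le_two_pow hh α
        rw [hα.2] at h1
        rw [mul_pow, ← pow_mul]
        gcongr
        exact coeffBound_nonneg hh α
    _ ≤ (2 * 2 ^ r.primeFactors.card) ^ 4 *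
        ((4 * √(min h r) * 2 ^ r.primeFactors.card) ^ 2 / r) := by
        rw [← Finset.mul_sum]
        gcongr
        exact sum_sq_coeffBound_le hh hr
    _ = (16 * √(min h r) * 8 ^ r.primeFactors.card) ^ 2 / r := by
        rw [show (8 : ℝ) = 2 ^ 3 by norm_num, ← pow_mul]
        ring
    _ ≤ _ := by
        gcongr
        · exact min_le_left _ _
        · norm_num

lemma sum_zeroSum_coeffBound_le {h : ℝ} (hh : 0 < h) (hsq : Squarefree Q) (n : ℕ) :
    ∑ x : Fin n → ZMod Q with ∑ i, x i = 0, ∏ i, coeffBound h (x i) ≤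
      (∏ p ∈ Q.primeFactors, (1 + (1 + 16) ^ n / (p : ℝ))) * (16 * √h) ^ n := by
  have := sum_zeroSum_prod_le_of_sum_sq_le (κ := 16) (by norm_num) n Q hsq
    (fun _ => coeffBound h) (fun _ => 16 * √h) (fun _ _ => coeffBound_nonneg hh _)
    (fun _ => by positivity) (fun _ r hr => sum_sq_coeffBound_le_of_min_le hh hr (min_le_left _ _))
  simpa using this

lemma sum_zeroSum_coeffBound_cube_le {h : ℝ} (hh : 0 < h) (hsq : Squarefree Q) (n : ℕ)
    (l : Fin n) :
    ∑ x : Fin n → ZMod Q with ∑ i, x i = 0, coeffBound h (x l) ^ 2 * ∏ i, coeffBound h (x i) ≤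
      (∏ p ∈ Q.primeFactors, (1 + (1 + 16) ^ n / (p : ℝ))) * (16 * √h) ^ n := by
  have := sum_zeroSum_prod_le_of_sum_sq_le (κ := 16) (by norm_num) n Q hsq
    (fun i a => (if i = l then coeffBound h a ^ 2 else 1) * coeffBound h a) (fun _ => 16 * √h)
    (fun i a => mul_nonneg (by split_ifs <;> positivity) (coeffBound_nonneg hh _))
    (fun _ => by positivity) (fun i r hr => by
      by_cases hi : i = l
      · simpa [hi] using sum_sq_coeffBound_cube_le hh hr
      · simpa [hi] using sum_sq_coeffBound_le_of_min_le hh hr (min_le_left _ _))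
  simp only [Finset.prod_mul_distrib, Finset.prod_ite_eq', Finset.mem_univ, if_true,
    Finset.prod_const, Finset.card_univ, Fintype.card_fin] at this
  rwa [mul_pow (16 : ℝ)]

/-- Restricting the first entry to orders at most T replaces its constant √h by √T. -/
lemma sum_zeroSum_low_le {h : ℝ} (hh : 0 < h) (hsq : Squarefree Q) (n : ℕ) (T : ℝ) :
    ∑ x : Fin (n + 1) → ZMod Q with ∑ i, x i = 0,
        (if (addOrderOf (x 0) : ℝ) ≤ T then ∏ i, coeffBound h (x i) else 0) ≤
      (∏ p ∈ Q.primeFactors, (1 + (1 + 16) ^ (n + 1) / (p : ℝ))) *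
        (16 * √T * (16 * √h) ^ n) := by
  have := sum_zeroSum_prod_le_of_sum_sq_le (κ := 16) (by norm_num) (n + 1) Q hsq
    (Fin.cons (fun a => if (addOrderOf a : ℝ) ≤ T then coeffBound h a else 0)
      (fun _ => coeffBound h)) (Fin.cons (16 * √T) (fun _ => 16 * √h))
    (fun i a => by
      refine Fin.cases ?_ (fun i => ?_) i
      · rw [Fin.cons_zero]
        split_ifs
        · exact coeffBound_nonneg hh _
        · exact le_rfl
      · rw [Fin.cons_succ]
        exact coeffBound_nonneg hh _)
    (fun i => by
      refine Fin.cases ?_ (fun i => ?_) i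
      · rw [Fin.cons_zero]; positivity
      · rw [Fin.cons_succ]; positivity)
    (fun i r hr => by
      refine Fin.cases ?_ (fun i => ?_) i
      · rw [Fin.cons_zero, Fin.cons_zero]
        by_cases hT : (r : ℝ) ≤ T
        · refine le_trans (Finset.sum_le_sum fun α _ => ?_)
            (sum_sq_coeffBound_le_of_min_le hh hr ((min_le_right _ _).trans hT))
          split_ifs
          · exact le_rfl
          · rw [zero_pow two_ne_zero]; positivity
        · refine le_trans (le_of_eq (Finset.sum_eq_zero fun α hα => ?_)) (by positivity)
          rw [Finset.mem_filter] at hα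
          rw [hα.2, if_neg hT]
          norm_num
      · rw [Fin.cons_succ, Fin.cons_succ]
        exact sum_sq_coeffBound_le_of_min_le hh hr (min_le_left _ _))
  simpa [Fin.prod_univ_succ, Fin.cons_zero, Fin.cons_succ, ite_mul] using this

/-- The first entry and the j-th later one are merged into their sum β, which leaves a zero-sum
tuple of length m + 1 whose first factor is `gcdConv`. The exclusion of opposite entries says β ≠ 0
and matches the vanishing of `gcdConv` at 0. -/
lemma sum_zeroSum_gcd_le {h : ℝ} (hh : 0 < h) (hsq : Squarefree Q) (m : ℕ) {D A : ℝ} (hA : 0 ≤ A)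
    (hR : ∀ b : ℕ, b ∣ Q → ∑ β : ZMod Q with addOrderOf β = b, gcdConv h D β ^ 2 ≤
      (A * 16 ^ b.primeFactors.card) ^ 2 / b) (j : Fin (m + 1)) :
    ∑ x : Fin (m + 2) → ZMod Q with ∑ i, x i = 0,
        (if x j.succ ≠ -x 0 ∧ D < (Nat.gcd (addOrderOf (x 0)) (addOrderOf (x j.succ)) : ℝ)
          then ∏ i, coeffBound h (x i) else 0) ≤
      (∏ p ∈ Q.primeFactors, (1 + (1 + 16) ^ (m + 1) / (p : ℝ))) * (A * (16 * √h) ^ m) := by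
  have := sum_zeroSum_prod_le_of_sum_sq_le (κ := 16) (by norm_num) (m + 1) Q hsq
    (Fin.cons (gcdConv h D) (fun _ => coeffBound h)) (Fin.cons A (fun _ => 16 * √h))
    (fun i a => by
      refine Fin.cases ?_ (fun i => ?_) i
      · rw [Fin.cons_zero]
        exact gcdConv_nonneg hh D _
      · rw [Fin.cons_succ]
        exact coeffBound_nonneg hh _)
    (fun i => by
      refine Fin.cases ?_ (fun i => ?_) i
      · rw [Fin.cons_zero]; exact hA
      · rw [Fin.cons_succ]; positivity)
    (fun i r hr => by
      refine Fin.cases ?_ (fun i => ?_) i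
      · rw [Fin.cons_zero, Fin.cons_zero]
        exact hR r hr
      · rw [Fin.cons_succ, Fin.cons_succ]
        exact sum_sq_coeffBound_le_of_min_le hh hr (min_le_left _ _))
  refine le_trans (le_of_eq ?_) (this.trans (le_of_eq ?_))
  · rw [sum_zeroSum_eq_sum_pair j, Finset.sum_filter, sum_fin_succ_pi 0]
    refine Finset.sum_congr rfl fun β _ => Finset.sum_congr rfl fun y _ => ?_
    rw [Fin.insertNth_zero', Fin.sum_univ_succ, Fin.prod_univ_succ]
    simp only [Fin.cons_zero, Fin.cons_succ, Fin.insertNth_apply_same]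
    refine if_congr Iff.rfl ?_ rfl
    have hprod : ∀ a, ∏ i, coeffBound h ((Fin.cons a (Fin.insertNth j (β - a) y :
        Fin (m + 1) → ZMod Q) : Fin (m + 2) → ZMod Q) i) =
        coeffBound h a * coeffBound h (β - a) * ∏ i, coeffBound h (y i) :=
      fun a => prod_cons_insertNth _ _ _ _ _
    simp only [hprod]
    unfold gcdConv
    split_ifs with hβ
    · simp [hβ]
    · rw [Finset.sum_filter, Finset.sum_mul]
      refine Finset.sum_congr rfl fun a _ => ?_
      have e : β - a ≠ -a := by
        rw [sub_eq_add_neg, Ne, add_eq_right]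
        exact hβ
      simp only [e, ne_eq, not_false_eq_true, true_and]
      split_ifs <;> simp
  · rw [Fin.prod_univ_succ]
    simp

end Bounds

/-! ### Gaussian moments when all primes of the modulus are small -/

/-- The zero-sum moment of a function. -/
noncomputable def zeroSumMoment {Q : ℕ} [NeZero Q] (w : ZMod Q → ℂ) (n : ℕ) : ℂ :=
  ∑ x : Fin n → ZMod Q with ∑ i, x i = 0, ∏ i, w (x i)

lemma sqrt_mul_pow_eq_rpow {N : ℝ} (hN : 0 ≤ N) (n : ℕ) :
    (16 * √N) ^ n = 16 ^ n * N ^ ((n : ℝ) / 2) := by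
  rw [mul_pow, Real.sqrt_eq_rpow, ← Real.rpow_mul_natCast hN]
  congr 2; ring

lemma exists_norm_zeroSumMoment_le (k : ℕ) {ε : ℝ} (hε : 0 < ε) :
    ∃ C : ℝ, 0 < C ∧ ∀ (Q N : ℕ) [NeZero Q], 1 ≤ N → Squarefree Q →
      (∀ p ∈ Q.primeFactors, p ≤ N) → ∀ w : ZMod Q → ℂ, (∀ a, ‖w a‖ ≤ coeffBound N a) →
      ‖zeroSumMoment w k‖ ≤ C * (N : ℝ) ^ ((k : ℝ) / 2 + ε) := by
  obtain ⟨K, hK1, hK⟩ := exists_prod_primes_le ((1 + 16) ^ k) (by positivity) hε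
  refine ⟨K * 16 ^ k, by positivity, ?_⟩
  intro Q N _ hN hsq hQp w hw
  have hN' : (0 : ℝ) < N := by exact_mod_cast hN
  calc ‖zeroSumMoment w k‖
      ≤ ∑ x : Fin k → ZMod Q with ∑ i, x i = 0, ∏ i, coeffBound N (x i) := by
        refine (norm_sum_le _ _).trans (Finset.sum_le_sum fun x _ => ?_)
        rw [norm_prod]
        exact Finset.prod_le_prod (fun _ _ => norm_nonneg _) fun i _ => hw _
    _ ≤ _ := sum_zeroSum_coeffBound_le hN' hsq k
    _ ≤ (K * (N : ℝ) ^ ε) * (16 * √N) ^ k := by gcongr; exact hK N Q hN hQp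
    _ = _ := by
        rw [sqrt_mul_pow_eq_rpow hN'.le, Real.rpow_add hN']
        ring

/-- Relative to N^((m+2)/2) and up to N^ε factors, the tuples with a small first order save N^(1/4),
those with a large gcd save √D, and the triple coincidences save N. The gcd saving N^(1/(4(m+1))) is
the smallest and still exceeds the required one. -/
lemma exists_zeroSumMoment_recursion (m : ℕ) :
    ∃ C : ℝ, 0 < C ∧ ∀ (Q N : ℕ) [NeZero Q], 1 ≤ N → Squarefree Q →
      (∀ p ∈ Q.primeFactors, p ≤ N) → ∀ w : ZMod Q → ℂ, (∀ a, ‖w a‖ ≤ coeffBound N a) →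
      ‖zeroSumMoment w (m + 2) - (m + 1) * (∑ a, w a * w (-a)) * zeroSumMoment w m‖ ≤
        C * (N : ℝ) ^ (((m + 2 : ℕ) : ℝ) / 2 - 1 / (7 * ((m + 2 : ℕ) : ℝ))) := by
  -- Small enough that 1/4 - 3/80 ≥ 1/7 after multiplication by m + 2; losses of 3ε/2 occur.
  set ε : ℝ := 1 / (40 * (m + 2)) with hεdef
  have hε : 0 < ε := by positivity
  obtain ⟨K₁, hK₁1, hK₁⟩ := exists_prod_primes_le ((1 + 16) ^ (m + 2)) (by positivity) hε
  obtain ⟨K₂, hK₂1, hK₂⟩ := exists_sum_sq_gcdConv_le hε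
  refine ⟨K₁ * (16 * 16 ^ (m + 1)) + (m + 1) * (K₁ * (K₂ * 16 ^ m)) + (m + 1) * (m * (K₁ * 16 ^ m)),
    by positivity, ?_⟩
  intro Q N _ hN hsq hQp w hw
  have hN1 : (1 : ℝ) ≤ N := by exact_mod_cast hN
  have hN' : (0 : ℝ) < N := by exact_mod_cast hN
  set e : ℝ := ((m + 2 : ℕ) : ℝ) / 2 - 1 / (7 * ((m + 2 : ℕ) : ℝ)) with he
  set P : ℕ → ℝ := fun n => ∏ p ∈ Q.primeFactors, (1 + (1 + 16) ^ n / (p : ℝ)) with hP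
  have hPn : ∀ n, n ≤ m + 2 → P n ≤ K₁ * (N : ℝ) ^ ε := fun n hn => by
    refine le_trans (Finset.prod_le_prod (fun _ _ => by positivity) fun p _ => ?_) (hK₁ N Q hN hQp)
    gcongr
    norm_num
  -- Chosen so that D^(m+1) = √N: the orders below this threshold replace √N by N^(1/4) for the
  -- first factor.
  set D : ℝ := (N : ℝ) ^ (1 / (2 * ((m : ℝ) + 1))) with hD
  have hm0 : (0 : ℝ) ≤ m := Nat.cast_nonneg m
  have hD1 : 1 ≤ D := Real.one_le_rpow hN1 (by positivity)
  have hDN : D ≤ N := by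
    conv_rhs => rw [← Real.rpow_one (N : ℝ)]
    refine Real.rpow_le_rpow_of_exponent_le hN1 ?_
    rw [div_le_one (by positivity)]
    linarith
  have hDm : D ^ (m + 1) = (N : ℝ) ^ (1 / 2 : ℝ) := by
    rw [hD, ← Real.rpow_mul_natCast hN'.le]
    congr 1
    push_cast
    field_simp
  have hmono : ∀ x : ℝ, x ≤ e → (N : ℝ) ^ x ≤ (N : ℝ) ^ e := fun x hx =>
    Real.rpow_le_rpow_of_exponent_le hN1 hx
  have hεe : ∀ c : ℝ, 1 / (4 * ((m : ℝ) + 1)) ≤ c → c ≤ 1 →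
      ((m : ℝ) + 2) / 2 - c + ε + ε / 2 ≤ e := by
    intro c hc _
    rw [he, hεdef]
    push_cast
    have h1 : 1 / (4 * ((m : ℝ) + 2)) ≤ 1 / (4 * ((m : ℝ) + 1)) := by gcongr; linarith
    have h2 : 1 / (4 * ((m : ℝ) + 2)) = 1 / 4 * (1 / ((m : ℝ) + 2)) := by field_simp
    have h3 : 1 / (40 * ((m : ℝ) + 2)) = 1 / 40 * (1 / ((m : ℝ) + 2)) := by field_simp
    have h4 : 1 / (7 * ((m : ℝ) + 2)) = 1 / 7 * (1 / ((m : ℝ) + 2)) := by field_simp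
    have h5 : 0 ≤ 1 / ((m : ℝ) + 2) := by positivity
    rw [h3, h4]
    rw [h2] at h1
    linarith
  -- the three parts of the error
  have hlow : ∑ x : Fin (m + 2) → ZMod Q with ∑ i, x i = 0,
      (if (addOrderOf (x 0) : ℝ) ≤ D ^ (m + 1) then ∏ i, coeffBound N (x i) else 0) ≤
      K₁ * (16 * 16 ^ (m + 1)) * (N : ℝ) ^ e := by
    refine (sum_zeroSum_low_le hN' hsq (m + 1) _).trans ?_
    have h1 : √(D ^ (m + 1)) = (N : ℝ) ^ (1 / 4 : ℝ) := by
      rw [hDm, Real.sqrt_eq_rpow, ← Real.rpow_mul hN'.le]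
      norm_num
    calc P (m + 1 + 1) * (16 * √(D ^ (m + 1)) * (16 * √N) ^ (m + 1))
        ≤ K₁ * (N : ℝ) ^ ε * (16 * √(D ^ (m + 1)) * (16 * √N) ^ (m + 1)) := by
          gcongr
          exact hPn _ le_rfl
      _ = K₁ * (16 * 16 ^ (m + 1)) * (N : ℝ) ^ (ε + 1 / 4 + ((m + 1 : ℕ) : ℝ) / 2) := by
          rw [h1, sqrt_mul_pow_eq_rpow hN'.le, Real.rpow_add hN', Real.rpow_add hN']
          ring
      _ ≤ _ := by
          gcongr ?_ * ?_
          refine hmono _ ((le_trans ?_ (hεe (1 / 4) ?_ (by norm_num))))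
          · push_cast; linarith
          · gcongr; linarith
  have hgcd : ∀ j : Fin (m + 1), ∑ x : Fin (m + 2) → ZMod Q with ∑ i, x i = 0,
      (if x j.succ ≠ -x 0 ∧ D < (Nat.gcd (addOrderOf (x 0)) (addOrderOf (x j.succ)) : ℝ)
        then ∏ i, coeffBound N (x i) else 0) ≤ K₁ * (K₂ * 16 ^ m) * (N : ℝ) ^ e := by
    intro j
    refine (sum_zeroSum_gcd_le hN' hsq m (by positivity)
      (hK₂ Q N hN hsq hQp D hD1 hDN) j).trans ?_
    have h1 : √((N : ℝ) ^ (2 + ε) / D) = (N : ℝ) ^ (1 + ε / 2 - 1 / (4 * ((m : ℝ) + 1))) := by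
      rw [hD, ← Real.rpow_sub hN', Real.sqrt_eq_rpow, ← Real.rpow_mul hN'.le]
      congr 1
      field_simp
      ring
    calc P (m + 1) * (K₂ * √((N : ℝ) ^ (2 + ε) / D) * (16 * √N) ^ m)
        ≤ K₁ * (N : ℝ) ^ ε * (K₂ * √((N : ℝ) ^ (2 + ε) / D) * (16 * √N) ^ m) := by
          gcongr
          exact hPn _ (by omega)
      _ = K₁ * (K₂ * 16 ^ m) *
          (N : ℝ) ^ (ε + (1 + ε / 2 - 1 / (4 * ((m : ℝ) + 1))) + (m : ℝ) / 2) := by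
          rw [h1, sqrt_mul_pow_eq_rpow hN'.le, Real.rpow_add hN', Real.rpow_add hN']
          ring
      _ ≤ _ := by
          gcongr ?_ * ?_
          refine hmono _ (le_trans (le_of_eq ?_) (hεe _ le_rfl ?_))
          · ring
          · rw [div_le_one (by positivity)]; linarith
  have hcube : ∀ l : Fin m, ∑ y : Fin m → ZMod Q with ∑ i, y i = 0,
      coeffBound N (y l) ^ 2 * ∏ i, coeffBound N (y i) ≤ K₁ * 16 ^ m * (N : ℝ) ^ e := by
    intro l
    refine (sum_zeroSum_coeffBound_cube_le hN' hsq m l).trans ?_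
    calc P m * (16 * √N) ^ m ≤ K₁ * (N : ℝ) ^ ε * (16 * √N) ^ m := by
          gcongr
          exact hPn _ (by omega)
      _ = K₁ * 16 ^ m * (N : ℝ) ^ (ε + (m : ℝ) / 2) := by
          rw [sqrt_mul_pow_eq_rpow hN'.le, Real.rpow_add hN']
          ring
      _ ≤ _ := by
          gcongr ?_ * ?_
          refine hmono _ ((le_trans ?_ (hεe 1 ?_ le_rfl)))
          · linarith
          · rw [div_le_one (by positivity)]; linarith
  have hcover : ∑ x : Fin (m + 2) → ZMod Q with ∑ i, x i = 0,
      (if cancelCount x = 0 then ∏ i, coeffBound N (x i) else 0) ≤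
      ∑ x : Fin (m + 2) → ZMod Q with ∑ i, x i = 0,
        (if (addOrderOf (x 0) : ℝ) ≤ D ^ (m + 1) then ∏ i, coeffBound N (x i) else 0) +
      ∑ j : Fin (m + 1), ∑ x : Fin (m + 2) → ZMod Q with ∑ i, x i = 0,
      (if x j.succ ≠ -x 0 ∧ D < (Nat.gcd (addOrderOf (x 0)) (addOrderOf (x j.succ)) : ℝ)
        then ∏ i, coeffBound N (x i) else 0) := by
    rw [Finset.sum_comm, ← Finset.sum_add_distrib]
    refine Finset.sum_le_sum fun x hx => ?_
    rw [Finset.mem_filter] at hx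
    have hp0 : 0 ≤ ∏ i, coeffBound N (x i) :=
      Finset.prod_nonneg fun i _ => coeffBound_nonneg hN' _
    have hs0 : ∀ j : Fin (m + 1), 0 ≤ (if x j.succ ≠ -x 0 ∧
        D < (Nat.gcd (addOrderOf (x 0)) (addOrderOf (x j.succ)) : ℝ)
        then ∏ i, coeffBound N (x i) else 0) := fun j => by split_ifs <;> [exact hp0; exact le_rfl]
    split_ifs with hc hl hl
    · exact le_add_of_nonneg_right (Finset.sum_nonneg fun j _ => hs0 j)
    · rw [zero_add]
      obtain ⟨j, hj⟩ := (addOrderOf_le_or_gcd hx.2 (fun a => addOrderOf_pos a) D).resolve_left hl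
      have hne : x j.succ ≠ -x 0 := fun h => by
        have : j ∈ Finset.univ.filter fun j : Fin (m + 1) => x j.succ = -x 0 := by simp [h]
        rw [cancelCount, Finset.card_eq_zero] at hc
        rw [hc] at this
        simp at this
      refine le_trans ?_ (Finset.single_le_sum (fun j _ => hs0 j) (Finset.mem_univ j))
      rw [if_pos ⟨hne, hj⟩]
    · exact add_nonneg hp0 (Finset.sum_nonneg fun j _ => hs0 j)
    · exact add_nonneg le_rfl (Finset.sum_nonneg fun j _ => hs0 j)
  refine (norm_zeroSum_recursion_le hw (fun a => coeffBound_neg _ a) m).trans ?_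
  have h1 := Finset.sum_le_sum fun (j : Fin (m + 1)) (_ : j ∈ Finset.univ) => hgcd j
  have h2 := Finset.sum_le_sum fun (j : Fin m) (_ : j ∈ Finset.univ) => hcube j
  rw [Finset.sum_const, Finset.card_univ, Fintype.card_fin, nsmul_eq_mul] at h1 h2
  push_cast at h1
  have h3 := mul_le_mul_of_nonneg_left h2 (show (0 : ℝ) ≤ m + 1 by positivity)
  calc _ ≤ (K₁ * (16 * 16 ^ (m + 1)) * (N : ℝ) ^ e +
        ((m : ℝ) + 1) * (K₁ * (K₂ * 16 ^ m) * (N : ℝ) ^ e)) +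
        ((m : ℝ) + 1) * (m * (K₁ * 16 ^ m * (N : ℝ) ^ e)) :=
        add_le_add (hcover.trans (add_le_add hlow h1)) h3
    _ = _ := by ring

lemma gaussMoment_add_two (k : ℕ) : gaussMoment (k + 2) = (k + 1) * gaussMoment k := by
  unfold gaussMoment
  by_cases hk : Even k
  · rw [if_pos hk, if_pos (hk.add (by decide))]
    rcases k with _ | k
    · rfl
    · rw [show k + 1 + 2 - 1 = k + 2 by omega, Nat.doubleFactorial_add_two]
      rfl
  · rw [if_neg hk, if_neg (by rw [Nat.even_add]; simp [hk]), mul_zero]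

lemma zeroSumMoment_one {Q : ℕ} [NeZero Q] (w : ZMod Q → ℂ) : zeroSumMoment w 1 = w 0 := by
  rw [zeroSumMoment, Finset.sum_filter, sum_fin_succ_pi 0]
  simp

lemma zeroSumMoment_two {Q : ℕ} [NeZero Q] (w : ZMod Q → ℂ) :
    zeroSumMoment w 2 = ∑ a, w a * w (-a) := by
  rw [zeroSumMoment, sum_zeroSum_eq_sum_pair 0]
  simp [Fin.insertNth_zero']

/-- The zero-sum moments are close to the Gaussian ones. -/
lemma exists_zeroSumMoment_sub_gaussMoment_le (k : ℕ) (hk : 1 ≤ k) :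
    ∃ C : ℝ, 0 < C ∧ ∀ (Q N : ℕ) [NeZero Q], 1 ≤ N → Squarefree Q →
      (∀ p ∈ Q.primeFactors, p ≤ N) → ∀ w : ZMod Q → ℂ, (∀ a, ‖w a‖ ≤ coeffBound N a) →
      ‖zeroSumMoment w k - gaussMoment k * zeroSumMoment w 2 ^ (k / 2)‖ ≤
        C * (N : ℝ) ^ ((k : ℝ) / 2 - 1 / (7 * (k : ℝ))) := by
  induction k using Nat.strong_induction_on with
  | _ k ih =>
  obtain rfl | rfl | hk3 : k = 1 ∨ k = 2 ∨ 3 ≤ k := by omega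
  · refine ⟨1, one_pos, fun Q N _ hN _ _ w hw => ?_⟩
    have h0 : w 0 = 0 := by simpa [coeffBound] using hw 0
    rw [zeroSumMoment_one, h0]
    simp only [gaussMoment]
    norm_num
    positivity
  · refine ⟨1, one_pos, fun Q N _ hN _ _ w hw => ?_⟩
    simp only [gaussMoment]
    norm_num
    positivity
  · obtain ⟨m, rfl⟩ : ∃ m, k = m + 2 := ⟨k - 2, by omega⟩
    have hm1 : 1 ≤ m := by omega
    obtain ⟨C₁, hC₁, h₁⟩ := ih m (by omega) hm1
    obtain ⟨C₂, hC₂, h₂⟩ := exists_zeroSumMoment_recursion m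
    have hmR : (1 : ℝ) ≤ m := by exact_mod_cast hm1
    -- The saving at m exceeds the one wanted at m + 2 by exactly this amount, so the second moment
    -- may be as large as N^(1+ε).
    set ε : ℝ := 1 / (7 * m) - 1 / (7 * (m + 2)) with hεdef
    have hε : 0 < ε := by
      rw [hεdef, sub_pos]
      gcongr
      linarith
    obtain ⟨C₃, hC₃, h₃⟩ := exists_norm_zeroSumMoment_le 2 hε
    refine ⟨C₂ + (m + 1) * (C₃ * C₁), by positivity, fun Q N _ hN hsq hQp w hw => ?_⟩
    have hN' : (0 : ℝ) < N := by exact_mod_cast hN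
    have a₁ := h₁ Q N hN hsq hQp w hw
    have a₂ := h₂ Q N hN hsq hQp w hw
    have a₃ := h₃ Q N hN hsq hQp w hw
    rw [← zeroSumMoment_two] at a₂
    have e : zeroSumMoment w (m + 2) -
        gaussMoment (m + 2) * zeroSumMoment w 2 ^ ((m + 2) / 2) =
        (zeroSumMoment w (m + 2) - (m + 1) * zeroSumMoment w 2 * zeroSumMoment w m) +
        (m + 1) * (zeroSumMoment w 2 *
          (zeroSumMoment w m - gaussMoment m * zeroSumMoment w 2 ^ (m / 2))) := by
      rw [gaussMoment_add_two, show (m + 2) / 2 = m / 2 + 1 by omega]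
      push_cast
      ring
    rw [e]
    refine (norm_add_le _ _).trans ?_
    have hm : ‖((m : ℂ) + 1)‖ = m + 1 := by
      have : ((m : ℂ) + 1) = ((m + 1 : ℕ) : ℂ) := by push_cast; rfl
      rw [this, Complex.norm_natCast]; push_cast; rfl
    rw [norm_mul, norm_mul, hm]
    calc _ ≤ C₂ * (N : ℝ) ^ (((m + 2 : ℕ) : ℝ) / 2 - 1 / (7 * ((m + 2 : ℕ) : ℝ))) +
          (m + 1) * ((C₃ * (N : ℝ) ^ (((2 : ℕ) : ℝ) / 2 + ε)) *
            (C₁ * (N : ℝ) ^ ((m : ℝ) / 2 - 1 / (7 * (m : ℝ))))) := by gcongr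
      _ = _ := by
        have : (N : ℝ) ^ (((m + 2 : ℕ) : ℝ) / 2 - 1 / (7 * ((m + 2 : ℕ) : ℝ))) =
            (N : ℝ) ^ (((2 : ℕ) : ℝ) / 2 + ε) * (N : ℝ) ^ ((m : ℝ) / 2 - 1 / (7 * (m : ℝ))) := by
          rw [← Real.rpow_add hN']
          congr 1
          rw [hεdef]
          push_cast
          ring
        rw [this]
        ring

/-! ### Fourier analysis of the unit count -/

lemma ZMod.sum_eq_sum_range {Q : ℕ} [NeZero Q] {M : Type*} [AddCommMonoid M] (F : ZMod Q → M) :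
    ∑ y, F y = ∑ n ∈ Finset.range Q, F n := by
  refine Finset.sum_nbij' (fun y => y.val) (fun n => (n : ZMod Q)) (fun y _ => ?_)
    (fun _ _ => Finset.mem_univ _) (fun y _ => ?_) (fun n hn => ?_) (fun y _ => ?_)
  · exact Finset.mem_range.2 (ZMod.val_lt y)
  · exact ZMod.natCast_zmod_val y
  · exact ZMod.val_cast_of_lt (Finset.mem_range.1 hn)
  · rw [ZMod.natCast_zmod_val]

lemma sum_range_dvd {M : Type*} [AddCommMonoid M] {Q d : ℕ} (hQ : 0 < Q) (hd : d ∣ Q) (F : ℕ → M) :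
    ∑ n ∈ Finset.range Q, (if d ∣ n then F n else 0) =
      ∑ i ∈ Finset.range (Q / d), F (d * i) := by
  have hd0 : 0 < d := Nat.pos_of_dvd_of_pos hd hQ
  rw [← Finset.sum_filter]
  refine Finset.sum_nbij' (fun n => n / d) (fun i => d * i) ?_ ?_ ?_ ?_ ?_
  · intro n hn
    rw [Finset.mem_filter, Finset.mem_range] at hn
    exact Finset.mem_range.2 (Nat.div_lt_div_of_lt_of_dvd hd hn.1)
  · intro i hi
    rw [Finset.mem_range] at hi
    rw [Finset.mem_filter, Finset.mem_range]
    refine ⟨?_, dvd_mul_right _ _⟩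
    calc d * i < d * (Q / d) := Nat.mul_lt_mul_of_pos_left hi hd0
      _ = Q := Nat.mul_div_cancel' hd
  · intro n hn
    rw [Finset.mem_filter] at hn
    exact Nat.mul_div_cancel' hn.2
  · intro i _
    exact Nat.mul_div_cancel_left i hd0
  · intro n hn
    rw [Finset.mem_filter] at hn
    simp only [Nat.mul_div_cancel' hn.2]

lemma sum_stdAddChar_of_dvd {Q : ℕ} [NeZero Q] {d : ℕ} (hd : d ∣ Q) (α : ZMod Q) :
    ∑ n ∈ Finset.range Q, (if d ∣ n then ZMod.stdAddChar (α * (n : ZMod Q)) else 0) =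
      if addOrderOf α ∣ d then ((Q / d : ℕ) : ℂ) else 0 := by
  rw [sum_range_dvd (NeZero.pos Q) hd]
  have h1 : ∀ i : ℕ, (ZMod.stdAddChar (α * ((d * i : ℕ) : ZMod Q)) : ℂ) =
      ZMod.stdAddChar (d • α) ^ i := by
    intro i
    rw [← AddChar.map_nsmul_eq_pow]
    congr 1
    simp only [nsmul_eq_mul]
    push_cast
    ring
  simp_rw [h1]
  simp only [addOrderOf_dvd_iff_nsmul_eq_zero]
  split_ifs with h0
  · simp [h0]
  · have h2 : (ZMod.stdAddChar (d • α) : ℂ) ≠ 1 := by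
      rw [← (ZMod.stdAddChar (N := Q)).map_zero_eq_one]
      exact fun h => h0 (ZMod.injective_stdAddChar h)
    have h3 := geom_sum_mul (ZMod.stdAddChar (d • α) : ℂ) (Q / d)
    rw [← AddChar.map_nsmul_eq_pow, ← mul_nsmul, Nat.mul_div_cancel' hd] at h3
    have h4 : Q • α = 0 := by simp [nsmul_eq_mul]
    rw [h4, AddChar.map_zero_eq_one, sub_self] at h3
    exact (mul_eq_zero.1 h3).resolve_right (sub_ne_zero.2 h2)

lemma sum_moebius_gcd {Q : ℕ} (hQ : Q ≠ 0) (n : ℕ) :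
    ∑ d ∈ Q.divisors, (if d ∣ n then (ArithmeticFunction.moebius d : ℂ) else 0) =
      if Nat.Coprime n Q then 1 else 0 := by
  have h := congrArg (fun f : ArithmeticFunction ℤ => f (Nat.gcd n Q))
    ArithmeticFunction.coe_zeta_mul_moebius
  simp only [ArithmeticFunction.coe_zeta_mul_apply, ArithmeticFunction.one_apply] at h
  rw [← Finset.sum_filter]
  have hfil : Q.divisors.filter (fun d => d ∣ n) = (Nat.gcd n Q).divisors := by
    ext d
    simp only [Finset.mem_filter, Nat.mem_divisors, Nat.dvd_gcd_iff, ne_eq, Nat.gcd_eq_zero_iff]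
    tauto
  rw [hfil]
  unfold Nat.Coprime
  exact_mod_cast h

lemma sum_moebius_mul_div (n : ℕ) (hn : 0 < n) :
    ∑ d ∈ n.divisors, (ArithmeticFunction.moebius d : ℂ) * ((n / d : ℕ) : ℂ) = (n.totient : ℂ) := by
  have h := (ArithmeticFunction.sum_eq_iff_sum_mul_moebius_eq (R := ℂ)
    (f := fun m => (m.totient : ℂ)) (g := fun m => (m : ℂ))).1 (fun m _ => by
      exact_mod_cast Nat.sum_totient m) n hn
  rwa [Nat.sum_divisorsAntidiagonal
    (fun a b => ((ArithmeticFunction.moebius a : ℂ)) * (b : ℂ))] at h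

/-- Ramanujan sums to squarefree moduli. -/
lemma norm_sum_units_stdAddChar {Q : ℕ} [NeZero Q] (hsq : Squarefree Q) (α : ZMod Q) :
    ‖∑ n ∈ Finset.range Q, (if Nat.Coprime n Q then
      (ZMod.stdAddChar (α * (n : ZMod Q)) : ℂ) else 0)‖ = (Q / addOrderOf α).totient := by
  have hQ0 : Q ≠ 0 := NeZero.ne Q
  obtain ⟨e, he⟩ := ZMod.addOrderOf_dvd Q α
  set r := addOrderOf α with hr
  have hr0 : 0 < r := addOrderOf_pos α
  have he0 : 0 < e := Nat.pos_of_ne_zero fun h => hQ0 (by rw [he, h, mul_zero])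
  have h1 : ∀ n : ℕ, (if Nat.Coprime n Q then (ZMod.stdAddChar (α * (n : ZMod Q)) : ℂ) else 0) =
      ∑ d ∈ Q.divisors, (ArithmeticFunction.moebius d : ℂ) *
        (if d ∣ n then (ZMod.stdAddChar (α * (n : ZMod Q)) : ℂ) else 0) := by
    intro n
    have h2 := sum_moebius_gcd hQ0 n
    calc _ = (if Nat.Coprime n Q then (1 : ℂ) else 0) * ZMod.stdAddChar (α * (n : ZMod Q)) := by
          split_ifs <;> simp
      _ = _ := by
          rw [← h2, Finset.sum_mul]
          refine Finset.sum_congr rfl fun d _ => ?_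
          split_ifs <;> simp
  simp_rw [h1]
  rw [Finset.sum_comm]
  have h3 : ∑ d ∈ Q.divisors, ∑ n ∈ Finset.range Q, (ArithmeticFunction.moebius d : ℂ) *
        (if d ∣ n then (ZMod.stdAddChar (α * (n : ZMod Q)) : ℂ) else 0) =
      ∑ d ∈ Q.divisors, if r ∣ d then
        (ArithmeticFunction.moebius d : ℂ) * ((Q / d : ℕ) : ℂ) else 0 := by
    refine Finset.sum_congr rfl fun d hd => ?_
    rw [← Finset.mul_sum, sum_stdAddChar_of_dvd (Nat.dvd_of_mem_divisors hd)]
    split_ifs <;> simp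
  have hcop : Nat.Coprime r e := Nat.coprime_of_squarefree_mul (he ▸ hsq)
  -- Only d = r d' survive, and squarefreeness gives μ(r d') = μ(r) μ(d'); the remaining sum over d'
  -- is the totient of Q/r.
  have h4 : ∑ d ∈ Q.divisors, (if r ∣ d then
        (ArithmeticFunction.moebius d : ℂ) * ((Q / d : ℕ) : ℂ) else 0) =
      ∑ d ∈ e.divisors, (ArithmeticFunction.moebius r : ℂ) *
        ((ArithmeticFunction.moebius d : ℂ) * ((e / d : ℕ) : ℂ)) := by
    rw [← Finset.sum_filter]
    symm
    refine Finset.sum_nbij' (fun d => r * d) (fun d => d / r) ?_ ?_ ?_ ?_ ?_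
    · intro d hd
      rw [Nat.mem_divisors] at hd
      rw [Finset.mem_filter, Nat.mem_divisors]
      exact ⟨⟨by rw [he]; exact mul_dvd_mul_left _ hd.1, hQ0⟩, dvd_mul_right _ _⟩
    · intro d hd
      rw [Finset.mem_filter, Nat.mem_divisors] at hd
      obtain ⟨⟨h5, -⟩, c, rfl⟩ := hd
      rw [Nat.mul_div_cancel_left _ hr0, Nat.mem_divisors]
      rw [he] at h5
      exact ⟨Nat.dvd_of_mul_dvd_mul_left hr0 h5, he0.ne'⟩
    · intro d _
      exact Nat.mul_div_cancel_left d hr0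
    · intro d hd
      rw [Finset.mem_filter] at hd
      exact Nat.mul_div_cancel' hd.2
    · intro d hd
      rw [Nat.mem_divisors] at hd
      rw [ArithmeticFunction.isMultiplicative_moebius.map_mul_of_coprime
        (hcop.coprime_dvd_right hd.1)]
      have : Q / (r * d) = e / d := by rw [he, Nat.mul_div_mul_left _ _ hr0]
      rw [this]
      push_cast
      ring
  rw [h3, h4, ← Finset.mul_sum, sum_moebius_mul_div e he0, norm_mul, Complex.norm_natCast]
  have h5 : Q / r = e := by rw [he, Nat.mul_div_cancel_left _ hr0]
  have h6 : ‖(ArithmeticFunction.moebius r : ℂ)‖ = 1 := by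
    rw [Complex.norm_intCast]
    exact_mod_cast ArithmeticFunction.abs_moebius_eq_one_of_squarefree
      (hsq.squarefree_of_dvd ⟨e, he⟩)
  rw [h5, h6, one_mul]

lemma norm_stdAddChar_sub_one {Q : ℕ} [NeZero Q] (α : ZMod Q) :
    4 * circleDist α ≤ ‖(ZMod.stdAddChar α : ℂ) - 1‖ := by
  have hQ : (0 : ℝ) < Q := by exact_mod_cast NeZero.pos Q
  set a : ℤ := α.valMinAbs with ha
  have h1 : (ZMod.stdAddChar α : ℂ) = Complex.exp (Complex.I * ((2 * Real.pi * a / Q : ℝ) : ℂ)) := by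
    conv_lhs => rw [← ZMod.coe_valMinAbs α, ZMod.stdAddChar_coe]
    congr 1
    push_cast
    ring
  have hd : circleDist α = |(a : ℝ)| / Q := by
    unfold circleDist
    rw [Nat.cast_natAbs]
    push_cast
    rfl
  have hle : |(a : ℝ)| / Q ≤ 1 / 2 := by
    rw [div_le_div_iff₀ hQ two_pos, one_mul]
    have h2 := ZMod.natAbs_valMinAbs_le α
    have h3 : a.natAbs * 2 ≤ Q := by omega
    have h4 : ((a.natAbs : ℕ) : ℝ) = |(a : ℝ)| := by rw [Nat.cast_natAbs]; push_cast; rfl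
    rw [← h4]
    exact_mod_cast h3
  rw [h1, Complex.norm_exp_I_mul_ofReal_sub_one, hd, norm_mul, Real.norm_eq_abs, Real.norm_eq_abs,
    abs_two]
  have hx : |2 * Real.pi * a / Q / 2| = Real.pi * (|(a : ℝ)| / Q) := by
    rw [show 2 * Real.pi * a / Q / 2 = Real.pi * (a / Q) by ring, abs_mul, abs_div,
      abs_of_pos Real.pi_pos, abs_of_pos hQ]
  have h5 := Real.mul_abs_le_abs_sin (x := 2 * Real.pi * a / Q / 2) (by
    rw [hx]; nlinarith [Real.pi_pos])
  rw [hx] at h5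
  have h6 : 2 / Real.pi * (Real.pi * (|(a : ℝ)| / Q)) = 2 * (|(a : ℝ)| / Q) := by
    field_simp
  linarith

/-- Adding the trivial bound h to h times the geometric-sum bound |E| · distance ≤ 1/2 gives |E| (1
+ h · distance) ≤ 2h. -/
lemma norm_geom_sum_stdAddChar_le {Q : ℕ} [NeZero Q] {h : ℕ} (hh : 1 ≤ h) (α : ZMod Q) :
    ‖∑ j ∈ Finset.range h, (ZMod.stdAddChar (α * (j : ZMod Q)) : ℂ)‖ ≤ 2 * kern h α := by
  have hh' : (0 : ℝ) < h := by exact_mod_cast hh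
  have hd := circleDist_nonneg α
  have h1 : ∀ j : ℕ, (ZMod.stdAddChar (α * (j : ZMod Q)) : ℂ) = ZMod.stdAddChar α ^ j := by
    intro j
    rw [← AddChar.map_nsmul_eq_pow, nsmul_eq_mul, mul_comm]
  simp_rw [h1]
  set z : ℂ := ZMod.stdAddChar α with hz
  have hz1 : ‖z‖ = 1 := AddChar.norm_apply _ _
  set E := ∑ j ∈ Finset.range h, z ^ j with hE
  have hE1 : ‖E‖ ≤ h := by
    refine (norm_sum_le _ _).trans (le_of_eq ?_)
    simp [hz1]
  have hE2 : ‖E‖ * (4 * circleDist α) ≤ 2 := by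
    calc ‖E‖ * (4 * circleDist α) ≤ ‖E‖ * ‖z - 1‖ :=
          mul_le_mul_of_nonneg_left (norm_stdAddChar_sub_one α) (norm_nonneg _)
      _ = ‖z ^ h - 1‖ := by rw [← norm_mul, hE, geom_sum_mul]
      _ ≤ ‖z ^ h‖ + ‖(1 : ℂ)‖ := norm_sub_le _ _
      _ = 2 := by rw [norm_pow, hz1, one_pow, norm_one]; norm_num
  unfold kern
  rw [← mul_div_assoc, le_div_iff₀ (by positivity)]
  nlinarith

lemma inv_totient_le {r : ℕ} (hr : Squarefree r) :
    1 / (r.totient : ℝ) ≤ 2 ^ r.primeFactors.card / r := by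
  have hr0 : (0 : ℝ) < r := by exact_mod_cast Nat.pos_of_ne_zero hr.ne_zero
  have ht0 : (0 : ℝ) < r.totient := by
    exact_mod_cast Nat.totient_pos.2 (Nat.pos_of_ne_zero hr.ne_zero)
  rw [div_le_div_iff₀ ht0 hr0, one_mul]
  have h1 : r.totient = ∏ p ∈ r.primeFactors, (p - 1) := by
    have := Nat.totient_mul_prod_primeFactors r
    rw [Nat.prod_primeFactors_of_squarefree hr, mul_comm] at this
    exact Nat.eq_of_mul_eq_mul_left (Nat.pos_of_ne_zero hr.ne_zero) this
  have h2 : r ≤ 2 ^ r.primeFactors.card * r.totient := by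
    conv_lhs => rw [← Nat.prod_primeFactors_of_squarefree hr]
    rw [h1, ← Finset.prod_const, ← Finset.prod_mul_distrib]
    refine Finset.prod_le_prod' fun p hp => ?_
    have := (Nat.prime_of_mem_primeFactors hp).two_le
    omega
  exact_mod_cast h2

/-- The normalized count of units among `y, y + 1, …, y + h - 1`. -/
noncomputable def unitDev (Q h : ℕ) (y : ZMod Q) : ℝ :=
  ∑ j ∈ Finset.range h,
    (((Nat.totient Q : ℝ) / (Q : ℝ))⁻¹ * (if Nat.Coprime (y + j).val Q then (1 : ℝ) else 0) - 1)

/-- The moments of `unitDev`. -/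
noncomputable def unitMoment (k Q h : ℕ) [NeZero Q] : ℝ :=
  1 / (Q : ℝ) * ∑ y : ZMod Q, unitDev Q h y ^ k

/-- The Fourier coefficients of a function on `ZMod Q`. -/
noncomputable def fourierCoef {Q : ℕ} [NeZero Q] (g : ZMod Q → ℂ) (α : ZMod Q) : ℂ :=
  1 / (Q : ℂ) * ∑ y, g y * ZMod.stdAddChar (-(α * y))

lemma sum_stdAddChar_mul {Q : ℕ} [NeZero Q] (y : ZMod Q) :
    ∑ α : ZMod Q, (ZMod.stdAddChar (α * y) : ℂ) = if y = 0 then (Q : ℂ) else 0 := by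
  rw [AddChar.sum_mulShift y (ZMod.isPrimitive_stdAddChar Q), ZMod.card]
  split_ifs <;> simp

lemma sum_fourierCoef_mul {Q : ℕ} [NeZero Q] (g : ZMod Q → ℂ) (y : ZMod Q) :
    ∑ α, fourierCoef g α * ZMod.stdAddChar (α * y) = g y := by
  have hQ : (Q : ℂ) ≠ 0 := by exact_mod_cast NeZero.ne Q
  unfold fourierCoef
  simp_rw [mul_assoc, ← Finset.mul_sum, Finset.sum_mul]
  rw [Finset.sum_comm]
  have h1 : ∀ z α : ZMod Q, g z * ZMod.stdAddChar (-(α * z)) * ZMod.stdAddChar (α * y) =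
      g z * ZMod.stdAddChar (α * (y - z)) := by
    intro z α
    rw [mul_assoc, ← AddChar.map_add_eq_mul]
    congr 2
    ring
  simp_rw [h1, ← Finset.mul_sum, sum_stdAddChar_mul, sub_eq_zero]
  simp
  field_simp

/-- Fourier inversion inside the k-th power, followed by orthogonality of characters, leaves only
the frequencies with sum zero. -/
lemma zeroSumMoment_fourierCoef {Q : ℕ} [NeZero Q] (g : ZMod Q → ℂ) (k : ℕ) :
    zeroSumMoment (fourierCoef g) k = 1 / (Q : ℂ) * ∑ y, g y ^ k := by
  have hQ : (Q : ℂ) ≠ 0 := by exact_mod_cast NeZero.ne Q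
  have h1 : ∀ y, g y ^ k = ∑ x : Fin k → ZMod Q, (∏ i, fourierCoef g (x i)) *
      ZMod.stdAddChar ((∑ i, x i) * y) := by
    intro y
    rw [← sum_fourierCoef_mul g y, Fintype.sum_pow]
    refine Finset.sum_congr rfl fun x _ => ?_
    rw [Finset.prod_mul_distrib, Finset.sum_mul]
    congr 1
    induction (Finset.univ : Finset (Fin k)) using Finset.induction_on with
    | empty => simp
    | insert i s hi ih => rw [Finset.prod_insert hi, Finset.sum_insert hi, AddChar.map_add_eq_mul, ih]
  simp_rw [h1]
  rw [Finset.sum_comm]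
  have h2 : ∀ x : Fin k → ZMod Q, ∑ y : ZMod Q, (∏ i, fourierCoef g (x i)) *
      (ZMod.stdAddChar ((∑ i, x i) * y) : ℂ) =
      if ∑ i, x i = 0 then (Q : ℂ) * ∏ i, fourierCoef g (x i) else 0 := by
    intro x
    rw [← Finset.mul_sum]
    simp_rw [mul_comm (∑ i, x i)]
    rw [sum_stdAddChar_mul]
    split_ifs <;> ring
  simp_rw [h2]
  rw [zeroSumMoment, Finset.sum_filter, Finset.mul_sum]
  refine Finset.sum_congr rfl fun x _ => ?_
  split_ifs
  · field_simp
  · simp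

lemma fourierCoef_unitDev {Q : ℕ} [NeZero Q] (h : ℕ) {α : ZMod Q} (hα : α ≠ 0) :
    fourierCoef (fun y => (unitDev Q h y : ℂ)) α =
      1 / (Q.totient : ℂ) * (∑ j ∈ Finset.range h, ZMod.stdAddChar (α * (j : ZMod Q))) *
        ∑ n ∈ Finset.range Q, (if Nat.Coprime n Q then
          (ZMod.stdAddChar (-α * (n : ZMod Q)) : ℂ) else 0) := by
  have hQ : (Q : ℂ) ≠ 0 := by exact_mod_cast NeZero.ne Q
  have ht : (Q.totient : ℂ) ≠ 0 := by exact_mod_cast (Nat.totient_pos.2 (NeZero.pos Q)).ne'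
  have h1 : ∑ y : ZMod Q, (ZMod.stdAddChar (-(α * y)) : ℂ) = 0 := by
    have := sum_stdAddChar_mul (-α)
    rw [if_neg (neg_ne_zero.2 hα)] at this
    rw [← this]
    refine Finset.sum_congr rfl fun y _ => ?_
    congr 1; ring
  have h2 : ∀ j : ℕ, ∑ y : ZMod Q, (if Nat.Coprime (y + j).val Q then (1 : ℂ) else 0) *
      ZMod.stdAddChar (-(α * y)) = ZMod.stdAddChar (α * (j : ZMod Q)) *
        ∑ n ∈ Finset.range Q, (if Nat.Coprime n Q then
          (ZMod.stdAddChar (-α * (n : ZMod Q)) : ℂ) else 0) := by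
    intro j
    rw [← (Equiv.subRight (j : ZMod Q)).sum_comp, ZMod.sum_eq_sum_range, Finset.mul_sum]
    refine Finset.sum_congr rfl fun n hn => ?_
    rw [Equiv.subRight_apply, sub_add_cancel, ZMod.val_cast_of_lt (Finset.mem_range.1 hn)]
    split_ifs
    · rw [one_mul, ← AddChar.map_add_eq_mul]
      congr 1; ring
    · simp
  unfold fourierCoef unitDev
  push_cast
  simp_rw [Finset.sum_mul]
  rw [Finset.sum_comm]
  simp_rw [sub_mul, Finset.sum_sub_distrib, one_mul, h1, mul_assoc, ← Finset.mul_sum]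
  have h3 : ∀ j : ℕ, ∑ y : ZMod Q, (((if Nat.Coprime (y + j).val Q then (1 : ℝ) else 0 : ℝ) : ℂ) *
      ZMod.stdAddChar (-(α * y))) = ZMod.stdAddChar (α * (j : ZMod Q)) *
        ∑ n ∈ Finset.range Q, (if Nat.Coprime n Q then
          (ZMod.stdAddChar (-α * (n : ZMod Q)) : ℂ) else 0) := by
    intro j
    rw [← h2 j]
    refine Finset.sum_congr rfl fun y _ => ?_
    split_ifs <;> simp
  simp_rw [h3, ← Finset.sum_mul]
  simp
  field_simp

lemma sum_unitDev {Q : ℕ} [NeZero Q] (h : ℕ) : ∑ y : ZMod Q, unitDev Q h y = 0 := by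
  have hQ : (Q : ℝ) ≠ 0 := by exact_mod_cast NeZero.ne Q
  have ht : (Q.totient : ℝ) ≠ 0 := by exact_mod_cast (Nat.totient_pos.2 (NeZero.pos Q)).ne'
  unfold unitDev
  rw [Finset.sum_comm]
  refine Finset.sum_eq_zero fun j _ => ?_
  rw [Finset.sum_sub_distrib, ← Finset.mul_sum]
  have : ∑ y : ZMod Q, (if Nat.Coprime (y + j).val Q then (1 : ℝ) else 0) = Q.totient := by
    rw [← (Equiv.subRight (j : ZMod Q)).sum_comp, ZMod.sum_eq_sum_range]
    simp only [Equiv.subRight_apply, sub_add_cancel]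
    rw [Nat.totient_eq_card_coprime, Finset.card_filter]
    push_cast
    refine Finset.sum_congr rfl fun n hn => ?_
    rw [ZMod.val_cast_of_lt (Finset.mem_range.1 hn)]
    simp only [Nat.coprime_comm]
  rw [this]
  simp

/-- The Ramanujan sum divided by φ(Q) has size 1/φ(r), where r is the order of α, and the interval
gives the kernel. At α = 0 the coefficient vanishes because the deviation has mean zero. -/
lemma norm_fourierCoef_unitDev_le {Q : ℕ} [NeZero Q] (hsq : Squarefree Q) {h : ℕ} (hh : 1 ≤ h)
    (α : ZMod Q) :
    ‖fourierCoef (fun y => (unitDev Q h y : ℂ)) α‖ ≤ coeffBound h α := by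
  have hh' : (0 : ℝ) < h := by exact_mod_cast hh
  unfold coeffBound
  split_ifs with h0
  · have : ∑ y : ZMod Q, (unitDev Q h y : ℂ) = 0 := by exact_mod_cast sum_unitDev (Q := Q) h
    simp [fourierCoef, h0, this]
  · rw [fourierCoef_unitDev h h0, norm_mul, norm_mul, norm_sum_units_stdAddChar hsq, addOrderOf_neg]
    obtain ⟨e, he⟩ := ZMod.addOrderOf_dvd Q α
    set r := addOrderOf α
    have hr0 : 0 < r := addOrderOf_pos α
    have hrsq := hsq.squarefree_of_dvd ⟨e, he⟩
    have hcop : Nat.Coprime r e := Nat.coprime_of_squarefree_mul (he ▸ hsq)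
    have he0 : 0 < e := Nat.pos_of_ne_zero fun h => NeZero.ne Q (by rw [he, h, mul_zero])
    have h5 : Q / r = e := by rw [he, Nat.mul_div_cancel_left _ hr0]
    have h6 : Q.totient = r.totient * e.totient := by
      conv_lhs => rw [he]
      exact Nat.totient_mul hcop
    have hte : (0 : ℝ) < e.totient := by exact_mod_cast Nat.totient_pos.2 he0
    have htr : (0 : ℝ) < r.totient := by exact_mod_cast Nat.totient_pos.2 hr0
    rw [h5, norm_div, norm_one, Complex.norm_natCast, h6]
    have hk := (kern_pos hh' α).le
    calc 1 / ((r.totient * e.totient : ℕ) : ℝ) *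
          ‖∑ j ∈ Finset.range h, (ZMod.stdAddChar (α * (j : ZMod Q)) : ℂ)‖ * e.totient
        ≤ 1 / ((r.totient * e.totient : ℕ) : ℝ) * (2 * kern h α) * e.totient := by
          gcongr
          exact norm_geom_sum_stdAddChar_le hh α
      _ = 2 * (1 / (r.totient : ℝ)) * kern h α := by push_cast; field_simp
      _ ≤ 2 * (2 ^ r.primeFactors.card / r) * kern h α := by
          gcongr ?_ * _
          exact mul_le_mul_of_nonneg_left (inv_totient_le hrsq) two_pos.le
      _ = _ := by ring

lemma zeroSumMoment_unitDev {Q : ℕ} [NeZero Q] (k h : ℕ) :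
    zeroSumMoment (fourierCoef (fun y => (unitDev Q h y : ℂ))) k = (unitMoment k Q h : ℂ) := by
  rw [zeroSumMoment_fourierCoef, unitMoment]
  push_cast
  rfl

lemma exists_abs_unitMoment_le (k : ℕ) {ε : ℝ} (hε : 0 < ε) :
    ∃ C : ℝ, 0 < C ∧ ∀ (Q h : ℕ) [NeZero Q], 1 ≤ h → Squarefree Q →
      (∀ p ∈ Q.primeFactors, p ≤ h) → |unitMoment k Q h| ≤ C * (h : ℝ) ^ ((k : ℝ) / 2 + ε) := by
  obtain ⟨C, hC, H⟩ := exists_norm_zeroSumMoment_le k hε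
  refine ⟨C, hC, fun Q h _ hh hsq hQ => ?_⟩
  have := H Q h hh hsq hQ _ (norm_fourierCoef_unitDev_le hsq hh)
  rwa [zeroSumMoment_unitDev, Complex.norm_real, Real.norm_eq_abs] at this

lemma exists_abs_unitMoment_sub_gaussMoment_le (k : ℕ) (hk : 1 ≤ k) :
    ∃ C : ℝ, 0 < C ∧ ∀ (Q h : ℕ) [NeZero Q], 1 ≤ h → Squarefree Q →
      (∀ p ∈ Q.primeFactors, p ≤ h) →
      |unitMoment k Q h - gaussMoment k * unitMoment 2 Q h ^ (k / 2)| ≤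
        C * (h : ℝ) ^ ((k : ℝ) / 2 - 1 / (7 * (k : ℝ))) := by
  obtain ⟨C, hC, H⟩ := exists_zeroSumMoment_sub_gaussMoment_le k hk
  refine ⟨C, hC, fun Q h _ hh hsq hQ => ?_⟩
  have := H Q h hh hsq hQ _ (norm_fourierCoef_unitDev_le hsq hh)
  rw [zeroSumMoment_unitDev, zeroSumMoment_unitDev] at this
  rw [← Real.norm_eq_abs, ← Complex.norm_real]
  push_cast
  exact this

/-! ### Adding one prime larger than h to the modulus -/

open scoped BigOperators

/-- The density of the residues coprime to `Q`. -/
noncomputable def unitDensity (Q : ℕ) : ℝ := (Q.totient : ℝ) / Q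

lemma unitDensity_pos {Q : ℕ} (hQ : 0 < Q) : 0 < unitDensity Q := by
  have : (0 : ℝ) < Q.totient := by exact_mod_cast Nat.totient_pos.2 hQ
  unfold unitDensity
  positivity

lemma unitDensity_le_one (Q : ℕ) : unitDensity Q ≤ 1 := by
  unfold unitDensity
  exact div_le_one_of_le₀ (by exact_mod_cast Nat.totient_le Q) (Nat.cast_nonneg _)

lemma unitDensity_mul_prime {Q p : ℕ} (hp : p.Prime) (hQp : Nat.Coprime Q p) :
    unitDensity (Q * p) = unitDensity Q * (1 - 1 / p) := by
  have hp0 : (p : ℝ) ≠ 0 := by exact_mod_cast hp.ne_zero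
  unfold unitDensity
  rw [Nat.totient_mul hQp, Nat.totient_prime hp]
  push_cast [Nat.cast_sub hp.one_le]
  field_simp

/-- The indices `j < h` such that `y + j` is a unit. -/
def unitIndices (Q h : ℕ) (y : ZMod Q) : Finset ℕ :=
  (Finset.range h).filter fun j => Nat.Coprime (y + j).val Q

lemma unitDev_eq (Q h : ℕ) (y : ZMod Q) :
    unitDev Q h y = (unitDensity Q)⁻¹ * (unitIndices Q h y).card - h := by
  unfold unitDev unitDensity unitIndices
  rw [Finset.sum_sub_distrib, ← Finset.mul_sum, Finset.card_filter]
  simp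

lemma unitIndices_card_le (Q h : ℕ) (y : ZMod Q) : (unitIndices Q h y).card ≤ h :=
  (Finset.card_filter_le _ _).trans (Finset.card_range h).le

lemma coprime_val_iff_isUnit {n : ℕ} [NeZero n] (x : ZMod n) : Nat.Coprime x.val n ↔ IsUnit x := by
  rw [← ZMod.isUnit_iff_coprime, ZMod.natCast_zmod_val]

lemma unitMoment_eq_expect (k Q h : ℕ) [NeZero Q] :
    unitMoment k Q h = 𝔼 y, unitDev Q h y ^ k := by
  rw [Fintype.expect_eq_sum_div_card, ZMod.card, unitMoment]
  ring

/-- Separating one prime larger than `h` from the modulus. -/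
lemma unitMoment_mul_prime {Q p h : ℕ} [NeZero Q] [NeZero (Q * p)] (hp : p.Prime)
    (hQp : Nat.Coprime Q p) (hh : h ≤ p) (k : ℕ) :
    unitMoment k (Q * p) h = 𝔼 y : ZMod Q,
      ((1 - (unitIndices Q h y).card / (p : ℝ)) *
        ((unitDensity (Q * p))⁻¹ * (unitIndices Q h y).card - h) ^ k +
      (unitIndices Q h y).card / (p : ℝ) *
        ((unitDensity (Q * p))⁻¹ * ((unitIndices Q h y).card - 1) - h) ^ k) := by
  haveI : Fact p.Prime := ⟨hp⟩
  have hp0 : (p : ℝ) ≠ 0 := by exact_mod_cast hp.ne_zero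
  have hQ0 : (Q : ℝ) ≠ 0 := by exact_mod_cast NeZero.ne Q
  set e := ZMod.chineseRemainder hQp
  -- The residues z modulo p at which one of the units modulo Q is lost. Since h ≤ p the values -j
  -- are distinct, so exactly one index is lost for z in this set and none otherwise.
  set T : ZMod Q → Finset (ZMod p) := fun y => (unitIndices Q h y).image fun j : ℕ => -(j : ZMod p)
  have hT : ∀ y, (T y).card = (unitIndices Q h y).card := fun y => by
    refine Finset.card_image_of_injOn fun i hi j hj hij => ?_
    simp only [unitIndices, Finset.coe_filter, Finset.mem_range, Set.mem_ofPred_eq] at hi hj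
    have h1 := neg_injective hij
    rw [ZMod.natCast_eq_natCast_iff'] at h1
    rwa [Nat.mod_eq_of_lt (by omega), Nat.mod_eq_of_lt (by omega)] at h1
  have hdev : ∀ y z, unitDev (Q * p) h (e.symm (y, z)) =
      if z ∈ T y then (unitDensity (Q * p))⁻¹ * ((unitIndices Q h y).card - 1) - h
      else (unitDensity (Q * p))⁻¹ * (unitIndices Q h y).card - h := by
    intro y z
    have h1 : unitIndices (Q * p) h (e.symm (y, z)) =
        (unitIndices Q h y).filter fun j : ℕ => z ≠ -(j : ZMod p) := by
      ext j
      simp only [unitIndices, Finset.mem_filter, and_assoc]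
      refine and_congr_right fun _ => ?_
      rw [coprime_val_iff_isUnit, coprime_val_iff_isUnit, ← MulEquiv.isUnit_map e, map_add,
        RingEquiv.apply_symm_apply, map_natCast, Prod.isUnit_iff]
      refine and_congr Iff.rfl ?_
      simp only [Prod.snd_add, Prod.snd_natCast, isUnit_iff_ne_zero, ne_eq]
      rw [add_eq_zero_iff_eq_neg]
    rw [unitDev_eq, h1]
    split_ifs with hz
    · obtain ⟨j₀, hj₀, hj₀z⟩ := Finset.mem_image.1 hz
      have h2 : (unitIndices Q h y).filter (fun j : ℕ => z ≠ -(j : ZMod p)) =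
          (unitIndices Q h y).erase j₀ := by
        ext j
        simp only [Finset.mem_filter, Finset.mem_erase, and_comm (a := j ≠ j₀)]
        refine and_congr_right fun hj => not_congr ?_
        constructor
        · intro hzj
          have h1 := neg_injective (hj₀z.trans hzj)
          simp only [unitIndices, Finset.mem_filter, Finset.mem_range] at hj hj₀
          rw [ZMod.natCast_eq_natCast_iff'] at h1
          rw [Nat.mod_eq_of_lt (by omega), Nat.mod_eq_of_lt (by omega)] at h1
          exact h1.symm
        · rintro rfl
          exact hj₀z.symm
      rw [h2, Finset.card_erase_of_mem hj₀, Nat.cast_sub (Finset.card_pos.2 ⟨j₀, hj₀⟩)]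
      push_cast
      rfl
    · rw [Finset.filter_true_of_mem]
      intro j hj hzj
      exact hz (Finset.mem_image.2 ⟨j, hj, hzj.symm⟩)
  rw [unitMoment, ← e.symm.toEquiv.sum_comp, Fintype.sum_prod_type,
    Fintype.expect_eq_sum_div_card, ZMod.card]
  push_cast
  rw [show 1 / ((Q : ℝ) * p) = 1 / p / Q by field_simp, div_mul_eq_mul_div]
  congr 1
  rw [Finset.mul_sum]
  refine Finset.sum_congr rfl fun y _ => ?_
  have h3 : ∀ z, unitDev (Q * p) h (e.symm.toEquiv (y, z)) ^ k =
      if z ∈ T y then ((unitDensity (Q * p))⁻¹ * ((unitIndices Q h y).card - 1) - h) ^ k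
      else ((unitDensity (Q * p))⁻¹ * (unitIndices Q h y).card - h) ^ k := by
    intro z
    have := hdev y z
    simp only [RingEquiv.toEquiv_eq_coe, EquivLike.coe_coe] at this ⊢
    rw [this]
    split_ifs <;> rfl
  simp_rw [h3]
  rw [Finset.sum_ite, Finset.sum_const, Finset.sum_const, Finset.filter_mem_eq_inter,
    Finset.univ_inter, Finset.filter_not, Finset.filter_mem_eq_inter, Finset.univ_inter,
    Finset.card_sdiff_of_subset (Finset.subset_univ _), Finset.card_univ, ZMod.card, hT,
    nsmul_eq_mul, nsmul_eq_mul, Nat.cast_sub ((unitIndices_card_le Q h y).trans hh)]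
  field_simp
  ring

/-- The moments of a centred two-point variable added to `X`. -/
lemma two_point_moment {s R X : ℝ} (hs0 : 0 ≤ s) (hs1 : s ≤ 1) (hR : 0 ≤ R) (m : ℕ) :
    |(1 - s) * (X + s * R) ^ (m + 2) + s * (X - (1 - s) * R) ^ (m + 2) - X ^ (m + 2) -
      ((m + 2).choose 2 : ℝ) * (X ^ m * (R ^ 2 * (s * (1 - s))))| ≤
      ∑ b ∈ Finset.range m, ((m + 2).choose (b + 3) : ℝ) *
        (s * (|X| ^ (m - 1 - b) * R ^ (b + 3))) := by
  have h1 : (1 - s) * (X + s * R) ^ (m + 2) + s * (X - (1 - s) * R) ^ (m + 2) =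
      ∑ b ∈ Finset.range (m + 3), ((m + 2).choose b : ℝ) *
        (((1 - s) * s ^ b + s * (-(1 - s)) ^ b) * (X ^ (m + 2 - b) * R ^ b)) := by
    rw [add_comm X, sub_eq_add_neg X, add_comm X, add_pow, add_pow, Finset.mul_sum, Finset.mul_sum,
      ← Finset.sum_add_distrib]
    refine Finset.sum_congr rfl fun b _ => ?_
    rw [mul_pow, ← neg_mul, mul_pow]
    ring
  -- The terms b = 0, 1, 2 are split off: the power of X, zero by centring, and the variance term.
  rw [h1, Finset.sum_range_succ', Finset.sum_range_succ', Finset.sum_range_succ']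
  have h2 : ∀ S : ℝ, S + ((m + 2).choose (0 + 1 + 1) : ℝ) *
      (((1 - s) * s ^ (0 + 1 + 1) + s * (-(1 - s)) ^ (0 + 1 + 1)) *
        (X ^ (m + 2 - (0 + 1 + 1)) * R ^ (0 + 1 + 1))) +
      ((m + 2).choose (0 + 1) : ℝ) * (((1 - s) * s ^ (0 + 1) + s * (-(1 - s)) ^ (0 + 1)) *
        (X ^ (m + 2 - (0 + 1)) * R ^ (0 + 1))) +
      ((m + 2).choose 0 : ℝ) * (((1 - s) * s ^ 0 + s * (-(1 - s)) ^ 0) *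
        (X ^ (m + 2 - 0) * R ^ 0)) - X ^ (m + 2) -
      ((m + 2).choose 2 : ℝ) * (X ^ m * (R ^ 2 * (s * (1 - s)))) = S := by
    intro S
    simp only [zero_add, Nat.reduceAdd, Nat.add_sub_cancel, Nat.choose_zero_right, Nat.sub_zero]
    push_cast
    ring
  rw [h2]
  refine (Finset.abs_sum_le_sum_abs _ _).trans (Finset.sum_le_sum fun b hb => ?_)
  rw [abs_mul, abs_of_nonneg (Nat.cast_nonneg _ : (0 : ℝ) ≤ _)]
  refine mul_le_mul_of_nonneg_left ?_ (Nat.cast_nonneg _)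
  rw [abs_mul, abs_mul, abs_pow X, abs_of_nonneg (pow_nonneg hR _),
    show m + 2 - (b + 1 + 1 + 1) = m - 1 - b by omega]
  refine mul_le_mul_of_nonneg_right ?_ (by positivity)
  have hs2 : 0 ≤ 1 - s := by linarith
  have e1 : s ^ (b + 1 + 1 + 1) ≤ s ^ 2 := pow_le_pow_of_le_one hs0 hs1 (by omega)
  have e2 : (1 - s) ^ (b + 1 + 1 + 1) ≤ (1 - s) ^ 1 :=
    pow_le_pow_of_le_one hs2 (by linarith) (by omega)
  calc |(1 - s) * s ^ (b + 1 + 1 + 1) + s * (-(1 - s)) ^ (b + 1 + 1 + 1)|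
      ≤ |(1 - s) * s ^ (b + 1 + 1 + 1)| + |s * (-(1 - s)) ^ (b + 1 + 1 + 1)| := abs_add_le _ _
    _ = (1 - s) * s ^ (b + 1 + 1 + 1) + s * (1 - s) ^ (b + 1 + 1 + 1) := by
        rw [abs_mul, abs_mul, abs_pow, abs_pow, abs_neg, abs_of_nonneg hs0, abs_of_nonneg hs2]
    _ ≤ (1 - s) * s ^ 2 + s * (1 - s) ^ 1 := by gcongr
    _ ≤ s := by nlinarith [mul_nonneg hs0 (mul_nonneg hs0 hs0), mul_nonneg hs0 hs2]

/-- First-order Taylor expansion of the power, by induction on the exponent; it follows the growth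
of V₂^(k/2) when the variance increases by w. -/
lemma abs_add_pow_sub_sub_le {x w U δ : ℝ} (hx : 0 ≤ x) (hw : 0 ≤ w) (hU : x + w ≤ U)
    (hδ : w ≤ δ * U) (n : ℕ) :
    |(x + w) ^ (n + 1) - x ^ (n + 1) - (n + 1) * (w * x ^ n)| ≤
      ((n : ℝ) + 1) ^ 2 * (δ ^ 2 * U ^ (n + 1)) := by
  have hU0 : 0 ≤ U := (add_nonneg hx hw).trans hU
  have hw2 : w ^ 2 ≤ δ ^ 2 * U ^ 2 := by
    rw [← mul_pow]
    exact pow_le_pow_left₀ hw hδ 2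
  induction n with
  | zero =>
    have : (x + w) ^ (0 + 1) - x ^ (0 + 1) - ((0 : ℕ) + 1) * (w * x ^ 0) = 0 := by
      push_cast; ring
    rw [this, abs_zero]
    positivity
  | succ n ih =>
    have e : (x + w) ^ (n + 1 + 1) - x ^ (n + 1 + 1) - ((n + 1 : ℕ) + 1) * (w * x ^ (n + 1)) =
        (x + w) * ((x + w) ^ (n + 1) - x ^ (n + 1) - (n + 1) * (w * x ^ n)) +
          (n + 1) * (w ^ 2 * x ^ n) := by
      push_cast; ring
    rw [e]
    have hxU : x ≤ U := by linarith
    calc _ ≤ |(x + w) * ((x + w) ^ (n + 1) - x ^ (n + 1) - (n + 1) * (w * x ^ n))| +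
          |((n : ℝ) + 1) * (w ^ 2 * x ^ n)| := abs_add_le _ _
      _ = (x + w) * |(x + w) ^ (n + 1) - x ^ (n + 1) - (n + 1) * (w * x ^ n)| +
          ((n : ℝ) + 1) * (w ^ 2 * x ^ n) := by
        rw [abs_mul, abs_of_nonneg (add_nonneg hx hw)]
        congr 1
        exact abs_of_nonneg (by positivity)
      _ ≤ U * (((n : ℝ) + 1) ^ 2 * (δ ^ 2 * U ^ (n + 1))) +
          ((n : ℝ) + 1) * ((δ ^ 2 * U ^ 2) * U ^ n) := by gcongr
      _ = (((n : ℝ) + 1) ^ 2 + (n + 1)) * (δ ^ 2 * U ^ (n + 1 + 1)) := by ring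
      _ ≤ _ := by
        gcongr
        push_cast
        nlinarith [(Nat.cast_nonneg n : (0 : ℝ) ≤ n)]

/-- The reason the Gaussian shape persists: the coefficient in the growth of the moment of order m +
2 equals that in the growth of μ V^(m/2+1). For odd m both sides vanish. -/
lemma choose_two_mul_gaussMoment (m : ℕ) :
    ((m + 2).choose 2 : ℝ) * gaussMoment m = ((m / 2 : ℕ) + 1) * gaussMoment (m + 2) := by
  rw [gaussMoment_add_two]
  by_cases hm : Even m
  · obtain ⟨j, rfl⟩ := hm
    rw [Nat.cast_choose_two, show (j + j) / 2 = j by omega]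
    push_cast
    ring
  · simp [gaussMoment, hm]

section Step

variable {Q p h : ℕ} [NeZero Q]

/-- The variance of the contribution of one prime, as a function of the residue. -/
noncomputable def primeVar (Q p h : ℕ) (y : ZMod Q) : ℝ :=
  (unitDensity (Q * p))⁻¹ ^ 2 * ((unitIndices Q h y).card / (p : ℝ) *
    (1 - (unitIndices Q h y).card / (p : ℝ)))

lemma unitDev_add_eq (hp : p.Prime) (hQp : Nat.Coprime Q p) (y : ZMod Q) :
    (unitDensity (Q * p))⁻¹ * (unitIndices Q h y).card - h =
      unitDev Q h y + (unitIndices Q h y).card / (p : ℝ) * (unitDensity (Q * p))⁻¹ := by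
  have hp1 : (1 : ℝ) < p := by exact_mod_cast hp.one_lt
  have hP := (unitDensity_pos (NeZero.pos Q)).ne'
  have hp2 : (p : ℝ) - 1 ≠ 0 := by linarith
  rw [unitDev_eq, unitDensity_mul_prime hp hQp]
  have : (1 : ℝ) - 1 / p ≠ 0 := by
    have : (1 : ℝ) / p < 1 := by rw [div_lt_one (by linarith)]; exact hp1
    linarith
  field_simp
  ring

lemma card_div_mem (hh : h ≤ p) (hp : p.Prime) (y : ZMod Q) :
    0 ≤ (unitIndices Q h y).card / (p : ℝ) ∧ (unitIndices Q h y).card / (p : ℝ) ≤ h / p ∧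
      (unitIndices Q h y).card / (p : ℝ) ≤ 1 := by
  have hp0 : (0 : ℝ) < p := by exact_mod_cast hp.pos
  have h1 : ((unitIndices Q h y).card : ℝ) ≤ h := by exact_mod_cast unitIndices_card_le Q h y
  have h2 : (h : ℝ) ≤ p := by exact_mod_cast hh
  refine ⟨by positivity, by gcongr, ?_⟩
  rw [div_le_one hp0]
  linarith

/-- The normalization of `unitDev`. -/
noncomputable def unitScale (Q h : ℕ) : ℝ := √h / unitDensity Q

lemma unitScale_nonneg (Q h : ℕ) : 0 ≤ unitScale Q h := by
  unfold unitScale unitDensity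
  positivity

/-- The scale grows by 1/(1 - 1/p) with each prime, which leaves room for an error of relative size
O(1/p) at every step of the induction on primes. -/
lemma unitScale_mul_prime (hp : p.Prime) (hQp : Nat.Coprime Q p) :
    unitScale Q h = unitScale (Q * p) h * (1 - 1 / p) := by
  have hp1 : (1 : ℝ) < p := by exact_mod_cast hp.one_lt
  have hP := (unitDensity_pos (NeZero.pos Q)).ne'
  have hp2 : (p : ℝ) - 1 ≠ 0 := by linarith
  unfold unitScale
  rw [unitDensity_mul_prime hp hQp]
  field_simp

lemma inv_unitDensity_mul_prime (hp : p.Prime) (hQp : Nat.Coprime Q p) :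
    (unitDensity Q)⁻¹ = (unitDensity (Q * p))⁻¹ * (1 - 1 / p) := by
  have hp1 : (1 : ℝ) < p := by exact_mod_cast hp.one_lt
  have hP := (unitDensity_pos (NeZero.pos Q)).ne'
  have hp2 : (p : ℝ) - 1 ≠ 0 := by linarith
  rw [unitDensity_mul_prime hp hQp]
  field_simp

lemma unitScale_eq (Q h : ℕ) : unitScale Q h = √h * (unitDensity Q)⁻¹ := by
  unfold unitScale; rw [div_eq_mul_inv]

lemma primeVar_mem (hh : h ≤ p) (hp : p.Prime) (y : ZMod Q) :
    0 ≤ primeVar Q p h y ∧ primeVar Q p h y ≤ unitScale (Q * p) h ^ 2 / p := by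
  obtain ⟨h1, h2, h3⟩ := card_div_mem hh hp y
  have hs : √(h : ℝ) ^ 2 = h := Real.sq_sqrt (Nat.cast_nonneg h)
  unfold primeVar
  rw [unitScale_eq, mul_pow, hs]
  set s := ((unitIndices Q h y).card : ℝ) / p
  constructor
  · exact mul_nonneg (by positivity) (mul_nonneg h1 (by linarith))
  · calc (unitDensity (Q * p))⁻¹ ^ 2 * (s * (1 - s)) ≤ (unitDensity (Q * p))⁻¹ ^ 2 * (h / p * 1) := by
          gcongr
          linarith
      _ = _ := by ring

/-- The moments after adding a prime, up to an error controlled by lower moments. -/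
lemma abs_unitMoment_mul_prime_sub_le [NeZero (Q * p)] (hp : p.Prime) (hQp : Nat.Coprime Q p)
    (hh : h ≤ p) (h1 : 1 ≤ h) (m : ℕ) {M : ℝ} (hM0 : 0 ≤ M)
    (hM : ∀ i < m, 𝔼 y, |unitDev Q h y| ^ i ≤ M * unitScale (Q * p) h ^ i) :
    |unitMoment (m + 2) (Q * p) h - unitMoment (m + 2) Q h -
      ((m + 2).choose 2 : ℝ) * 𝔼 y, unitDev Q h y ^ m * primeVar Q p h y| ≤
      2 ^ (m + 2) * (M * unitScale (Q * p) h ^ (m + 2)) / (p * √h) := by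
  have hh1 : (1 : ℝ) ≤ h := by exact_mod_cast h1
  have hs1 : 1 ≤ √(h : ℝ) := Real.one_le_sqrt.2 hh1
  have hp0 : (0 : ℝ) < p := by exact_mod_cast hp.pos
  have hR0 : 0 ≤ (unitDensity (Q * p))⁻¹ := by
    have := unitDensity_pos (NeZero.pos (Q * p))
    positivity
  set R := (unitDensity (Q * p))⁻¹ with hR
  set a := unitScale (Q * p) h with ha
  have haR : a = √h * R := unitScale_eq _ _
  have ha0 : 0 ≤ a := unitScale_nonneg _ _
  rw [unitMoment_mul_prime hp hQp hh, unitMoment_eq_expect, ← Finset.expect_sub_distrib,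
    Finset.mul_expect, ← Finset.expect_sub_distrib]
  refine (Finset.abs_expect_le _ _).trans ?_
  have hpt : ∀ y : ZMod Q, |((1 - (unitIndices Q h y).card / (p : ℝ)) *
        (R * (unitIndices Q h y).card - h) ^ (m + 2) +
      (unitIndices Q h y).card / (p : ℝ) *
        (R * ((unitIndices Q h y).card - 1) - h) ^ (m + 2)) - unitDev Q h y ^ (m + 2) -
      ((m + 2).choose 2 : ℝ) * (unitDev Q h y ^ m * primeVar Q p h y)| ≤
      ∑ b ∈ Finset.range m, ((m + 2).choose (b + 3) : ℝ) *
        (h / p * R ^ (b + 3) * |unitDev Q h y| ^ (m - 1 - b)) := by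
    intro y
    obtain ⟨k1, k2, k3⟩ := card_div_mem hh hp y
    have e1 := unitDev_add_eq (h := h) hp hQp y
    have e2 : R * ((unitIndices Q h y).card - 1) - h =
        unitDev Q h y - (1 - (unitIndices Q h y).card / (p : ℝ)) * R := by
      linear_combination e1
    rw [e1, e2]
    refine (two_point_moment k1 k3 hR0 m).trans (Finset.sum_le_sum fun b _ => ?_)
    refine mul_le_mul_of_nonneg_left ?_ (Nat.cast_nonneg _)
    calc _ ≤ h / p * (|unitDev Q h y| ^ (m - 1 - b) * R ^ (b + 3)) :=
          mul_le_mul_of_nonneg_right k2 (by positivity)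
      _ = _ := by ring
  refine (Finset.expect_le_expect fun y _ => hpt y).trans ?_
  rw [Finset.expect_sum_comm]
  simp_rw [← Finset.mul_expect]
  have hterm : ∀ b ∈ Finset.range m, ((m + 2).choose (b + 3) : ℝ) *
      (h / p * R ^ (b + 3) * 𝔼 y, |unitDev Q h y| ^ (m - 1 - b)) ≤
      ((m + 2).choose (b + 3) : ℝ) * (M * a ^ (m + 2) / (p * √h)) := by
    intro b hb
    rw [Finset.mem_range] at hb
    refine mul_le_mul_of_nonneg_left ?_ (Nat.cast_nonneg _)
    -- Terms of order at least three in R gain √h, because a = √h R and h √h = √h³.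
    have hb1 : h * R ^ (b + 3) ≤ a ^ (b + 3) / √h := by
      rw [le_div_iff₀ (by linarith), haR, mul_pow]
      have h3 : (h : ℝ) * √h = √h ^ 3 := by
        rw [pow_succ, Real.sq_sqrt (by linarith)]
      calc (h : ℝ) * R ^ (b + 3) * √h = √h ^ 3 * R ^ (b + 3) := by rw [← h3]; ring
        _ ≤ √h ^ (b + 3) * R ^ (b + 3) := by
          gcongr
          omega
    calc h / p * R ^ (b + 3) * 𝔼 y, |unitDev Q h y| ^ (m - 1 - b)
        ≤ h / p * R ^ (b + 3) * (M * a ^ (m - 1 - b)) := by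
          gcongr
          exact hM _ (by omega)
      _ = h * R ^ (b + 3) * (M * a ^ (m - 1 - b)) / p := by ring
      _ ≤ a ^ (b + 3) / √h * (M * a ^ (m - 1 - b)) / p := by gcongr
      _ = M * (a ^ (b + 3) * a ^ (m - 1 - b)) / (p * √h) := by
          field_simp
      _ = _ := by rw [← pow_add, show b + 3 + (m - 1 - b) = m + 2 by omega]
  refine (Finset.sum_le_sum hterm).trans ?_
  rw [← Finset.sum_mul, mul_div_assoc ((2 : ℝ) ^ (m + 2))]
  refine mul_le_mul_of_nonneg_right ?_ (div_nonneg (mul_nonneg hM0 (pow_nonneg ha0 _))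
    (by positivity))
  have hsum : ∑ b ∈ Finset.range m, (m + 2).choose (b + 3) ≤ 2 ^ (m + 2) := by
    rw [← Nat.sum_range_choose (m + 2), Finset.sum_range_succ', Finset.sum_range_succ',
      Finset.sum_range_succ']
    simp only [add_assoc, Nat.reduceAdd]
    omega
  exact_mod_cast hsum

/-- The value of `primeVar` at a point where `unitDev` vanishes. -/
noncomputable def meanVar (Q p h : ℕ) : ℝ :=
  (unitDensity (Q * p))⁻¹ ^ 2 * (unitDensity Q * h / p * (1 - unitDensity Q * h / p))

lemma meanVar_mem (hh : h ≤ p) (hp : p.Prime) :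
    0 ≤ meanVar Q p h ∧ meanVar Q p h ≤ unitScale (Q * p) h ^ 2 / p := by
  have hp0 : (0 : ℝ) < p := by exact_mod_cast hp.pos
  have hP := unitDensity_pos (NeZero.pos Q)
  have hP1 := unitDensity_le_one Q
  have hhp : (h : ℝ) ≤ p := by exact_mod_cast hh
  have hh0 : (0 : ℝ) ≤ h := Nat.cast_nonneg h
  have hs : √(h : ℝ) ^ 2 = h := Real.sq_sqrt hh0
  have h1 : 0 ≤ unitDensity Q * h / p := by positivity
  have h2 : unitDensity Q * h / p ≤ h / p := by
    gcongr
    nlinarith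
  have h3 : (h : ℝ) / p ≤ 1 := by rw [div_le_one hp0]; exact hhp
  unfold meanVar
  rw [unitScale_eq, mul_pow, hs]
  set s := unitDensity Q * h / p
  constructor
  · exact mul_nonneg (by positivity) (mul_nonneg h1 (by linarith))
  · calc (unitDensity (Q * p))⁻¹ ^ 2 * (s * (1 - s)) ≤ (unitDensity (Q * p))⁻¹ ^ 2 * (h / p * 1) := by
          gcongr
          · linarith
          · linarith
      _ = _ := by ring

/-- The map s ↦ s(1 - s) is 1-Lipschitz on [0, 1], and s - s₀ is the deviation times density over p.
The density for Q times the inverse density for Qp is 1/(1 - 1/p) ≤ 2. -/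
lemma abs_primeVar_sub_meanVar_le (hp : p.Prime) (hQp : Nat.Coprime Q p) (hh : h ≤ p) (h1 : 1 ≤ h)
    (y : ZMod Q) :
    |primeVar Q p h y - meanVar Q p h| ≤
      2 * unitScale (Q * p) h / (p * √h) * |unitDev Q h y| := by
  have hp0 : (0 : ℝ) < p := by exact_mod_cast hp.pos
  have hp2 : (2 : ℝ) ≤ p := by exact_mod_cast hp.two_le
  have hP := unitDensity_pos (NeZero.pos Q)
  have hP1 := unitDensity_le_one Q
  have hhp : (h : ℝ) ≤ p := by exact_mod_cast hh
  have hh1 : (1 : ℝ) ≤ h := by exact_mod_cast h1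
  have hs1 : 1 ≤ √(h : ℝ) := Real.one_le_sqrt.2 hh1
  obtain ⟨k1, k2, k3⟩ := card_div_mem hh hp y
  have hdiff : ((unitIndices Q h y).card : ℝ) / p - unitDensity Q * h / p =
      unitDensity Q * unitDev Q h y / p := by
    rw [unitDev_eq]
    field_simp
  have k4 : 0 ≤ unitDensity Q * h / p := by positivity
  have k5 : unitDensity Q * h / p ≤ 1 := by
    rw [div_le_one hp0]
    nlinarith
  have hinv := inv_unitDensity_mul_prime hp hQp
  have hR0 : 0 ≤ (unitDensity (Q * p))⁻¹ :=
    inv_nonneg.2 (by unfold unitDensity; positivity)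
  unfold primeVar meanVar
  rw [unitScale_eq]
  set R := (unitDensity (Q * p))⁻¹
  set s := ((unitIndices Q h y).card : ℝ) / p
  set s₀ := unitDensity Q * h / p
  have hRP : R * unitDensity Q ≤ 2 := by
    have e1 : R * (1 - 1 / p) * unitDensity Q = 1 := by rw [← hinv, inv_mul_cancel₀ hP.ne']
    have e2 : (1 : ℝ) / 2 ≤ 1 - 1 / p := by
      have : (1 : ℝ) / p ≤ 1 / 2 := by gcongr
      linarith
    nlinarith [mul_nonneg hR0 hP.le]
  calc |R ^ 2 * (s * (1 - s)) - R ^ 2 * (s₀ * (1 - s₀))|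
      = R ^ 2 * (|s - s₀| * |1 - s - s₀|) := by
        rw [← abs_mul, ← abs_of_nonneg (sq_nonneg R), ← abs_mul, abs_of_nonneg (sq_nonneg R)]
        congr 1
        ring
    _ ≤ R ^ 2 * (|s - s₀| * 1) := by
        gcongr
        rw [abs_le]
        constructor <;> linarith
    _ = R * (R * unitDensity Q) * |unitDev Q h y| / p := by
        rw [hdiff, abs_div, abs_mul, abs_of_pos hP, abs_of_pos hp0]
        ring
    _ ≤ R * 2 * |unitDev Q h y| / p := by gcongr
    _ = _ := by field_simp

end Step

/-! ### Moments for all squarefree moduli -/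

/-- Induction on squarefree numbers, adding the primes larger than `h` one at a time. -/
lemma Squarefree.induction_large_primes {h : ℕ} {motive : ℕ → Prop}
    (base : ∀ Q, Squarefree Q → (∀ p ∈ Q.primeFactors, p ≤ h) → motive Q)
    (step : ∀ Q p : ℕ, p.Prime → Nat.Coprime Q p → h < p → Squarefree Q → motive Q →
      motive (Q * p)) (Q : ℕ) (hQ : Squarefree Q) : motive Q := by
  induction Q using Nat.strong_induction_on with
  | _ Q ih =>
  by_cases hbase : ∀ p ∈ Q.primeFactors, p ≤ h
  · exact base Q hQ hbase
  · push Not at hbase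
    obtain ⟨p, hp, hhp⟩ := hbase
    have hpp := Nat.prime_of_mem_primeFactors hp
    obtain ⟨Q₁, rfl⟩ := Nat.dvd_of_mem_primeFactors hp
    rw [mul_comm] at hQ ⊢
    have hQ₁ : Squarefree Q₁ := hQ.squarefree_of_dvd (dvd_mul_right _ _)
    have hQ₁0 : 0 < Q₁ := Nat.pos_of_ne_zero hQ₁.ne_zero
    refine step Q₁ p hpp (Nat.coprime_of_squarefree_mul hQ) hhp hQ₁ (ih Q₁ ?_ hQ₁)
    nlinarith [hpp.two_le]

lemma unitScale_pow_le {Q p h : ℕ} [NeZero Q] (hp : p.Prime) (hQp : Nat.Coprime Q p) (i : ℕ) :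
    unitScale Q h ^ i ≤ unitScale (Q * p) h ^ i := by
  refine pow_le_pow_left₀ (unitScale_nonneg _ _) ?_ i
  rw [unitScale_mul_prime hp hQp]
  have : (0 : ℝ) ≤ 1 / p := by positivity
  exact mul_le_of_le_one_right (unitScale_nonneg _ _) (by linarith)

lemma one_sub_inv_mem {p : ℕ} (hp : p.Prime) : (0 : ℝ) ≤ 1 - 1 / p ∧ (1 : ℝ) - 1 / p ≤ 1 := by
  have hp1 : (1 : ℝ) ≤ p := by exact_mod_cast hp.one_le
  have h1 : (1 : ℝ) / p ≤ 1 := by rw [div_le_one (by linarith)]; exact hp1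
  have h2 : (0 : ℝ) ≤ 1 / p := by positivity
  constructor <;> linarith

lemma sqrt_le_unitScale {Q : ℕ} (hQ : 0 < Q) (h : ℕ) : √(h : ℝ) ≤ unitScale Q h := by
  unfold unitScale
  rw [le_div_iff₀ (unitDensity_pos hQ)]
  exact mul_le_of_le_one_right (Real.sqrt_nonneg _) (unitDensity_le_one Q)

lemma rpow_half_mul {h : ℝ} (hh : 0 ≤ h) (k : ℕ) : h ^ ((k : ℝ) / 2) = √h ^ k := by
  rw [Real.sqrt_eq_rpow, ← Real.rpow_mul_natCast hh]
  congr 1; ring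

/-- The even moments of `unitDev`, given the smaller moments. -/
lemma expect_abs_unitDev_even_le {ε : ℝ} (hε : 0 < ε) (j : ℕ) {B : ℝ} (hB0 : 0 < B)
    (hB : ∀ (Q h : ℕ) [NeZero Q], 1 ≤ h → Squarefree Q → ∀ i ≤ 2 * j,
      𝔼 y, |unitDev Q h y| ^ i ≤ B * (h : ℝ) ^ ε * unitScale Q h ^ i) :
    ∃ B' : ℝ, B ≤ B' ∧ ∀ (Q h : ℕ) [NeZero Q], 1 ≤ h → Squarefree Q →
      unitMoment (2 * j + 2) Q h ≤ B' * (h : ℝ) ^ ε * unitScale Q h ^ (2 * j + 2) := by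
  obtain ⟨C, hC, hbase⟩ := exists_abs_unitMoment_le (2 * j + 2) hε
  have h2k : (1 : ℝ) ≤ 2 ^ (2 * j + 2) := one_le_pow₀ one_le_two
  -- C serves the moduli with primes at most h. The second summand is the numerator of the error
  -- that each further prime adds over p, so it is exactly absorbed by the factor 1 - 1/p in the
  -- scale.
  refine ⟨C + 2 * 2 ^ (2 * j + 2) * B, by nlinarith, fun Q h _ hh hQ => ?_⟩
  have hh' : (1 : ℝ) ≤ h := by exact_mod_cast hh
  have hW : 0 ≤ (h : ℝ) ^ ε := by positivity
  suffices H : ∀ [NeZero Q], unitMoment (2 * j + 2) Q h ≤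
      (C + 2 * 2 ^ (2 * j + 2) * B) * (h : ℝ) ^ ε * unitScale Q h ^ (2 * j + 2) from H
  refine Squarefree.induction_large_primes (h := h) (motive := fun Q => ∀ [NeZero Q],
    unitMoment (2 * j + 2) Q h ≤
      (C + 2 * 2 ^ (2 * j + 2) * B) * (h : ℝ) ^ ε * unitScale Q h ^ (2 * j + 2)) ?_ ?_ Q hQ
  · intro Q hQ hQh _
    refine (le_abs_self _).trans ((hbase Q h hh hQ hQh).trans ?_)
    rw [add_comm _ ε, Real.rpow_add (by linarith), rpow_half_mul (by linarith), ← mul_assoc]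
    gcongr
    · nlinarith
    · exact sqrt_le_unitScale (NeZero.pos Q) h
  · intro Q p hp hQp hhp hQ ih _
    have : NeZero Q := ⟨hQ.ne_zero⟩
    have hp0 : (0 : ℝ) < p := by exact_mod_cast hp.pos
    set a := unitScale (Q * p) h with ha
    have ha0 : 0 ≤ a := unitScale_nonneg _ _
    set M := B * (h : ℝ) ^ ε with hMdef
    have hM0 : 0 ≤ M := by positivity
    have hM : ∀ i ≤ 2 * j, 𝔼 y, |unitDev Q h y| ^ i ≤ M * a ^ i := fun i hi =>
      (hB Q h hh hQ i hi).trans (mul_le_mul_of_nonneg_left (unitScale_pow_le hp hQp i) hM0)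
    have h1 := (abs_le.1 (abs_unitMoment_mul_prime_sub_le hp hQp hhp.le hh (2 * j) hM0
      fun i hi => hM i hi.le)).2
    have h2 : 𝔼 y, unitDev Q h y ^ (2 * j) * primeVar Q p h y ≤ a ^ 2 / p * (M * a ^ (2 * j)) := by
      calc _ ≤ 𝔼 y, a ^ 2 / p * |unitDev Q h y| ^ (2 * j) := by
            refine Finset.expect_le_expect fun y _ => ?_
            obtain ⟨v1, v2⟩ := primeVar_mem hhp.le hp y
            rw [← abs_pow, abs_of_nonneg ((even_two_mul j).pow_nonneg _), mul_comm]
            exact mul_le_mul_of_nonneg_right v2 ((even_two_mul j).pow_nonneg _)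
        _ ≤ _ := by
            rw [← Finset.mul_expect]
            exact mul_le_mul_of_nonneg_left (hM _ le_rfl) (by positivity)
    have h3 : ((2 * j + 2).choose 2 : ℝ) ≤ 2 ^ (2 * j + 2) := by
      exact_mod_cast Nat.choose_le_two_pow _ _
    have h4 : 2 ^ (2 * j + 2) * (M * a ^ (2 * j + 2)) / (p * √h) ≤
        2 ^ (2 * j + 2) * (M * a ^ (2 * j + 2)) / p := by
      gcongr
      exact le_mul_of_one_le_right hp0.le (Real.one_le_sqrt.2 hh')
    have h5 : ((2 * j + 2).choose 2 : ℝ) * 𝔼 y, unitDev Q h y ^ (2 * j) * primeVar Q p h y ≤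
        2 ^ (2 * j + 2) * (M * a ^ (2 * j + 2)) / p := by
      calc _ ≤ ((2 * j + 2).choose 2 : ℝ) * (a ^ 2 / p * (M * a ^ (2 * j))) := by gcongr
        _ ≤ 2 ^ (2 * j + 2) * (a ^ 2 / p * (M * a ^ (2 * j))) := by gcongr
        _ = _ := by ring
    obtain ⟨q1, q2⟩ := one_sub_inv_mem hp
    have h6 : unitScale Q h ^ (2 * j + 2) ≤ a ^ (2 * j + 2) * (1 - 1 / p) := by
      rw [unitScale_mul_prime hp hQp, mul_pow]
      gcongr
      exact pow_le_of_le_one q1 q2 (by omega)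
    have h7 := ih
    calc unitMoment (2 * j + 2) (Q * p) h
        ≤ unitMoment (2 * j + 2) Q h + 2 ^ (2 * j + 2) * (M * a ^ (2 * j + 2)) / p +
          2 ^ (2 * j + 2) * (M * a ^ (2 * j + 2)) / p := by linarith
      _ ≤ (C + 2 * 2 ^ (2 * j + 2) * B) * (h : ℝ) ^ ε * (a ^ (2 * j + 2) * (1 - 1 / p)) +
          2 ^ (2 * j + 2) * (M * a ^ (2 * j + 2)) / p +
          2 ^ (2 * j + 2) * (M * a ^ (2 * j + 2)) / p := by
          gcongr
          exact h7.trans (mul_le_mul_of_nonneg_left h6 (by positivity))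
      _ = (C + 2 * 2 ^ (2 * j + 2) * B) * (h : ℝ) ^ ε * a ^ (2 * j + 2) -
          C * (h : ℝ) ^ ε * a ^ (2 * j + 2) / p := by
          rw [hMdef]
          ring
      _ ≤ _ := by
          have : 0 ≤ C * (h : ℝ) ^ ε * a ^ (2 * j + 2) / p := by positivity
          linarith

/-- The absolute moments of `unitDev`. -/
lemma exists_expect_abs_unitDev_le {ε : ℝ} (hε : 0 < ε) (j : ℕ) :
    ∃ B : ℝ, 1 ≤ B ∧ ∀ (Q h : ℕ) [NeZero Q], 1 ≤ h → Squarefree Q → ∀ i ≤ 2 * j,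
      𝔼 y, |unitDev Q h y| ^ i ≤ B * (h : ℝ) ^ ε * unitScale Q h ^ i := by
  induction j with
  | zero =>
    refine ⟨1, le_rfl, fun Q h _ hh _ i hi => ?_⟩
    obtain rfl : i = 0 := by omega
    have hh' : (1 : ℝ) ≤ h := by exact_mod_cast hh
    simpa [Fintype.expect_const] using Real.one_le_rpow hh' hε.le
  | succ j ih =>
    obtain ⟨B, hB1, hB⟩ := ih
    obtain ⟨B', hBB', hB'⟩ := expect_abs_unitDev_even_le hε j (by linarith) hB
    refine ⟨B', by linarith, fun Q h _ hh hQ i hi => ?_⟩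
    have hh' : (1 : ℝ) ≤ h := by exact_mod_cast hh
    set a := unitScale Q h with ha
    have ha1 : 1 ≤ a := (Real.one_le_sqrt.2 hh').trans (sqrt_le_unitScale (NeZero.pos Q) h)
    have hW : 0 ≤ (h : ℝ) ^ ε := by positivity
    have hlow : ∀ i ≤ 2 * j, 𝔼 y, |unitDev Q h y| ^ i ≤ B' * (h : ℝ) ^ ε * a ^ i := fun i hi =>
      (hB Q h hh hQ i hi).trans (by gcongr)
    have htop : 𝔼 y, |unitDev Q h y| ^ (2 * j + 2) ≤ B' * (h : ℝ) ^ ε * a ^ (2 * j + 2) := by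
      have := hB' Q h hh hQ
      rw [unitMoment_eq_expect] at this
      refine le_trans (le_of_eq (Finset.expect_congr rfl fun y _ => ?_)) this
      rw [← abs_pow, abs_of_nonneg (Even.pow_nonneg ⟨j + 1, by ring⟩ _)]
    obtain hi' | rfl | rfl : i ≤ 2 * j ∨ i = 2 * j + 1 ∨ i = 2 * j + 2 := by omega
    · exact hlow i hi'
    -- The odd moment is interpolated between its even neighbours by the arithmetic-geometric mean
    -- inequality at scale a.
    · have hpt : ∀ y, |unitDev Q h y| ^ (2 * j + 1) ≤
          1 / 2 * (a * |unitDev Q h y| ^ (2 * j) + a⁻¹ * |unitDev Q h y| ^ (2 * j + 2)) := by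
        intro y
        set x := |unitDev Q h y|
        have hx : 0 ≤ x ^ (2 * j) := by positivity
        have h1 : x ≤ 1 / 2 * (a + a⁻¹ * x ^ 2) := by
          have h2 : 1 / 2 * (a + a⁻¹ * x ^ 2) - x = 1 / 2 * a⁻¹ * (a - x) ^ 2 := by
            field_simp
            ring
          have h3 : 0 ≤ 1 / 2 * a⁻¹ * (a - x) ^ 2 := by positivity
          linarith
        calc x ^ (2 * j + 1) = x * x ^ (2 * j) := by ring
          _ ≤ 1 / 2 * (a + a⁻¹ * x ^ 2) * x ^ (2 * j) := by gcongr
          _ = _ := by ring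
      calc 𝔼 y, |unitDev Q h y| ^ (2 * j + 1)
          ≤ 1 / 2 * (a * 𝔼 y, |unitDev Q h y| ^ (2 * j) +
            a⁻¹ * 𝔼 y, |unitDev Q h y| ^ (2 * j + 2)) := by
            rw [Finset.mul_expect, Finset.mul_expect, ← Finset.expect_add_distrib,
              Finset.mul_expect]
            exact Finset.expect_le_expect fun y _ => hpt y
        _ ≤ 1 / 2 * (a * (B' * (h : ℝ) ^ ε * a ^ (2 * j)) +
            a⁻¹ * (B' * (h : ℝ) ^ ε * a ^ (2 * j + 2))) := by
            gcongr
            exact hlow _ le_rfl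
        _ = _ := by
            field_simp
            ring
    · exact htop

/-- The deviation of a moment of `unitDev` from the corresponding Gaussian moment. -/
noncomputable def gaussDev (k Q h : ℕ) [NeZero Q] : ℝ :=
  unitMoment k Q h - gaussMoment k * unitMoment 2 Q h ^ (k / 2)

lemma unitMoment_zero (Q h : ℕ) [NeZero Q] : unitMoment 0 Q h = 1 := by
  rw [unitMoment_eq_expect]
  simp [Fintype.expect_const]

lemma unitMoment_one (Q h : ℕ) [NeZero Q] : unitMoment 1 Q h = 0 := by
  simp [unitMoment, sum_unitDev]

/-- For m = 0 the error in the general step involves no moments at all, so it may be taken with M =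
0 and the step is an identity. -/
lemma unitMoment_two_mul_prime {Q p h : ℕ} [NeZero Q] [NeZero (Q * p)] (hp : p.Prime)
    (hQp : Nat.Coprime Q p) (hh : h ≤ p) (h1 : 1 ≤ h) :
    unitMoment 2 (Q * p) h = unitMoment 2 Q h + 𝔼 y : ZMod Q, primeVar Q p h y := by
  have := abs_unitMoment_mul_prime_sub_le hp hQp hh h1 0 le_rfl (by omega)
  simp only [zero_add, zero_mul, mul_zero, zero_div, pow_zero, one_mul, Nat.choose_self,
    Nat.cast_one] at this
  have h0 := abs_nonpos_iff.1 this
  linarith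

/-- The effect of one prime larger than `h` on `gaussDev`. -/
lemma abs_gaussDev_mul_prime_le {Q p h : ℕ} [NeZero Q] [NeZero (Q * p)] (hp : p.Prime)
    (hQp : Nat.Coprime Q p) (hh : h ≤ p) (h1 : 1 ≤ h) (m : ℕ) {M : ℝ} (hM1 : 1 ≤ M)
    (hM : ∀ i ≤ m + 2, 𝔼 y, |unitDev Q h y| ^ i ≤ M * unitScale (Q * p) h ^ i) :
    |gaussDev (m + 2) (Q * p) h| ≤ |gaussDev (m + 2) Q h| +
      (2 ^ (m + 2) * unitScale (Q * p) h ^ 2 * |gaussDev m Q h| +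
        (3 * 2 ^ (m + 2) + gaussMoment (m + 2) *
          (((m / 2 : ℕ) + 1) ^ 2 * 2 ^ (m + 2) + 2 * ((m / 2 : ℕ) + 1))) *
          (M ^ (m + 2) * unitScale (Q * p) h ^ (m + 2) / √h)) / p := by
  have hh1 : (1 : ℝ) ≤ h := by exact_mod_cast h1
  have hs1 : 1 ≤ √(h : ℝ) := Real.one_le_sqrt.2 hh1
  have hp0 : (0 : ℝ) < p := by exact_mod_cast hp.pos
  have hM0 : 0 ≤ M := by linarith
  set a := unitScale (Q * p) h with ha
  have ha0 : 0 ≤ a := unitScale_nonneg _ _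
  set v₀ := meanVar Q p h with hv₀
  obtain ⟨hv0, hva⟩ := meanVar_mem (Q := Q) hh hp
  set w := 𝔼 y : ZMod Q, primeVar Q p h y with hw
  have hw0 : 0 ≤ w := Finset.expect_nonneg fun y _ => (primeVar_mem hh hp y).1
  have hwa : w ≤ a ^ 2 / p := Finset.expect_le Finset.univ_nonempty fun y _ =>
    (primeVar_mem hh hp y).2
  have hV' := unitMoment_two_mul_prime hp hQp hh h1
  rw [← hw] at hV'
  set V := unitMoment 2 Q h with hV
  have hV0 : 0 ≤ V := by
    rw [hV, unitMoment_eq_expect]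
    exact Finset.expect_nonneg fun y _ => sq_nonneg _
  have hVa : V ≤ M * a ^ 2 := by
    rw [hV, unitMoment_eq_expect]
    simpa using hM 2 (by omega)
  have H1 := abs_unitMoment_mul_prime_sub_le hp hQp hh h1 m hM0 fun i hi => hM i (by omega)
  rw [← ha] at H1
  have Hv := fun y : ZMod Q => abs_primeVar_sub_meanVar_le hp hQp hh h1 y
  simp only [← ha, ← hv₀] at Hv
  have H2 : |𝔼 y, unitDev Q h y ^ m * primeVar Q p h y - v₀ * unitMoment m Q h| ≤
      2 * (M * a ^ (m + 2)) / (p * √h) := by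
    rw [unitMoment_eq_expect, Finset.mul_expect, ← Finset.expect_sub_distrib]
    refine (Finset.abs_expect_le _ _).trans ?_
    calc 𝔼 y, |unitDev Q h y ^ m * primeVar Q p h y - v₀ * unitDev Q h y ^ m|
        ≤ 𝔼 y, 2 * a / (p * √h) * |unitDev Q h y| ^ (m + 1) := by
          refine Finset.expect_le_expect fun y _ => ?_
          rw [mul_comm v₀, ← mul_sub, abs_mul, abs_pow]
          calc |unitDev Q h y| ^ m * |primeVar Q p h y - v₀|
              ≤ |unitDev Q h y| ^ m * (2 * a / (p * √h) * |unitDev Q h y|) := by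
                gcongr
                exact Hv y
            _ = _ := by ring
      _ ≤ 2 * a / (p * √h) * (M * a ^ (m + 1)) := by
          rw [← Finset.mul_expect]
          gcongr
          exact hM _ (by omega)
      _ = _ := by ring
  have H4 : |w - v₀| ≤ 2 * (M * a ^ 2) / (p * √h) := by
    have e : w - v₀ = 𝔼 y : ZMod Q, (primeVar Q p h y - v₀) := by
      rw [Finset.expect_sub_distrib, Fintype.expect_const]
    rw [e]
    refine (Finset.abs_expect_le _ _).trans ?_
    calc 𝔼 y : ZMod Q, |primeVar Q p h y - v₀|
        ≤ 𝔼 y : ZMod Q, 2 * a / (p * √h) * |unitDev Q h y| :=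
          Finset.expect_le_expect fun y _ => Hv y
      _ ≤ 2 * a / (p * √h) * (M * a) := by
          rw [← Finset.mul_expect]
          gcongr
          simpa using hM 1 (by omega)
      _ = _ := by ring
  set n := m / 2 with hn
  have H5 : |(V + w) ^ (n + 1) - V ^ (n + 1) - (n + 1) * (w * V ^ n)| ≤
      ((n : ℝ) + 1) ^ 2 * ((1 / p) ^ 2 * (2 * M * a ^ 2) ^ (n + 1)) := by
    have hp1 : (1 : ℝ) ≤ p := by exact_mod_cast hp.one_le
    have hap : a ^ 2 / p ≤ a ^ 2 := div_le_self (by positivity) hp1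
    refine abs_add_pow_sub_sub_le hV0 hw0 ?_ ?_ n
    · nlinarith [sq_nonneg a]
    · refine hwa.trans ?_
      rw [div_eq_mul_one_div, mul_comm]
      gcongr
      nlinarith [sq_nonneg a]
  -- Four errors: terms of third order, the variance replaced by its central value v₀, the deviation
  -- of the m-th moment, and the Taylor expansion of V^(n+1). The main terms cancel by
  -- `choose_two_mul_gaussMoment`.
  have hdecomp : gaussDev (m + 2) (Q * p) h = gaussDev (m + 2) Q h +
      ((unitMoment (m + 2) (Q * p) h - unitMoment (m + 2) Q h -
        ((m + 2).choose 2 : ℝ) * 𝔼 y, unitDev Q h y ^ m * primeVar Q p h y) +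
      (((m + 2).choose 2 : ℝ) * (𝔼 y, unitDev Q h y ^ m * primeVar Q p h y -
        v₀ * unitMoment m Q h) +
      (((m + 2).choose 2 : ℝ) * (v₀ * gaussDev m Q h) -
      (gaussMoment (m + 2) * (((V + w) ^ (n + 1) - V ^ (n + 1) - (n + 1) * (w * V ^ n)) +
        (n + 1) * ((w - v₀) * V ^ n)))))) := by
    have hC := choose_two_mul_gaussMoment m
    rw [← hn] at hC
    unfold gaussDev
    rw [hV', ← hV, show (m + 2) / 2 = n + 1 by omega, ← hn]
    linear_combination v₀ * V ^ n * hC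
  have hch : ((m + 2).choose 2 : ℝ) ≤ 2 ^ (m + 2) := by exact_mod_cast Nat.choose_le_two_pow _ _
  have hMM : M ≤ M ^ (m + 2) := le_self_pow₀ hM1 (by omega)
  set T := M ^ (m + 2) * a ^ (m + 2) / √h / p with hT
  have hT0 : 0 ≤ T := by positivity
  have hMT : M * a ^ (m + 2) / (p * √h) ≤ T := by
    rw [hT, div_div, mul_comm (√(h : ℝ))]
    gcongr
  have B1 : |unitMoment (m + 2) (Q * p) h - unitMoment (m + 2) Q h -
      ((m + 2).choose 2 : ℝ) * 𝔼 y, unitDev Q h y ^ m * primeVar Q p h y| ≤ 2 ^ (m + 2) * T := by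
    refine H1.trans ?_
    rw [mul_div_assoc]
    gcongr
  have B2 : |((m + 2).choose 2 : ℝ) * (𝔼 y, unitDev Q h y ^ m * primeVar Q p h y -
      v₀ * unitMoment m Q h)| ≤ 2 ^ (m + 2) * (2 * T) := by
    rw [abs_mul, abs_of_nonneg (Nat.cast_nonneg _ : (0 : ℝ) ≤ _)]
    gcongr
    refine H2.trans ?_
    rw [mul_div_assoc]
    gcongr
  have B3 : |((m + 2).choose 2 : ℝ) * (v₀ * gaussDev m Q h)| ≤
      2 ^ (m + 2) * (a ^ 2 / p * |gaussDev m Q h|) := by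
    rw [abs_mul, abs_mul, abs_of_nonneg (Nat.cast_nonneg _ : (0 : ℝ) ≤ _), abs_of_nonneg hv0]
    gcongr
  have B4 : |gaussMoment (m + 2) * (((V + w) ^ (n + 1) - V ^ (n + 1) - (n + 1) * (w * V ^ n)) +
        (n + 1) * ((w - v₀) * V ^ n))| ≤
      gaussMoment (m + 2) * (((n : ℝ) + 1) ^ 2 * 2 ^ (m + 2) + 2 * ((n : ℝ) + 1)) * T := by
    by_cases hm : Even m
    · have hm2 : m = 2 * n := by obtain ⟨r, hr⟩ := hm; omega
      rw [abs_mul, abs_of_nonneg (Nat.cast_nonneg _ : (0 : ℝ) ≤ _), mul_assoc]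
      refine mul_le_mul_of_nonneg_left ?_ (Nat.cast_nonneg _)
      refine (abs_add_le _ _).trans ?_
      rw [add_mul (((n : ℝ) + 1) ^ 2 * 2 ^ (m + 2))]
      refine add_le_add (H5.trans ?_) ?_
      · rw [mul_assoc (((n : ℝ) + 1) ^ 2)]
        refine mul_le_mul_of_nonneg_left ?_ (sq_nonneg _)
        -- The second-order Taylor error has 1/p²; one of these factors is traded for 1/√h, since √h
        -- ≤ h ≤ p.
        have e1 : (1 / (p : ℝ)) ^ 2 ≤ 1 / (√h * p) := by
          rw [one_div_pow]
          refine one_div_le_one_div_of_le (by positivity) ?_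
          rw [sq]
          gcongr
          have h3 : √(h : ℝ) ≤ h := Real.sqrt_le_iff.2 ⟨by linarith, by nlinarith⟩
          have h4 : (h : ℝ) ≤ p := by exact_mod_cast hh
          linarith
        have e2 : (2 * M * a ^ 2) ^ (n + 1) ≤ 2 ^ (m + 2) * (M ^ (m + 2) * a ^ (m + 2)) := by
          rw [mul_pow, mul_pow, ← pow_mul, show 2 * (n + 1) = m + 2 by omega, mul_assoc]
          have e3 : (2 : ℝ) ^ (n + 1) ≤ 2 ^ (m + 2) := pow_le_pow_right₀ one_le_two (by omega)
          have e4 : M ^ (n + 1) ≤ M ^ (m + 2) := pow_le_pow_right₀ hM1 (by omega)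
          gcongr
        calc (1 / (p : ℝ)) ^ 2 * (2 * M * a ^ 2) ^ (n + 1)
            ≤ 1 / (√h * p) * (2 ^ (m + 2) * (M ^ (m + 2) * a ^ (m + 2))) := by gcongr
          _ = _ := by rw [hT]; field_simp
      · rw [abs_mul, abs_mul, abs_of_nonneg (pow_nonneg hV0 n),
          abs_of_nonneg (by positivity : (0 : ℝ) ≤ (n : ℝ) + 1)]
        calc ((n : ℝ) + 1) * (|w - v₀| * V ^ n)
            ≤ ((n : ℝ) + 1) * (2 * (M * a ^ 2) / (p * √h) * (M * a ^ 2) ^ n) := by gcongr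
          _ = 2 * ((n : ℝ) + 1) * (M ^ (n + 1) * a ^ (2 * (n + 1)) / √h / p) := by
              rw [pow_mul]
              field_simp
              ring
          _ ≤ _ := by
              rw [hT, show 2 * (n + 1) = m + 2 by omega]
              gcongr ?_ * (?_ * _ / _ / _)
              exact pow_le_pow_right₀ hM1 (by omega)
    · have : gaussMoment (m + 2) = 0 := by
        rw [gaussMoment_add_two]
        simp [gaussMoment, hm]
      simp [this]
  rw [hdecomp]
  refine (abs_add_le _ _).trans ((add_le_add le_rfl ((abs_add_le _ _).trans (add_le_add B1
    ((abs_add_le _ _).trans (add_le_add B2 ((abs_sub _ _).trans (add_le_add B3 B4))))))).trans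
    (le_of_eq ?_))
  rw [hT]
  ring

lemma gaussDev_zero (Q h : ℕ) [NeZero Q] : gaussDev 0 Q h = 0 := by
  simp [gaussDev, unitMoment_zero, gaussMoment]

lemma gaussDev_one (Q h : ℕ) [NeZero Q] : gaussDev 1 Q h = 0 := by
  simp [gaussDev, unitMoment_one, gaussMoment]

/-- The moments of `unitDev` are close to the Gaussian ones, for all squarefree moduli. -/
lemma exists_abs_gaussDev_le (K : ℕ) (hK : 1 ≤ K) (k : ℕ) (hk : k ≤ K) :
    ∃ A : ℝ, 0 < A ∧ ∀ (Q h : ℕ) [NeZero Q], 1 ≤ h → Squarefree Q →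
      |gaussDev k Q h| ≤ A * (h : ℝ) ^ (-(1 / (7 * (K : ℝ)))) *
        (unitScale Q h ^ k * (unitDensity Q)⁻¹) := by
  have hKR : (1 : ℝ) ≤ K := by exact_mod_cast hK
  have hdens : ∀ Q : ℕ, 0 ≤ (unitDensity Q)⁻¹ := fun Q =>
    inv_nonneg.2 (by unfold unitDensity; positivity)
  induction k using Nat.strong_induction_on with
  | _ k ih =>
  obtain rfl | rfl | ⟨m, rfl⟩ : k = 0 ∨ k = 1 ∨ ∃ m, k = m + 2 := by
    rcases k with _ | _ | m
    · exact Or.inl rfl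
    · exact Or.inr (Or.inl rfl)
    · exact Or.inr (Or.inr ⟨m, rfl⟩)
  · refine ⟨1, one_pos, fun Q h _ _ _ => ?_⟩
    rw [gaussDev_zero, abs_zero]
    exact mul_nonneg (by positivity) (mul_nonneg (pow_nonneg (unitScale_nonneg _ _) _) (hdens Q))
  · refine ⟨1, one_pos, fun Q h _ _ _ => ?_⟩
    rw [gaussDev_one, abs_zero]
    exact mul_nonneg (by positivity) (mul_nonneg (pow_nonneg (unitScale_nonneg _ _) _) (hdens Q))
  obtain ⟨A₀, hA₀, H₀⟩ := ih m (by omega) (by omega)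
  obtain ⟨C, hC, hbase⟩ := exists_abs_unitMoment_sub_gaussMoment_le (m + 2) (by omega)
  -- The moment bounds enter to the power m + 2 ≤ K, so they lose at most h^(1/4) of the gain √h.
  have hε : (0 : ℝ) < 1 / (4 * K) := by positivity
  obtain ⟨B, hB1, hB⟩ := exists_expect_abs_unitDev_le hε (m + 2)
  set c : ℝ := 3 * 2 ^ (m + 2) + gaussMoment (m + 2) *
    (((m / 2 : ℕ) + 1) ^ 2 * 2 ^ (m + 2) + 2 * ((m / 2 : ℕ) + 1)) with hc
  have hc0 : 0 ≤ c := by positivity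
  set A : ℝ := C + (2 ^ (m + 2) * A₀ + c * B ^ (m + 2)) with hA
  have hA0 : 0 < A := by positivity
  refine ⟨A, hA0, fun Q h _ hh hQ => ?_⟩
  have hh1 : (1 : ℝ) ≤ h := by exact_mod_cast hh
  have hh0 : (0 : ℝ) < h := by linarith
  set η : ℝ := 1 / (7 * (K : ℝ)) with hη
  suffices H : ∀ [NeZero Q], |gaussDev (m + 2) Q h| ≤ A * (h : ℝ) ^ (-η) *
        (unitScale Q h ^ (m + 2) * (unitDensity Q)⁻¹) from H
  refine Squarefree.induction_large_primes (h := h) (motive := fun Q => ∀ [NeZero Q],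
    |gaussDev (m + 2) Q h| ≤ A * (h : ℝ) ^ (-η) *
        (unitScale Q h ^ (m + 2) * (unitDensity Q)⁻¹)) ?_ ?_ Q hQ
  · intro Q hQ hQh _
    refine (hbase Q h hh hQ hQh).trans ?_
    have hkK : ((m + 2 : ℕ) : ℝ) ≤ K := by exact_mod_cast hk
    have hk0 : (0 : ℝ) < ((m + 2 : ℕ) : ℝ) := by positivity
    calc C * (h : ℝ) ^ (((m + 2 : ℕ) : ℝ) / 2 - 1 / (7 * ((m + 2 : ℕ) : ℝ)))
        ≤ C * (h : ℝ) ^ (-η + ((m + 2 : ℕ) : ℝ) / 2) := by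
          refine mul_le_mul_of_nonneg_left
            (Real.rpow_le_rpow_of_exponent_le hh1 ?_) hC.le
          have : η ≤ 1 / (7 * ((m + 2 : ℕ) : ℝ)) := by rw [hη]; gcongr
          linarith
      _ = C * (h : ℝ) ^ (-η) * (√h ^ (m + 2) * 1) := by
          rw [Real.rpow_add hh0, rpow_half_mul hh0.le]
          ring
      _ ≤ _ := by
          gcongr
          · rw [hA]
            have : 0 ≤ 2 ^ (m + 2) * A₀ + c * B ^ (m + 2) := by positivity
            linarith
          · exact pow_nonneg (unitScale_nonneg _ _) _
          · exact sqrt_le_unitScale (NeZero.pos Q) h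
          · exact (one_le_inv₀ (unitDensity_pos (NeZero.pos Q))).2 (unitDensity_le_one Q)
  · intro Q p hp hQp hhp hQ ihQ _
    have : NeZero Q := ⟨hQ.ne_zero⟩
    have hp0 : (0 : ℝ) < p := by exact_mod_cast hp.pos
    obtain ⟨q1, q2⟩ := one_sub_inv_mem hp
    set a := unitScale (Q * p) h with ha
    have ha0 : 0 ≤ a := unitScale_nonneg _ _
    set R := (unitDensity (Q * p))⁻¹ with hR
    have hR0 : 0 ≤ R := hdens _
    have hR1 : 1 ≤ R := (one_le_inv₀ (unitDensity_pos (NeZero.pos (Q * p)))).2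
      (unitDensity_le_one _)
    set ε : ℝ := 1 / (4 * K) with hεdef
    set W := (h : ℝ) ^ ε with hW
    have hW1 : 1 ≤ W := Real.one_le_rpow hh1 hε.le
    have hstep := abs_gaussDev_mul_prime_le hp hQp hhp.le hh m (M := B * W)
      (one_le_mul_of_one_le_of_one_le hB1 hW1) (fun i hi => (hB Q h hh hQ i (by omega)).trans
        (mul_le_mul_of_nonneg_left (unitScale_pow_le hp hQp i) (by positivity)))
    rw [← hc, ← ha] at hstep
    have hWh : W ^ (m + 2) / √h ≤ (h : ℝ) ^ (-η) := by
      rw [hW, ← Real.rpow_mul_natCast hh0.le, Real.sqrt_eq_rpow, ← Real.rpow_sub hh0]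
      refine Real.rpow_le_rpow_of_exponent_le hh1 ?_
      have hkK : ((m + 2 : ℕ) : ℝ) ≤ K := by exact_mod_cast hk
      have e1 : ε * ((m + 2 : ℕ) : ℝ) ≤ 1 / 4 := by
        calc ε * ((m + 2 : ℕ) : ℝ) ≤ ε * K := by gcongr
          _ = 1 / 4 := by rw [hεdef]; field_simp
      have e2 : η ≤ 1 / 7 := by
        rw [hη]
        exact one_div_le_one_div_of_le (by norm_num) (by linarith)
      linarith
    have g1 : |gaussDev (m + 2) Q h| ≤ A * (h : ℝ) ^ (-η) * (a ^ (m + 2) * R * (1 - 1 / p)) := by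
      refine ihQ.trans ?_
      rw [unitScale_mul_prime hp hQp, inv_unitDensity_mul_prime hp hQp, mul_pow]
      refine mul_le_mul_of_nonneg_left ?_ (by positivity)
      -- Only the factor 1 - 1/p from the extra inverse density is kept; it pays for the error terms
      -- over p.
      calc a ^ (m + 2) * (1 - 1 / (p : ℝ)) ^ (m + 2) * (R * (1 - 1 / p))
          ≤ a ^ (m + 2) * 1 * (R * (1 - 1 / p)) := by
            gcongr
            exact pow_le_one₀ q1 q2
        _ = _ := by ring
    have g2 : |gaussDev m Q h| ≤ A₀ * (h : ℝ) ^ (-η) * (a ^ m * R) := by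
      refine (H₀ Q h hh hQ).trans ?_
      rw [inv_unitDensity_mul_prime hp hQp]
      gcongr
      · exact unitScale_nonneg _ _
      · simpa using unitScale_pow_le (h := h) hp hQp 1
      · exact mul_le_of_le_one_right hR0 q2
    calc |gaussDev (m + 2) (Q * p) h|
        ≤ A * (h : ℝ) ^ (-η) * (a ^ (m + 2) * R * (1 - 1 / p)) +
          (2 ^ (m + 2) * a ^ 2 * (A₀ * (h : ℝ) ^ (-η) * (a ^ m * R)) +
            c * ((B * W) ^ (m + 2) * a ^ (m + 2) / √h)) / p := by
          refine hstep.trans ?_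
          gcongr
      _ = A * (h : ℝ) ^ (-η) * (a ^ (m + 2) * R * (1 - 1 / p)) +
          (2 ^ (m + 2) * A₀ * ((h : ℝ) ^ (-η) * (a ^ (m + 2) * R)) +
            c * B ^ (m + 2) * (W ^ (m + 2) / √h * (a ^ (m + 2) * 1))) / p := by
          rw [mul_pow B W]
          ring
      _ ≤ A * (h : ℝ) ^ (-η) * (a ^ (m + 2) * R * (1 - 1 / p)) +
          (2 ^ (m + 2) * A₀ * ((h : ℝ) ^ (-η) * (a ^ (m + 2) * R)) +
            c * B ^ (m + 2) * ((h : ℝ) ^ (-η) * (a ^ (m + 2) * R))) / p := by gcongr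
      _ = A * (h : ℝ) ^ (-η) * (a ^ (m + 2) * R) -
          C * ((h : ℝ) ^ (-η) * (a ^ (m + 2) * R)) / p := by
          rw [hA]; ring
      _ ≤ _ := by
          have : 0 ≤ C * ((h : ℝ) ^ (-η) * (a ^ (m + 2) * R)) / p := by positivity
          linarith

/-! ### Reduction to squarefree moduli and to intervals; conclusion -/

lemma coprime_prod_primeFactors_iff {n Q : ℕ} (hQ : Q ≠ 0) :
    Nat.Coprime n (∏ p ∈ Q.primeFactors, p) ↔ Nat.Coprime n Q := by
  refine ⟨fun h => ?_, fun h => h.coprime_dvd_right (Nat.prod_primeFactors_dvd Q)⟩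
  refine Nat.coprime_of_dvd fun p hp hpn hpQ => ?_
  have h1 : p ∣ ∏ p ∈ Q.primeFactors, p :=
    Finset.dvd_prod_of_mem _ (Nat.mem_primeFactors.2 ⟨hp, hpQ, hQ⟩)
  have h2 := Nat.dvd_gcd hpn h1
  rw [Nat.Coprime] at h
  rw [h] at h2
  exact hp.one_lt.ne' (Nat.dvd_one.1 h2)

lemma squarefree_prod_primeFactors (Q : ℕ) : Squarefree (∏ p ∈ Q.primeFactors, p) := by
  refine Finset.squarefree_prod_of_pairwise_isCoprime (fun p hp r hr hpr => ?_)
    fun p hp => (Nat.prime_of_mem_primeFactors hp).squarefree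
  simp only [Function.onFun, ← Nat.coprime_iff_isRelPrime]
  exact (Nat.coprime_primes (Nat.prime_of_mem_primeFactors hp)
    (Nat.prime_of_mem_primeFactors hr)).2 hpr

lemma unitDensity_prod_primeFactors {Q : ℕ} (hQ : Q ≠ 0) :
    unitDensity (∏ p ∈ Q.primeFactors, p) = unitDensity Q := by
  have hprime : ∀ p ∈ Q.primeFactors, p.Prime := fun p hp => Nat.prime_of_mem_primeFactors hp
  have h1 := Nat.totient_mul_prod_primeFactors Q
  have h2 := Nat.totient_mul_prod_primeFactors (∏ p ∈ Q.primeFactors, p)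
  rw [Nat.primeFactors_prod hprime] at h2
  have hR : 0 < ∏ p ∈ Q.primeFactors, p := Finset.prod_pos fun p hp => (hprime p hp).pos
  unfold unitDensity
  have hR' : ((∏ p ∈ Q.primeFactors, p : ℕ) : ℝ) ≠ 0 := by exact_mod_cast hR.ne'
  have hQ' : (Q : ℝ) ≠ 0 := by exact_mod_cast hQ
  rw [div_eq_div_iff hR' hQ']
  have h3 : (∏ p ∈ Q.primeFactors, p).totient = ∏ p ∈ Q.primeFactors, (p - 1) := by
    rw [mul_comm] at h2
    exact Nat.eq_of_mul_eq_mul_left hR h2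
  have h4 : (∏ p ∈ Q.primeFactors, p).totient * Q = Q.totient * ∏ p ∈ Q.primeFactors, p := by
    rw [h3, h1, mul_comm]
  exact_mod_cast h4

lemma sum_range_mul_natCast {R : ℕ} [NeZero R] (c : ℕ) (F : ZMod R → ℝ) :
    ∑ m ∈ Finset.range (R * c), F m = c * ∑ z, F z := by
  induction c with
  | zero => simp
  | succ c ih =>
    rw [Nat.mul_succ, Finset.sum_range_add, ih, ZMod.sum_eq_sum_range F]
    push_cast
    simp only [CharP.cast_eq_zero, zero_mul, zero_add]
    ring

/-- The progression, parametrized. -/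
lemma exists_progression_eq_image {N q : ℕ} (a : ℤ) (hq : 2 ≤ q) (hN : 2 * q ≤ N) :
    ∃ n₀ h : ℕ, progression N q a = (Finset.range h).image (fun j => n₀ + q * j) ∧
      1 ≤ h ∧ (N : ℝ) / q / 2 ≤ h ∧ (h : ℝ) ≤ 3 / 2 * ((N : ℝ) / q) := by
  have hq0 : (0 : ℤ) < q := by exact_mod_cast (by omega : 0 < q)
  -- Reducing a - 1 and not a makes r + 1 the representative in [1, q], which is the first term of
  -- the progression.
  obtain ⟨r, hr⟩ := Int.eq_ofNat_of_zero_le (Int.emod_nonneg (a - 1) hq0.ne')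
  have hrq : r < q := by
    have := Int.emod_lt_of_pos (a - 1) hq0
    omega
  have hr' : ((r + 1 : ℕ) : ℤ) ≡ a [ZMOD q] := by
    have h1 : (r : ℤ) ≡ a - 1 [ZMOD q] := by
      rw [← hr]
      exact Int.mod_modEq _ _
    have := h1.add_right 1
    simpa using this
  have hlt : N - (r + 1) < q * ((N - (r + 1)) / q + 1) := Nat.lt_mul_div_succ _ (by omega)
  have hle : q * ((N - (r + 1)) / q) ≤ N - (r + 1) := Nat.mul_div_le _ _
  set h := (N - (r + 1)) / q + 1 with hh
  refine ⟨r + 1, h, ?_, Nat.le_add_left 1 _, ?_, ?_⟩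
  · ext n
    simp only [progression, Finset.mem_filter, Finset.mem_Icc, Finset.mem_image, Finset.mem_range]
    constructor
    · rintro ⟨⟨h1, h2⟩, h3⟩
      have h4 : (q : ℤ) ∣ n - (r + 1 : ℕ) := (Int.modEq_iff_dvd.1 (hr'.trans h3.symm))
      obtain ⟨j, hj⟩ := h4
      have hj0 : 0 ≤ j := by
        by_contra hcon
        have : (q : ℤ) * j ≤ q * (-1) := mul_le_mul_of_nonneg_left (by omega) hq0.le
        push_cast at hj
        omega
      obtain ⟨i, rfl⟩ := Int.eq_ofNat_of_zero_le hj0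
      have hn : n = r + 1 + q * i := by
        have : (n : ℤ) = ((r + 1 + q * i : ℕ) : ℤ) := by push_cast at hj ⊢; linarith
        exact_mod_cast this
      refine ⟨i, ?_, hn.symm⟩
      by_contra hcon
      have : q * h ≤ q * i := Nat.mul_le_mul_left q (by omega)
      omega
    · rintro ⟨j, hj, rfl⟩
      have h1 : q * j ≤ q * ((N - (r + 1)) / q) := Nat.mul_le_mul_left q (by omega)
      refine ⟨⟨by omega, by omega⟩, ?_⟩
      have h2 : ((r + 1 + q * j : ℕ) : ℤ) ≡ ((r + 1 : ℕ) : ℤ) [ZMOD q] := by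
        push_cast
        simp [Int.ModEq]
      exact h2.trans hr'
  · have hqR : (0 : ℝ) < q := by exact_mod_cast hq0
    have h1 : N < q * h + q := by omega
    have h1' : (N : ℝ) < q * h + q := by exact_mod_cast h1
    have h2' : 2 * (q : ℝ) ≤ N := by exact_mod_cast hN
    rw [div_div, div_le_iff₀ (by positivity)]
    nlinarith
  · have hqR : (0 : ℝ) < q := by exact_mod_cast hq0
    have h1 : q * h ≤ N + q := by
      have : q * h = q * ((N - (r + 1)) / q) + q := by rw [hh]; ring
      omega
    have h1' : (q : ℝ) * h ≤ N + q := by exact_mod_cast h1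
    have h2' : 2 * (q : ℝ) ≤ N := by exact_mod_cast hN
    rw [← mul_div_assoc, le_div_iff₀ hqR]
    nlinarith

/-- The moments `momentV` in terms of short intervals modulo `R`, where `R` is a divisor
of `Q` with the same prime factors. -/
lemma momentV_eq_unitMoment_of_dvd {Q R q N n₀ h : ℕ} [NeZero R] (a : ℤ) (hQ : Q ≠ 0) (hq : 2 ≤ q)
    (hqQ : Nat.Coprime q Q)
    (hprog : progression N q a = (Finset.range h).image (fun j => n₀ + q * j))
    (hRQ : R ∣ Q) (hcop : ∀ n, Nat.Coprime n R ↔ Nat.Coprime n Q)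
    (hden : unitDensity R = unitDensity Q) (k : ℕ) :
    momentV k Q q a N = unitMoment k R h := by
  obtain ⟨c, hc⟩ := hRQ
  have hqR : Nat.Coprime q R := (hcop q).2 hqQ
  have hcR : (c : ℝ) ≠ 0 := by
    intro h0
    have : c = 0 := by exact_mod_cast h0
    rw [this, mul_zero] at hc
    exact hQ hc
  have hRR : (R : ℝ) ≠ 0 := by exact_mod_cast NeZero.ne R
  -- Dividing n₀ + q j + m by the unit q gives y + j with y = q⁻¹(n₀ + m), so the progression
  -- becomes an interval and y is uniform when m is.
  set u := ZMod.unitOfCoprime q hqR with hu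
  have hcount : ∀ m : ℕ, normalizedCount Q q a N m =
      unitDev R h ((u⁻¹ : (ZMod R)ˣ) * ((n₀ : ZMod R) + (m : ZMod R))) := by
    intro m
    unfold normalizedCount unitDev
    rw [hprog, Finset.sum_image (fun i _ j _ hij =>
      Nat.eq_of_mul_eq_mul_left (by omega) (Nat.add_left_cancel hij))]
    refine Finset.sum_congr rfl fun j _ => ?_
    change unitDensity R = unitDensity Q at hden
    change (unitDensity Q)⁻¹ * _ - 1 = (unitDensity R)⁻¹ * _ - 1
    rw [hden]
    congr 2
    refine if_congr ?_ rfl rfl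
    rw [← hcop, ← ZMod.isUnit_iff_coprime, coprime_val_iff_isUnit]
    have e : ((n₀ + q * j + m : ℕ) : ZMod R) =
        u * (((u⁻¹ : (ZMod R)ˣ) : ZMod R) * ((n₀ : ZMod R) + (m : ZMod R)) + j) := by
      rw [mul_add, Units.mul_inv_cancel_left, hu, ZMod.coe_unitOfCoprime]
      push_cast
      ring
    rw [e, Units.isUnit_units_mul]
  obtain ⟨F, hF⟩ : ∃ F : ZMod R → ℝ, ∀ z, F z =
      unitDev R h ((u⁻¹ : (ZMod R)ˣ) * ((n₀ : ZMod R) + z)) ^ k := ⟨_, fun _ => rfl⟩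
  have h1 : ∑ m ∈ Finset.range Q, normalizedCount Q q a N m ^ k = c * ∑ z : ZMod R, F z := by
    rw [← sum_range_mul_natCast, ← hc]
    exact Finset.sum_congr rfl fun m _ => by rw [hF, hcount]
  have h2 : ∑ z : ZMod R, F z = ∑ y : ZMod R, unitDev R h y ^ k := by
    rw [← ((Equiv.addLeft (n₀ : ZMod R)).trans (Units.mulLeft u⁻¹)).sum_comp
      fun y => unitDev R h y ^ k]
    exact Finset.sum_congr rfl fun z _ => hF z
  unfold momentV unitMoment
  rw [h1, h2]
  have h3 : (Q : ℝ) = R * c := by exact_mod_cast hc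
  rw [h3]
  field_simp

lemma momentV_eq_unitMoment {Q q N n₀ h : ℕ} (a : ℤ) (hQ : Q ≠ 0) (hq : 2 ≤ q)
    (hqQ : Nat.Coprime q Q)
    (hprog : progression N q a = (Finset.range h).image (fun j => n₀ + q * j))
    [NeZero (∏ p ∈ Q.primeFactors, p)] (k : ℕ) :
    momentV k Q q a N = unitMoment k (∏ p ∈ Q.primeFactors, p) h :=
  momentV_eq_unitMoment_of_dvd a hQ hq hqQ hprog (Nat.prod_primeFactors_dvd Q)
    (fun _ => coprime_prod_primeFactors_iff hQ) (unitDensity_prod_primeFactors hQ) k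

lemma gaussMoment_mul_rpow (k : ℕ) (V : ℝ) :
    (gaussMoment k : ℝ) * V ^ ((k : ℝ) / 2) = gaussMoment k * V ^ (k / 2) := by
  by_cases hk : Even k
  · obtain ⟨j, rfl⟩ := hk
    rw [show (j + j) / 2 = j by omega, ← Real.rpow_natCast]
    congr 2
    push_cast
    ring
  · simp [gaussMoment, hk]

theorem proposition2p2 (k : ℕ) :
    ∃ C : ℝ, 0 < C ∧ ∀ (Q q N : ℕ) (a : ℤ), 1 ≤ Q → 2 ≤ q → Nat.Coprime q Q →
      IsCoprime a (q : ℤ) → 2 * q ≤ N →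
      (k = 0 →
        momentV k Q q a N = (gaussMoment k : ℝ) * momentV 2 Q q a N ^ ((k : ℝ) / 2)) ∧
      (1 ≤ k →
        |momentV k Q q a N - (gaussMoment k : ℝ) * momentV 2 Q q a N ^ ((k : ℝ) / 2)| ≤
          C * ((N : ℝ) / (q : ℝ)) ^ ((k : ℝ) / 2 - 1 / (7 * (k : ℝ))) *
            ((Nat.totient Q : ℝ) / (Q : ℝ)) ^ (-(2 : ℝ) ^ k - (k : ℝ) / 2)) := by
  rcases Nat.eq_zero_or_pos k with rfl | hk
  · refine ⟨1, one_pos, fun Q q N a hQ _ _ _ _ => ⟨fun _ => ?_, fun h => by omega⟩⟩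
    have hQ' : (Q : ℝ) ≠ 0 := by exact_mod_cast (by omega : Q ≠ 0)
    simp [momentV, gaussMoment, hQ']
  obtain ⟨A, hA, H⟩ := exists_abs_gaussDev_le k hk k le_rfl
  set e : ℝ := (k : ℝ) / 2 - 1 / (7 * (k : ℝ)) with he
  have hkR : (1 : ℝ) ≤ k := by exact_mod_cast hk
  have he0 : 0 ≤ e := by
    have : 1 / (7 * (k : ℝ)) ≤ 1 / 7 := one_div_le_one_div_of_le (by norm_num) (by linarith)
    rw [he]
    linarith
  -- The factor 3/2 is the upper bound for h relative to N/q; since e ≥ 0, only this upper bound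
  -- matters.
  refine ⟨A * (3 / 2) ^ e, by positivity, fun Q q N a hQ hq hqQ _ hN =>
    ⟨fun h => by omega, fun _ => ?_⟩⟩
  have hQ0 : Q ≠ 0 := by omega
  have hsq := squarefree_prod_primeFactors Q
  have : NeZero (∏ p ∈ Q.primeFactors, p) := ⟨hsq.ne_zero⟩
  obtain ⟨n₀, h, hprog, h1, -, hle⟩ := exists_progression_eq_image a hq hN
  rw [momentV_eq_unitMoment a hQ0 hq hqQ hprog, momentV_eq_unitMoment a hQ0 hq hqQ hprog]
  have hdev := H _ h h1 hsq
  unfold gaussDev at hdev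
  rw [gaussMoment_mul_rpow]
  refine hdev.trans ?_
  have hh1 : (1 : ℝ) ≤ h := by exact_mod_cast h1
  have hP := unitDensity_pos (Nat.pos_of_ne_zero hQ0)
  have hP1 := unitDensity_le_one Q
  -- The argument loses the exponent k + 1, which is at most 2^k; the density is at most 1, so the
  -- stated power is weaker.
  have hpow : (unitDensity Q)⁻¹ ^ k * (unitDensity Q)⁻¹ ≤
      unitDensity Q ^ (-(2 : ℝ) ^ k - (k : ℝ) / 2) := by
    rw [← pow_succ, inv_pow, ← Real.rpow_natCast, ← Real.rpow_neg hP.le]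
    refine Real.rpow_le_rpow_of_exponent_ge hP hP1 ?_
    have h2 : k + 1 ≤ 2 ^ k := Nat.lt_two_pow_self
    have h3 : ((k + 1 : ℕ) : ℝ) ≤ 2 ^ k := by exact_mod_cast h2
    linarith
  calc A * (h : ℝ) ^ (-(1 / (7 * (k : ℝ)))) *
        (unitScale (∏ p ∈ Q.primeFactors, p) h ^ k * (unitDensity (∏ p ∈ Q.primeFactors, p))⁻¹)
      = A * (h : ℝ) ^ e * ((unitDensity Q)⁻¹ ^ k * (unitDensity Q)⁻¹) := by
        rw [unitScale_eq, unitDensity_prod_primeFactors hQ0, mul_pow, ← rpow_half_mul (by linarith),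
          he, sub_eq_neg_add, Real.rpow_add (by linarith)]
        ring
    _ ≤ A * (3 / 2 * ((N : ℝ) / q)) ^ e * unitDensity Q ^ (-(2 : ℝ) ^ k - (k : ℝ) / 2) := by
        gcongr
    _ = _ := by
        rw [Real.mul_rpow (by norm_num) (by positivity), ← mul_assoc A]
        rfl
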